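/- Let $(F,\omega)$ be a closed (compact, without boundary) connected symplectic manifold and let $p:P\to N$ be a symplectic fibration with typical fiber $(F,\omega)$: $p$ is a smooth map of smooth manifolds that has smooth local trivializations $p^{-1}(U_i)\cong U_i\times F$ over an open cover $(U_i)$ of $N$ whose coordinate changes $g_{ij}(u):F\to F$ satisfy $g_{ij}(u)^*\omega=\omega$. For $u\in N$ let $F_u=p^{-1}(u)$, and let $i_u:F\to F_u\subset P$ be the embedding given by any of these trivializations. Let $\Omega$ be a closed $2$-form on $P$ whose class extends $[\omega]$, that is, $i_u^*[\Omega]=[\omega]$ in $H^2(F,\mathbb R)$ for all $u\in N$ (and all choices of $i_u$), and whose restriction to every fiber is nondegenerate (e.g. $i_u^*\Omega=\omega$ for all $u$), so that $$D^{\Omega}_x=\{v\in T_xP:\ \Omega_x(v,y)=0\ \text{ for all } y\in T_xF_{p(x)}\}$$ is a horizontal distribution. Let $\mathcal A$ be the set of closed $2$-forms $\Omega'$ on $P$ whose restriction to every fiber $F_u$ coincides with that of $\Omega$ and for which $D^{\Omega'}=D^{\Omega}$. Then for every $\Omega'\in\mathcal A$ there is a unique closed $2$-form $p(\Omega-\Omega')$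 on $N$ with $p^*\bigl(p(\Omega-\Omega')\bigr)=\Omega-\Omega'$, and $$[\Omega']\longmapsto[p(\Omega-\Omega')]$$ is a well-defined bijection from the set $\{[\Omega']:\Omega'\in\mathcal A\}\subset H^2(P,\mathbb R)$ of cohomology classes of elements of $\mathcal A$ onto $H^2(N,\mathbb R)$. -/

import Mathlib

open Set
open scoped Manifold ContDiff Topology

noncomputable section

namespace SympFib

section Forms

variable (E : Type*) [NormedAddCommGroup E] [NormedSpace ℝ E]
  (M : Type*) [TopologicalSpace M] [ChartedSpace E M]

/-- Not necessarily smooth differential forms of degree `k` on the boundaryless manifold `M`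
modelled on `E`: a continuous alternating `k`-linear form on every tangent space. -/
def Form (k : ℕ) : Type _ :=
  ∀ x : M, TangentSpace 𝓘(ℝ, E) x [⋀^Fin k]→L[ℝ] ℝ

instance (k : ℕ) : AddCommGroup (Form E M k) :=
  inferInstanceAs (AddCommGroup (∀ x : M, TangentSpace 𝓘(ℝ, E) x [⋀^Fin k]→L[ℝ] ℝ))

instance (k : ℕ) : Module ℝ (Form E M k) :=
  inferInstanceAs (Module ℝ (∀ x : M, TangentSpace 𝓘(ℝ, E) x [⋀^Fin k]→L[ℝ] ℝ))

variable {E M}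

/-- The expression of the form `σ` in the preferred chart at `x₀`, that is, the pullback of `σ`
under the inverse of this chart. It is meaningful on the target of the chart. -/
def Form.inChart {k : ℕ} (σ : Form E M k) (x₀ : M) (y : E) : E [⋀^Fin k]→L[ℝ] ℝ :=
  (σ ((extChartAt 𝓘(ℝ, E) x₀).symm y)).compContinuousLinearMap
    (mfderiv 𝓘(ℝ, E) 𝓘(ℝ, E) (extChartAt 𝓘(ℝ, E) x₀).symm y)

/-- A form is smooth if its expression in every preferred chart is smooth. -/
def Form.IsSmooth {k : ℕ} (σ : Form E M k) : Prop :=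
  ∀ x₀ : M, ContDiffOn ℝ ∞ (σ.inChart x₀) (extChartAt 𝓘(ℝ, E) x₀).target

/-- The exterior derivative: at `x`, it is computed in the preferred chart at `x`. -/
def Form.d {k : ℕ} (σ : Form E M k) : Form E M (k + 1) := fun x =>
  (extDeriv (σ.inChart x) (extChartAt 𝓘(ℝ, E) x x)).compContinuousLinearMap
    (mfderiv 𝓘(ℝ, E) 𝓘(ℝ, E) (extChartAt 𝓘(ℝ, E) x) x)

/-- The pullback of a form under a map of manifolds. -/
def Form.pullback {E' : Type*} [NormedAddCommGroup E'] [NormedSpace ℝ E']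
    {M' : Type*} [TopologicalSpace M'] [ChartedSpace E' M']
    (f : M → M') {k : ℕ} (σ : Form E' M' k) : Form E M k := fun x =>
  (σ (f x)).compContinuousLinearMap (mfderiv 𝓘(ℝ, E) 𝓘(ℝ, E') f x)

theorem Form.inChart_add {k : ℕ} (σ η : Form E M k) (x₀ : M) :
    (σ + η).inChart x₀ = σ.inChart x₀ + η.inChart x₀ := rfl

theorem Form.inChart_smul {k : ℕ} (c : ℝ) (σ : Form E M k) (x₀ : M) :
    (c • σ).inChart x₀ = c • σ.inChart x₀ := rfl

theorem Form.IsSmooth.differentiableAt {k : ℕ} {σ : Form E M k} (h : σ.IsSmooth) (x : M) :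
    DifferentiableAt ℝ (σ.inChart x) (extChartAt 𝓘(ℝ, E) x x) :=
  ((h x).contDiffAt (extChartAt_target_mem_nhds x)).differentiableAt (by simp)

theorem Form.d_add {k : ℕ} {σ η : Form E M k} (hσ : σ.IsSmooth) (hη : η.IsSmooth) :
    (σ + η).d = σ.d + η.d := by
  refine funext fun x => ?_
  simp only [Form.d, Form.inChart_add,
    extDeriv_add (hσ.differentiableAt x) (hη.differentiableAt x)]
  rfl

theorem Form.d_smul {k : ℕ} (c : ℝ) (σ : Form E M k) : (c • σ).d = c • σ.d := by
  refine funext fun x => ?_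
  simp only [Form.d, Form.inChart_smul, extDeriv_smul]
  rfl

theorem Form.d_zero {k : ℕ} : (0 : Form E M k).d = 0 := by
  simpa using Form.d_smul (0 : ℝ) (0 : Form E M k)

theorem Form.IsSmooth.add {k : ℕ} {σ η : Form E M k} (hσ : σ.IsSmooth) (hη : η.IsSmooth) :
    (σ + η).IsSmooth := fun x => (hσ x).add (hη x)

theorem Form.IsSmooth.smul {k : ℕ} (c : ℝ) {σ : Form E M k} (hσ : σ.IsSmooth) :
    (c • σ).IsSmooth := fun x => (hσ x).const_smul c

theorem Form.IsSmooth.zero {k : ℕ} : (0 : Form E M k).IsSmooth := fun _ =>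
  contDiffOn_const (c := (0 : E [⋀^Fin k]→L[ℝ] ℝ))

variable (E M)

/-- The space of smooth closed `k`-forms on `M`. -/
def closedForms (k : ℕ) : Submodule ℝ (Form E M k) where
  carrier := {σ | σ.IsSmooth ∧ σ.d = 0}
  add_mem' := fun ha hb =>
    ⟨ha.1.add hb.1, by rw [Form.d_add ha.1 hb.1, ha.2, hb.2, add_zero]⟩
  zero_mem' := ⟨Form.IsSmooth.zero, Form.d_zero⟩
  smul_mem' := fun c _ ha => ⟨ha.1.smul c, by rw [Form.d_smul, ha.2, smul_zero]⟩

/-- The space of exact `(k + 1)`-forms on `M`: the exterior derivatives of smooth `k`-forms. -/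
def exactForms (k : ℕ) : Submodule ℝ (Form E M (k + 1)) where
  carrier := {σ | ∃ α : Form E M k, α.IsSmooth ∧ α.d = σ}
  add_mem' := by
    rintro _ _ ⟨a, ha, rfl⟩ ⟨b, hb, rfl⟩
    exact ⟨a + b, ha.add hb, Form.d_add ha hb⟩
  zero_mem' := ⟨0, Form.IsSmooth.zero, Form.d_zero⟩
  smul_mem' := by
    intro c _ ⟨a, ha, h⟩
    subst h
    exact ⟨c • a, ha.smul c, Form.d_smul c a⟩

/-- The second de Rham cohomology `H²(M, ℝ)`: closed `2`-forms modulo exact `2`-forms. -/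
abbrev H2 : Type _ := closedForms E M 2 ⧸ (exactForms E M 1).submoduleOf (closedForms E M 2)

variable {E M}

/-- The cohomology class `[σ] ∈ H²(M, ℝ)` of a closed `2`-form `σ`. -/
def cohomologyClass (σ : closedForms E M 2) : H2 E M := Submodule.Quotient.mk σ

/-- A symplectic form: a closed smooth `2`-form that is nondegenerate at every point. -/
def IsSymplectic (σ : Form E M 2) : Prop :=
  σ ∈ closedForms E M 2 ∧
    ∀ (x : M) (v : TangentSpace 𝓘(ℝ, E) x),
      (∀ w : TangentSpace 𝓘(ℝ, E) x, σ x ![v, w] = 0) → v = 0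

end Forms

section Fibrations

variable {EN : Type*} [NormedAddCommGroup EN] [NormedSpace ℝ EN]
  {EF : Type*} [NormedAddCommGroup EF] [NormedSpace ℝ EF]
  {EP : Type*} [NormedAddCommGroup EP] [NormedSpace ℝ EP]
  {N : Type*} [TopologicalSpace N] [ChartedSpace EN N]
  {F : Type*} [TopologicalSpace F] [ChartedSpace EF F]
  {P : Type*} [TopologicalSpace P] [ChartedSpace EP P]

/-- The embedding `F → F_u → P` of the typical fiber as the fiber over `u` that is given by a
local trivialization `e` (for `u` in the base set of `e`). -/
def fiberEmbedding {p : P → N} (e : Bundle.Trivialization F p) (u : N) : F → P :=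
  fun y => e.toOpenPartialHomeomorph.symm (u, y)

variable (EN EP) in
/-- The structure of a symplectic fibration with typical fiber `(F, σ)` on `p : P → N`: `p` is
smooth and there is a family of smooth local trivializations whose base sets cover `N` and whose
coordinate changes `g(u) : F → F` preserve `σ`. So every fiber `F_u` carries the symplectic form
`σ_u` that corresponds to `σ` in any of these trivializations. -/
structure SymplecticFibration (p : P → N) (σ : Form EF F 2) where
  contMDiff_proj : ContMDiff 𝓘(ℝ, EP) 𝓘(ℝ, EN) ∞ p
  isSymplectic : IsSymplectic σ
  atlas : Set (Bundle.Trivialization F p)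
  covers : ∀ u : N, ∃ e ∈ atlas, u ∈ e.baseSet
  contMDiffOn : ∀ e ∈ atlas,
    ContMDiffOn 𝓘(ℝ, EP) (𝓘(ℝ, EN).prod 𝓘(ℝ, EF)) ∞ e e.source
  contMDiffOn_symm : ∀ e ∈ atlas,
    ContMDiffOn (𝓘(ℝ, EN).prod 𝓘(ℝ, EF)) 𝓘(ℝ, EP) ∞ e.toOpenPartialHomeomorph.symm e.target
  coordChange_symplectic : ∀ e ∈ atlas, ∀ e' ∈ atlas, ∀ u ∈ e.baseSet ∩ e'.baseSet,
    Form.pullback (fun y : F => (e' (fiberEmbedding e u y)).2) σ = σ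

/-- The cohomology class of the closed form `Ω` on `P` extends `[σ]`: its restriction to every
fiber is the class `[σ]`, i.e. `i_u^* Ω - σ` is exact for the embeddings `i_u : F → F_u → P`. -/
def SymplecticFibration.Extends {p : P → N} {σ : Form EF F 2}
    (S : SymplecticFibration EN EP p σ) (Ω : Form EP P 2) : Prop :=
  ∀ e ∈ S.atlas, ∀ u ∈ e.baseSet,
    Form.pullback (fiberEmbedding e u) Ω - σ ∈ exactForms EF F 1

variable (EN EP) in
/-- The tangent space at `x` of the fiber of `p` through `x`, i.e. the kernel of the derivative
of the submersion `p`. -/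
def vertical (p : P → N) (x : P) : Set (TangentSpace 𝓘(ℝ, EP) x) :=
  {v | mfderiv 𝓘(ℝ, EP) 𝓘(ℝ, EN) p x v = 0}

variable (EN) in
/-- The distribution `D^Ω`: the vectors that are `Ω`-orthogonal to the fiber. -/
def distribution (p : P → N) (Ω : Form EP P 2) (x : P) : Set (TangentSpace 𝓘(ℝ, EP) x) :=
  {v | ∀ y ∈ vertical EN EP p x, Ω x ![v, y] = 0}

variable (EN) in
/-- The restriction of `Ω` to every fiber of `p` is nondegenerate. -/
def FiberwiseNondegenerate (p : P → N) (Ω : Form EP P 2) : Prop :=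
  ∀ (x : P), ∀ v ∈ vertical EN EP p x, (∀ w ∈ vertical EN EP p x, Ω x ![v, w] = 0) → v = 0

variable (EN) in
/-- The closed `2`-forms `Ω'` on `P` that have the same restriction as `Ω` to every fiber of `p`
and define the same distribution, `D^{Ω'} = D^Ω`. -/
def sameFiberAndDistribution (p : P → N) (Ω : Form EP P 2) : Set (closedForms EP P 2) :=
  {Ω' | (∀ (x : P), ∀ v ∈ vertical EN EP p x, ∀ w ∈ vertical EN EP p x,
          (Ω' : Form EP P 2) x ![v, w] = Ω x ![v, w]) ∧
        ∀ x : P, distribution EN p (Ω' : Form EP P 2) x = distribution EN p Ω x}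

end Fibrations

end SympFib

end

open SympFib

noncomputable section

set_option linter.unusedSectionVars false

namespace SympFib

/-! For `Ω'` in the class considered, `τ = Ω - Ω'` is closed and vanishes as soon as one argument is
vertical: split the other argument into a vertical part, where the two forms agree, and a part in
the common distribution, which is orthogonal to the fiber for both. For a closed horizontal form the
derivative of its coefficients in fiber directions vanishes, so they are constant on the connected
fibers and `τ` descends to a unique form `β` on `N`, closed because local sections of `p` pull `τ`
back to `β` (`IsHorizontal.existsUnique_pullback`). Conversely `Ω - p^*β` lies in the class for
every closed `β`, which gives surjectivity.

What remains is that `p^*` is injective on second cohomology (`mem_exactForms_of_pullback`); this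
makes the map both well defined and injective. Let `dα = p^*β`. For a vector `ν` on the base let
`γ(ν)` be the mean over the fiber of `α` on the `Ω`-horizontal lift of `ν`, taken with respect to
the Liouville density of `Ω` on the fibers. Then `dγ = β` (`averageForm_d`), for the following
reasons.

A field `X` over a base field whose contraction with `Ω` is closed on the fibers preserves the
fiberwise restriction of `Ω`, hence its Liouville density, so differentiating a mean along the base
field is taking the mean of the derivative along `X` (`fderiv_fiberAverage`). This is used twice.
Applied to the horizontal lifts `X`, `W` of coordinate fields, it gives `dγ` as the mean of `X(α(W))
- W(α(X)) = dα(X, W) + α([X, W])`. Let `Y` be the vertical field whose contraction with `Ω` is `α`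
on the fibers. Closedness of `Ω` yields `α([X, W]) = Ω(Y, [X, W]) = -Y(Ω(X, W))`
(`fderiv_apply_sub_fderiv_apply`). Since `dα` is a pullback, `α` is closed on the fibers, so `Y`
preserves the density too. It lies over the zero field, so the mean of a derivative along `Y` is
zero. The mean of the constant `β(v, w)` is left. -/

theorem two_le_infty : (2 : WithTop ℕ∞) ≤ ∞ := by
  exact_mod_cast (ENat.LEInfty.out : (2 : WithTop ℕ∞) ≤ ∞)

/-! ### Smoothness of maps into spaces of alternating forms -/

section Alternating

variable {E : Type*} [NormedAddCommGroup E] [NormedSpace ℝ E]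
  {H : Type*} [NormedAddCommGroup H] [NormedSpace ℝ H]

/-- Evaluation on all tuples of basis vectors embeds the space of forms linearly into a finite power
of `ℝ`. A linear left inverse is continuous by finite dimension and recovers `f` from finitely many
scalar functions. -/
theorem contDiffWithinAt_alternating_of_apply [FiniteDimensional ℝ E] {k : ℕ}
    {f : H → E [⋀^Fin k]→L[ℝ] ℝ} {s : Set H} {x : H} {n : WithTop ℕ∞}
    (h : ∀ v : Fin k → E, ContDiffWithinAt ℝ n (fun y => f y v) s x) :
    ContDiffWithinAt ℝ n f s x := by
  let b := Module.finBasis ℝ E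
  let T : (E [⋀^Fin k]→L[ℝ] ℝ) →ₗ[ℝ] ((Fin k → Fin (Module.finrank ℝ E)) → ℝ) :=
    { toFun := fun g i => g (fun j => b (i j))
      map_add' := fun _ _ => rfl
      map_smul' := fun _ _ => rfl }
  have hT : Function.Injective T := by
    intro g g' hg
    apply ContinuousAlternatingMap.toAlternatingMap_injective
    refine Module.Basis.ext_alternating b fun i _ => ?_
    exact congrFun hg i
  obtain ⟨L, hL⟩ := LinearMap.exists_leftInverse_of_injective T (LinearMap.ker_eq_bot.2 hT)
  have hf : f = fun y => (LinearMap.toContinuousLinearMap L) (T (f y)) := by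
    funext y
    exact (LinearMap.congr_fun hL (f y)).symm
  rw [hf]
  refine (ContinuousLinearMap.contDiff _).comp_contDiffWithinAt ?_
  rw [contDiffWithinAt_pi]
  exact fun i => h _

theorem _root_.ContDiffWithinAt.alternating_apply {k : ℕ}
    {f : H → E [⋀^Fin k]→L[ℝ] ℝ} {g : H → Fin k → E} {s : Set H} {x : H} {n : WithTop ℕ∞}
    (hf : ContDiffWithinAt ℝ n f s x) (hg : ContDiffWithinAt ℝ n g s x) :
    ContDiffWithinAt ℝ n (fun y => f y (g y)) s x := by
  have h : ContDiff ℝ n (fun p : (E [⋀^Fin k]→L[ℝ] ℝ) × (Fin k → E) => p.1 p.2) := by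
    rw [← contDiffOn_univ]
    exact (ContinuousLinearMap.analyticOnNhd_uncurry_of_multilinear
      (ContinuousAlternatingMap.toContinuousMultilinearMapCLM ℝ :
        (E [⋀^Fin k]→L[ℝ] ℝ) →L[ℝ] _)).contDiffOn uniqueDiffOn_univ
  exact h.comp_contDiffWithinAt (hf.prodMk hg)

theorem _root_.ContDiffWithinAt.alternating_comp {E' : Type*} [NormedAddCommGroup E']
    [NormedSpace ℝ E'] [FiniteDimensional ℝ E'] {k : ℕ}
    {f : H → E [⋀^Fin k]→L[ℝ] ℝ} {g : H → E' →L[ℝ] E} {s : Set H} {x : H} {n : WithTop ℕ∞}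
    (hf : ContDiffWithinAt ℝ n f s x) (hg : ContDiffWithinAt ℝ n g s x) :
    ContDiffWithinAt ℝ n (fun y => (f y).compContinuousLinearMap (g y)) s x := by
  refine contDiffWithinAt_alternating_of_apply fun v => ?_
  refine ContDiffWithinAt.alternating_apply hf (g := fun y i => g y (v i)) ?_
  exact contDiffWithinAt_pi.2 fun i => hg.clm_apply contDiffWithinAt_const

end Alternating

/-! ### Pullbacks, charts and naturality of the exterior derivative -/

section Pullback

variable {E : Type*} [NormedAddCommGroup E] [NormedSpace ℝ E]
  {M : Type*} [TopologicalSpace M] [ChartedSpace E M]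
  {E' : Type*} [NormedAddCommGroup E'] [NormedSpace ℝ E']
  {M' : Type*} [TopologicalSpace M'] [ChartedSpace E' M']
  {E'' : Type*} [NormedAddCommGroup E''] [NormedSpace ℝ E'']
  {M'' : Type*} [TopologicalSpace M''] [ChartedSpace E'' M'']

theorem Form.pullback_congr {k : ℕ} {f g : M → M'} (σ : Form E' M' k) {x : M}
    (h : f =ᶠ[𝓝 x] g) : Form.pullback (E := E) f σ x = Form.pullback g σ x := by
  have h1 : mfderiv 𝓘(ℝ, E) 𝓘(ℝ, E') f x = mfderiv 𝓘(ℝ, E) 𝓘(ℝ, E') g x := h.mfderiv_eq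
  have h2 : f x = g x := h.eq_of_nhds
  ext v
  -- The tangent spaces are read as the fixed model spaces, so that `f x` can be replaced by `g x`
  -- without a dependent type getting in the way.
  let σ' : M' → E' [⋀^Fin k]→L[ℝ] ℝ := σ
  let D : (M → M') → (E →L[ℝ] E') := fun f => mfderiv 𝓘(ℝ, E) 𝓘(ℝ, E') f x
  change σ' (f x) (fun i => D f (v i)) = σ' (g x) (fun i => D g (v i))
  rw [h2, show D f = D g from h1]

theorem Form.pullback_comp_apply {k : ℕ} {f : M → M'} {g : M' → M''} (σ : Form E'' M'' k) {x : M}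
    (hg : MDifferentiableAt 𝓘(ℝ, E') 𝓘(ℝ, E'') g (f x))
    (hf : MDifferentiableAt 𝓘(ℝ, E) 𝓘(ℝ, E') f x) :
    Form.pullback (E := E) (g ∘ f) σ x
      = Form.pullback (E := E) f (Form.pullback (E := E') g σ) x := by
  have h := mfderiv_comp x hg hf
  ext v
  change σ (g (f x)) (fun i => mfderiv 𝓘(ℝ, E) 𝓘(ℝ, E'') (g ∘ f) x (v i)) = _
  rw [h]
  rfl

theorem Form.pullback_id {k : ℕ} (σ : Form E M k) : Form.pullback id σ = σ := by
  funext x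
  ext v
  change σ x (fun i => mfderiv 𝓘(ℝ, E) 𝓘(ℝ, E) id x (v i)) = _
  rw [mfderiv_id]
  rfl

theorem Form.inChart_eq_pullback {k : ℕ} (σ : Form E M k) (x₀ : M) :
    σ.inChart x₀ = Form.pullback (E := E) (M := E) (extChartAt 𝓘(ℝ, E) x₀).symm σ := rfl

theorem Form.pullback_sub {k : ℕ} (f : M → M') (σ η : Form E' M' k) :
    Form.pullback (E := E) f (σ - η) = Form.pullback f σ - Form.pullback f η := by
  funext x
  ext v
  rfl

/-- The pullback of a form under a map defined on a normed space. -/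
def Form.along {k : ℕ} (σ : Form E M k) (f : E'' → M) : E'' → E'' [⋀^Fin k]→L[ℝ] ℝ :=
  Form.pullback (E := E'') f σ

theorem Form.pullback_vec {k : ℕ} (σ : E' → E' [⋀^Fin k]→L[ℝ] ℝ) (f : E'' → E') (y : E'') :
    Form.pullback (E := E'') (E' := E') f (σ : Form E' E' k) y
      = (σ (f y)).compContinuousLinearMap (fderiv ℝ f y) := by
  ext v
  change σ (f y) (fun i => mfderiv 𝓘(ℝ, E'') 𝓘(ℝ, E') f y (v i)) = _
  rw [mfderiv_eq_fderiv]
  rfl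

theorem Form.IsSmooth.contDiffAt {k : ℕ} {σ : Form E M k} (h : σ.IsSmooth) {x₀ : M} {y : E}
    (hy : y ∈ (extChartAt 𝓘(ℝ, E) x₀).target) : ContDiffAt ℝ ∞ (σ.inChart x₀) y :=
  (h x₀).contDiffAt ((isOpen_extChartAt_target x₀).mem_nhds hy)

variable [IsManifold 𝓘(ℝ, E) ∞ M]

theorem mdifferentiableAt_extChartAt_symm {x₀ : M} {y : E}
    (hy : y ∈ (extChartAt 𝓘(ℝ, E) x₀).target) :
    MDifferentiableAt 𝓘(ℝ, E) 𝓘(ℝ, E) (extChartAt 𝓘(ℝ, E) x₀).symm y :=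
  ((contMDiffOn_extChartAt_symm (n := ∞) x₀).contMDiffAt
    ((isOpen_extChartAt_target x₀).mem_nhds hy)).mdifferentiableAt (by simp)

/-- Near `y₀` the map `f` factors as the inverse chart after its chart expression. Pulling back
along `f` thus becomes a pullback between vector spaces, where the calculus of `extDeriv` applies.
-/
theorem Form.along_eventuallyEq {k : ℕ} (σ : Form E M k) {f : E'' → M} {U : Set E''}
    (hU : IsOpen U) (hf : ContMDiffOn 𝓘(ℝ, E'') 𝓘(ℝ, E) ∞ f U) {y₀ : E''} (hy₀ : y₀ ∈ U)
    {x₀ : M} (hx₀ : f y₀ ∈ (extChartAt 𝓘(ℝ, E) x₀).source) :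
    ∀ᶠ y in 𝓝 y₀, ContDiffAt ℝ ∞ (extChartAt 𝓘(ℝ, E) x₀ ∘ f) y ∧
      σ.along f y = (σ.inChart x₀ ((extChartAt 𝓘(ℝ, E) x₀ ∘ f) y)).compContinuousLinearMap
        (fderiv ℝ (extChartAt 𝓘(ℝ, E) x₀ ∘ f) y) := by
  have hV : f ⁻¹' (extChartAt 𝓘(ℝ, E) x₀).source ∩ U ∈ 𝓝 y₀ := by
    refine Filter.inter_mem ?_ (hU.mem_nhds hy₀)
    exact (hf.continuousOn.continuousAt (hU.mem_nhds hy₀)).preimage_mem_nhds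
      ((isOpen_extChartAt_source x₀).mem_nhds hx₀)
  filter_upwards [eventually_mem_nhds_iff.2 hV] with y hy
  obtain ⟨hy1, hy2⟩ := mem_of_mem_nhds hy
  have hfy : ContMDiffAt 𝓘(ℝ, E'') 𝓘(ℝ, E) ∞ f y := hf.contMDiffAt (hU.mem_nhds hy2)
  have hc : ContMDiffAt 𝓘(ℝ, E) 𝓘(ℝ, E) ∞ (extChartAt 𝓘(ℝ, E) x₀) (f y) :=
    contMDiffAt_extChartAt' (by simpa using hy1)
  have hcf : ContMDiffAt 𝓘(ℝ, E'') 𝓘(ℝ, E) ∞ (extChartAt 𝓘(ℝ, E) x₀ ∘ f) y := hc.comp y hfy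
  refine ⟨hcf.contDiffAt, ?_⟩
  rw [← Form.pullback_vec, Form.inChart_eq_pullback]
  have := Form.pullback_comp_apply σ (f := extChartAt 𝓘(ℝ, E) x₀ ∘ f)
    (g := (extChartAt 𝓘(ℝ, E) x₀).symm) (x := y)
    (mdifferentiableAt_extChartAt_symm ((extChartAt 𝓘(ℝ, E) x₀).map_source hy1))
    (hcf.mdifferentiableAt (by simp))
  rw [Form.along]
  erw [← this]
  refine Form.pullback_congr σ ?_
  filter_upwards [hy] with z hz
  exact ((extChartAt 𝓘(ℝ, E) x₀).left_inv hz.1).symm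

/-- Only the expression of `σ` at the center of the chart at `f y₀` enters. Taking `f` to be an
inverse chart then reduces smoothness of a form to the centers of charts. -/
theorem Form.along_contDiffAt_of_center [FiniteDimensional ℝ E''] {k : ℕ} {σ : Form E M k}
    {f : E'' → M} {U : Set E''}
    (hU : IsOpen U) (hf : ContMDiffOn 𝓘(ℝ, E'') 𝓘(ℝ, E) ∞ f U) {y₀ : E''} (hy₀ : y₀ ∈ U)
    (hσ : ContDiffAt ℝ ∞ (σ.inChart (f y₀)) (extChartAt 𝓘(ℝ, E) (f y₀) (f y₀))) :
    ContDiffAt ℝ ∞ (σ.along f) y₀ := by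
  have h := Form.along_eventuallyEq σ hU hf hy₀ (mem_extChartAt_source (I := 𝓘(ℝ, E)) (f y₀))
  refine ContDiffAt.congr_of_eventuallyEq ?_ (h.mono fun y hy => hy.2)
  have h1 := h.self_of_nhds.1
  have h2 : ContDiffAt ℝ ∞ (fun y => σ.inChart (f y₀) ((extChartAt 𝓘(ℝ, E) (f y₀) ∘ f) y)) y₀ :=
    ContDiffAt.comp (g := σ.inChart (f y₀)) y₀ hσ h1
  exact ContDiffWithinAt.alternating_comp (s := univ) h2
    (h1.fderiv_right (m := ∞) (by simp))

theorem Form.IsSmooth.along_contDiffOn [FiniteDimensional ℝ E''] {k : ℕ} {σ : Form E M k}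
    (hσ : σ.IsSmooth) {f : E'' → M} {U : Set E''}
    (hU : IsOpen U) (hf : ContMDiffOn 𝓘(ℝ, E'') 𝓘(ℝ, E) ∞ f U) :
    ContDiffOn ℝ ∞ (σ.along f) U := fun y hy =>
  (Form.along_contDiffAt_of_center hU hf hy
    (hσ.contDiffAt (mem_extChartAt_target (f y)))).contDiffWithinAt

/-- Every smooth map from a vector space, and in particular every parametrization, computes
`Form.d`, although that is defined through one preferred chart per point. -/
theorem Form.IsSmooth.extDeriv_along {k : ℕ} {σ : Form E M k}
    (hσ : σ.IsSmooth) {f : E'' → M} {U : Set E''}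
    (hU : IsOpen U) (hf : ContMDiffOn 𝓘(ℝ, E'') 𝓘(ℝ, E) ∞ f U) {y : E''} (hy : y ∈ U) :
    extDeriv (σ.along f) y = σ.d.along f y := by
  have h := Form.along_eventuallyEq σ hU hf hy (mem_extChartAt_source (I := 𝓘(ℝ, E)) (f y))
  rw [Filter.EventuallyEq.extDeriv_eq (h.mono fun y hy => hy.2),
    extDeriv_pullback (f := extChartAt 𝓘(ℝ, E) (f y) ∘ f) (r := ∞) (hσ.differentiableAt (f y)) h.self_of_nhds.1
      (by simpa using two_le_infty)]
  ext v
  have hc : MDifferentiableAt 𝓘(ℝ, E) 𝓘(ℝ, E) (extChartAt 𝓘(ℝ, E) (f y)) (f y) :=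
    mdifferentiableAt_extChartAt (by simp)
  have hfy : MDifferentiableAt 𝓘(ℝ, E'') 𝓘(ℝ, E) f y :=
    (hf.contMDiffAt (hU.mem_nhds hy)).mdifferentiableAt (by simp)
  have hcomp := mfderiv_comp y hc hfy
  rw [← mfderiv_eq_fderiv, hcomp]
  rfl

theorem Form.isSmooth_of_center [FiniteDimensional ℝ E] {k : ℕ} {σ : Form E M k}
    (hσ : ∀ x, ContDiffAt ℝ ∞ (σ.inChart x) (extChartAt 𝓘(ℝ, E) x x)) : σ.IsSmooth :=
  fun x₀ _ hy => (Form.along_contDiffAt_of_center (isOpen_extChartAt_target x₀)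
    (contMDiffOn_extChartAt_symm x₀) hy (hσ _)).contDiffWithinAt

/-- The derivatives of the chart and of its inverse cancel, so equality of two forms at `x` may be
checked on chart expressions. -/
theorem Form.d_eq_of_center {k : ℕ} {σ : Form E M k} {η : Form E M (k + 1)} {x : M}
    (h : extDeriv (σ.inChart x) (extChartAt 𝓘(ℝ, E) x x)
      = η.inChart x (extChartAt 𝓘(ℝ, E) x x)) : σ.d x = η x := by
  let c := extChartAt 𝓘(ℝ, E) x
  rw [Form.d, h]
  have h1 := Form.pullback_comp_apply η (f := c) (g := c.symm) (x := x)
    (mdifferentiableAt_extChartAt_symm (mem_extChartAt_target x))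
    (mdifferentiableAt_extChartAt (by simp))
  have h2 : Form.pullback (E := E) (c.symm ∘ c) η x = Form.pullback (E := E) id η x := by
    refine Form.pullback_congr η ?_
    filter_upwards [extChartAt_source_mem_nhds (I := 𝓘(ℝ, E)) x] with z hz
    exact c.left_inv hz
  rw [Form.pullback_id, h1] at h2
  exact h2

theorem Form.pullback_inChart {k : ℕ} (σ : Form E' M' k) {f : M → M'}
    (hf : ContMDiff 𝓘(ℝ, E) 𝓘(ℝ, E') ∞ f) {x₀ : M} {y : E}
    (hy : y ∈ (extChartAt 𝓘(ℝ, E) x₀).target) :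
    (Form.pullback (E := E) f σ).inChart x₀ y = σ.along (f ∘ (extChartAt 𝓘(ℝ, E) x₀).symm) y :=
  (Form.pullback_comp_apply σ (hf.mdifferentiableAt (by simp))
    (mdifferentiableAt_extChartAt_symm hy)).symm

variable [IsManifold 𝓘(ℝ, E') ∞ M']

theorem Form.IsSmooth.pullback [FiniteDimensional ℝ E] {k : ℕ} {σ : Form E' M' k}
    (hσ : σ.IsSmooth) {f : M → M'} (hf : ContMDiff 𝓘(ℝ, E) 𝓘(ℝ, E') ∞ f) :
    (Form.pullback (E := E) f σ).IsSmooth := fun x₀ =>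
  (hσ.along_contDiffOn (isOpen_extChartAt_target x₀)
    (hf.comp_contMDiffOn (contMDiffOn_extChartAt_symm x₀))).congr
      fun _ hy => Form.pullback_inChart σ hf hy

theorem Form.IsSmooth.d_pullback {k : ℕ} {σ : Form E' M' k}
    (hσ : σ.IsSmooth) {f : M → M'} (hf : ContMDiff 𝓘(ℝ, E) 𝓘(ℝ, E') ∞ f) :
    (Form.pullback (E := E) f σ).d = Form.pullback f σ.d := by
  funext x
  refine Form.d_eq_of_center ?_
  rw [Form.pullback_inChart _ hf (mem_extChartAt_target x),
    ← hσ.extDeriv_along (isOpen_extChartAt_target x)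
    (hf.comp_contMDiffOn (contMDiffOn_extChartAt_symm x)) (mem_extChartAt_target x)]
  refine Filter.EventuallyEq.extDeriv_eq ?_
  filter_upwards [extChartAt_target_mem_nhds (I := 𝓘(ℝ, E)) x] with y hy
  exact Form.pullback_inChart σ hf hy

end Pullback

/-! ### The Liouville density of a `2`-form on a vector space and its derivative -/

section Liouville

variable {Z : Type*} [NormedAddCommGroup Z] [NormedSpace ℝ Z] [FiniteDimensional ℝ Z]
  {H : Type*} [NormedAddCommGroup H] [NormedSpace ℝ H]

/-- The Gram matrix of a `2`-form on a vector space in the standard basis. -/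
def gram (η : Z [⋀^Fin 2]→L[ℝ] ℝ) :
    Matrix (Fin (Module.finrank ℝ Z)) (Fin (Module.finrank ℝ Z)) ℝ :=
  Matrix.of fun i j => η ![Module.finBasis ℝ Z i, Module.finBasis ℝ Z j]

/-- The Liouville density of a `2`-form with respect to the standard basis. -/
def liouville (η : Z [⋀^Fin 2]→L[ℝ] ℝ) : ℝ := √|(gram η).det|

theorem form_two_add_left {E : Type*} [NormedAddCommGroup E] [NormedSpace ℝ E]
    (η : E [⋀^Fin 2]→L[ℝ] ℝ) (a b c : E) : η ![a + b, c] = η ![a, c] + η ![b, c] :=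
  η.toMultilinearMap.cons_add ![c] a b

theorem form_two_smul_left {E : Type*} [NormedAddCommGroup E] [NormedSpace ℝ E]
    (η : E [⋀^Fin 2]→L[ℝ] ℝ) (r : ℝ) (a c : E) : η ![r • a, c] = r * η ![a, c] :=
  η.toMultilinearMap.cons_smul ![c] r a

theorem form_two_swap {E : Type*} [NormedAddCommGroup E] [NormedSpace ℝ E]
    (η : E [⋀^Fin 2]→L[ℝ] ℝ) (a b : E) : η ![a, b] = - η ![b, a] := by
  have := η.map_swap ![b, a] (i := 0) (j := 1) (by simp)
  have h : ![b, a] ∘ (Equiv.swap (0 : Fin 2) 1) = ![a, b] := by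
    ext i
    fin_cases i <;> simp
  rw [h] at this
  exact this

/-- A `2`-form as a bilinear form. -/
def bilin {E : Type*} [NormedAddCommGroup E] [NormedSpace ℝ E]
    (η : E [⋀^Fin 2]→L[ℝ] ℝ) : E →ₗ[ℝ] E →ₗ[ℝ] ℝ :=
  LinearMap.mk₂ ℝ (fun a b => η ![a, b]) (form_two_add_left η) (form_two_smul_left η)
    (fun a b c => by
      rw [form_two_swap, form_two_add_left, form_two_swap η a b, form_two_swap η a c]; ring)
    (fun r a b => by
      rw [form_two_swap, form_two_smul_left, form_two_swap η a b, smul_eq_mul]; ring)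

@[simp] theorem bilin_apply {E : Type*} [NormedAddCommGroup E] [NormedSpace ℝ E]
    (η : E [⋀^Fin 2]→L[ℝ] ℝ) (a b : E) : bilin η a b = η ![a, b] := rfl

theorem gram_eq_toMatrix₂ (η : Z [⋀^Fin 2]→L[ℝ] ℝ) :
    gram η = LinearMap.toMatrix₂ (Module.finBasis ℝ Z) (Module.finBasis ℝ Z) (bilin η) := by
  ext i j
  simp [gram, LinearMap.toMatrix₂_apply]

theorem comp_two_apply {E E' : Type*} [NormedAddCommGroup E] [NormedSpace ℝ E]
    [NormedAddCommGroup E'] [NormedSpace ℝ E']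
    (η : E [⋀^Fin 2]→L[ℝ] ℝ) (T : E' →L[ℝ] E) (a b : E') :
    η.compContinuousLinearMap T ![a, b] = η ![T a, T b] := by
  rw [ContinuousAlternatingMap.compContinuousLinearMap_apply]
  congr 1
  funext i
  fin_cases i <;> rfl

theorem gram_comp (η : Z [⋀^Fin 2]→L[ℝ] ℝ) (T : Z →L[ℝ] Z) :
    gram (η.compContinuousLinearMap T) =
      (LinearMap.toMatrix (Module.finBasis ℝ Z) (Module.finBasis ℝ Z) T).transpose * gram η *
        LinearMap.toMatrix (Module.finBasis ℝ Z) (Module.finBasis ℝ Z) T := by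
  rw [gram_eq_toMatrix₂, gram_eq_toMatrix₂, ← LinearMap.toMatrix₂_compl₁₂]
  congr 1
  ext a b
  exact comp_two_apply η T a b

/-- The Gram determinant is multiplied by the square of `T.det`, so the root of its absolute value
transforms as a density. It can be integrated by the change of variables formula with no orientation
or top exterior power. -/
theorem liouville_comp (η : Z [⋀^Fin 2]→L[ℝ] ℝ) (T : Z →L[ℝ] Z) :
    liouville (η.compContinuousLinearMap T) = |T.det| * liouville η := by
  have h : (LinearMap.toMatrix (Module.finBasis ℝ Z) (Module.finBasis ℝ Z) T).det = T.det := by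
    rw [LinearMap.det_toMatrix]
  rw [liouville, gram_comp, Matrix.det_mul, Matrix.det_mul, Matrix.det_transpose, h, liouville,
    show T.det * (gram η).det * T.det = T.det ^ 2 * (gram η).det by ring, abs_mul, abs_pow,
    Real.sqrt_mul (by positivity), Real.sqrt_sq (abs_nonneg _)]

/-- Nondegeneracy of a `2`-form. -/
def Nondeg {E : Type*} [NormedAddCommGroup E] [NormedSpace ℝ E]
    (η : E [⋀^Fin 2]→L[ℝ] ℝ) : Prop := ∀ v, (∀ w, η ![v, w] = 0) → v = 0

theorem Nondeg.det_ne_zero {η : Z [⋀^Fin 2]→L[ℝ] ℝ} (h : Nondeg η) : (gram η).det ≠ 0 := by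
  rw [gram_eq_toMatrix₂]
  refine (LinearMap.nondegenerate_iff_det_ne_zero _).1 ?_
  refine ⟨fun v hv => h v hv, fun v hv => h v fun w => ?_⟩
  rw [form_two_swap, ← bilin_apply, hv, neg_zero]

theorem Nondeg.liouville_pos {η : Z [⋀^Fin 2]→L[ℝ] ℝ} (h : Nondeg η) : 0 < liouville η :=
  Real.sqrt_pos.2 (abs_pos.2 h.det_ne_zero)

/-- `Real.log` is the logarithm of the absolute value, so this expression absorbs both the root and
the absolute value and is visibly smooth where the determinant is nonzero. -/
theorem Nondeg.liouville_eventuallyEq {H : Type*} [TopologicalSpace H] {η : H → Z [⋀^Fin 2]→L[ℝ] ℝ} {x : H} (h : Nondeg (η x))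
    (hc : ContinuousAt (fun y => (gram (η y)).det) x) :
    (fun y => liouville (η y)) =ᶠ[𝓝 x] fun y => Real.exp (Real.log (gram (η y)).det / 2) := by
  filter_upwards [hc.eventually_ne h.det_ne_zero] with y hy
  rw [Real.exp_half, Real.exp_log_eq_abs hy, liouville]

theorem contDiff_det (n : ℕ) (r : WithTop ℕ∞) :
    ContDiff ℝ r fun M : Fin n → Fin n → ℝ => (Matrix.of M).det := by
  simp only [Matrix.det_apply, Matrix.of_apply]
  refine ContDiff.sum fun s _ => ContDiff.const_smul _ (contDiff_prod fun i _ => ?_)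
  fun_prop

theorem contDiffAt_gram {η : H → Z [⋀^Fin 2]→L[ℝ] ℝ} {x : H} {r : WithTop ℕ∞}
    (hη : ContDiffAt ℝ r η x) :
    ContDiffAt ℝ r (fun y i j => gram (η y) i j) x := by
  refine contDiffAt_pi.2 fun i => contDiffAt_pi.2 fun j => ?_
  exact ContDiffWithinAt.alternating_apply (s := univ) hη contDiffWithinAt_const

theorem contDiffAt_liouville {η : H → Z [⋀^Fin 2]→L[ℝ] ℝ} {x : H} {r : WithTop ℕ∞}
    (hη : ContDiffAt ℝ r η x) (h : Nondeg (η x)) :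
    ContDiffAt ℝ r (fun y => liouville (η y)) x := by
  have hd : ContDiffAt ℝ r (fun y => (gram (η y)).det) x :=
    (contDiff_det _ r).contDiffAt.comp x (contDiffAt_gram hη)
  refine ContDiffAt.congr_of_eventuallyEq ?_ (h.liouville_eventuallyEq hd.continuousAt)
  exact ((hd.log h.det_ne_zero).div_const 2).exp

theorem hasDerivAt_det_one_add {n : ℕ} (M : Matrix (Fin n) (Fin n) ℝ) :
    HasDerivAt (fun t : ℝ => (1 + t • M).det) M.trace 0 := by
  have h : (fun t : ℝ => (1 + t • M).det) = fun t => 1 + M.trace * t +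
      (Matrix.det (1 + (Polynomial.X : Polynomial ℝ) • M.map Polynomial.C)).divX.divX.eval t
        * t ^ 2 := by
    funext t
    exact Matrix.det_one_add_smul t M
  rw [h]
  have h1 := ((hasDerivAt_id (0 : ℝ)).const_mul M.trace).const_add 1
  have h2 := (Polynomial.hasDerivAt
    (Matrix.det (1 + (Polynomial.X : Polynomial ℝ) • M.map Polynomial.C)).divX.divX 0).mul
    ((hasDerivAt_id (0 : ℝ)).pow 2)
  have h3 := h1.add h2
  simp only [mul_one, Pi.pow_apply, id, ne_eq, OfNat.ofNat_ne_zero, not_false_eq_true, zero_pow,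
    mul_zero, Nat.cast_ofNat, Nat.add_one_sub_one, pow_one, add_zero] at h3
  exact h3

/-- Since `A + t • (A * J) = A * (1 + t • J)`, and likewise on the other side, the derivative
reduces to that of the determinant at the identity. Invertibility of `A` plays no role. -/
theorem fderiv_det_apply {n : ℕ} (A J : Matrix (Fin n) (Fin n) ℝ) :
    fderiv ℝ (fun M : Fin n → Fin n → ℝ => (Matrix.of M).det) A
      (-(J.transpose * A + A * J) : Matrix (Fin n) (Fin n) ℝ) = -2 * (A.det * J.trace) := by
  have hd : DifferentiableAt ℝ (fun M : Fin n → Fin n → ℝ => (Matrix.of M).det) A :=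
    (contDiff_det n 1).differentiable (by simp) _
  have key : ∀ (B : Matrix (Fin n) (Fin n) ℝ) (c : ℝ),
      HasDerivAt (fun t : ℝ => (A + t • B).det) c 0 →
      fderiv ℝ (fun M : Fin n → Fin n → ℝ => (Matrix.of M).det) A B = c := by
    intro B c hc
    let A₀ : Fin n → Fin n → ℝ := A
    let B₀ : Fin n → Fin n → ℝ := B
    have h1 : HasDerivAt (fun t : ℝ => A₀ + t • B₀) B₀ 0 := by
      simpa using ((hasDerivAt_id (0 : ℝ)).smul_const B₀).const_add A₀
    have h0 : A₀ + (0 : ℝ) • B₀ = A := by rw [zero_smul, add_zero]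
    have h2 := HasFDerivAt.comp_hasDerivAt (0 : ℝ) (f := fun t : ℝ => A₀ + t • B₀)
      (l := fun M : Fin n → Fin n → ℝ => (Matrix.of M).det)
      (l' := fderiv ℝ (fun M : Fin n → Fin n → ℝ => (Matrix.of M).det) A)
      (by rw [h0]; exact hd.hasFDerivAt) h1
    exact h2.unique hc
  have hJ := hasDerivAt_det_one_add J
  have e1 : fderiv ℝ (fun M : Fin n → Fin n → ℝ => (Matrix.of M).det) A
      (A * J : Matrix (Fin n) (Fin n) ℝ) = A.det * J.trace := by
    refine key _ _ ((hJ.const_mul A.det).congr_of_eventuallyEq (Filter.Eventually.of_forall ?_))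
    intro t
    change (A + t • (A * J)).det = A.det * (1 + t • J).det
    rw [← Matrix.det_mul, mul_add, mul_one, Matrix.mul_smul]
  have e2 : fderiv ℝ (fun M : Fin n → Fin n → ℝ => (Matrix.of M).det) A
      (J.transpose * A : Matrix (Fin n) (Fin n) ℝ) = A.det * J.trace := by
    refine key _ _ ((hJ.const_mul A.det).congr_of_eventuallyEq (Filter.Eventually.of_forall ?_))
    intro t
    change (A + t • (J.transpose * A)).det = A.det * (1 + t • J).det
    rw [mul_comm, ← Matrix.det_transpose (1 + t • J), ← Matrix.det_mul, Matrix.transpose_add,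
      Matrix.transpose_smul, Matrix.transpose_one, add_mul, one_mul, Matrix.smul_mul]
  have e3 := (fderiv ℝ (fun M : Fin n → Fin n → ℝ => (Matrix.of M).det) A).map_add
    (J.transpose * A : Matrix (Fin n) (Fin n) ℝ) (A * J : Matrix (Fin n) (Fin n) ℝ)
  have e4 := (fderiv ℝ (fun M : Fin n → Fin n → ℝ => (Matrix.of M).det) A).map_neg
    (J.transpose * A + A * J : Matrix (Fin n) (Fin n) ℝ)
  rw [e1, e2] at e3
  refine e4.trans ?_
  refine (congrArg Neg.neg e3).trans ?_
  ring

theorem fderiv_alternating_apply_const {E : Type*} [NormedAddCommGroup E] [NormedSpace ℝ E]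
    {k : ℕ} {η : H → E [⋀^Fin k]→L[ℝ] ℝ} {x : H} (hη : DifferentiableAt ℝ η x) (v : Fin k → E)
    (X : H) : fderiv ℝ (fun y => η y v) x X = fderiv ℝ η x X v := by
  rw [fderiv_continuousAlternatingMap_apply_const_apply hη]

/-- `hX` says that the Gram matrix `G` has derivative `-(Jᵀ G + G J)`, so `log |det G|` has
derivative `-2 tr J`, and the root halves it. -/
theorem fderiv_liouville {η : H → Z [⋀^Fin 2]→L[ℝ] ℝ} {x X : H}
    (hη : ContDiffAt ℝ 1 η x) (h : Nondeg (η x)) (J : Z →ₗ[ℝ] Z)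
    (hX : ∀ a b, fderiv ℝ η x X ![a, b] = -(η x ![J a, b] + η x ![a, J b])) :
    fderiv ℝ (fun y => liouville (η y)) x X = - (liouville (η x) * LinearMap.trace ℝ Z J) := by
  let b := Module.finBasis ℝ Z
  let Jm := LinearMap.toMatrix b b J
  have hg := contDiffAt_gram hη
  have hd : ContDiffAt ℝ 1 (fun y => (gram (η y)).det) x :=
    (contDiff_det _ 1).contDiffAt.comp x hg
  have hg' : fderiv ℝ (fun y i j => gram (η y) i j) x X
      = (-(Jm.transpose * gram (η x) + gram (η x) * Jm) : Matrix _ _ ℝ) := by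
    have hgd := hg.differentiableAt one_ne_zero
    ext i j
    have h1 : fderiv ℝ (fun y i j => gram (η y) i j) x X i j
        = fderiv ℝ (fun y => η y ![b i, b j]) x X := by
      have := (hasFDerivAt_pi'.1 (hasFDerivAt_pi'.1 hgd.hasFDerivAt i) j).fderiv
      exact (congrArg (fun L => L X) this).symm
    rw [h1, fderiv_alternating_apply_const (hη.differentiableAt one_ne_zero), hX]
    have h2 : ∀ i, J (b i) = ∑ k, Jm k i • b k := fun i => by
      simp [Jm, LinearMap.toMatrix_apply, b.sum_repr]
    have h3 : η x ![J (b i), b j] = (Jm.transpose * gram (η x)) i j := by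
      rw [← bilin_apply, h2, map_sum, LinearMap.sum_apply, Matrix.mul_apply]
      simp [gram, b]
    have h4 : η x ![b i, J (b j)] = (gram (η x) * Jm) i j := by
      rw [← bilin_apply, h2, map_sum, Matrix.mul_apply]
      simp [gram, b, mul_comm]
    rw [h3, h4]
    rfl
  have hdet : fderiv ℝ (fun y => (gram (η y)).det) x X
      = -2 * ((gram (η x)).det * Jm.trace) := by
    have := fderiv_comp (𝕜 := ℝ) x (g := fun M : Fin (Module.finrank ℝ Z) →
      Fin (Module.finrank ℝ Z) → ℝ => (Matrix.of M).det) (f := fun y i j => gram (η y) i j)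
      ((contDiff_det _ 1).differentiable (by simp) _) (hg.differentiableAt one_ne_zero)
    have h' := congrArg (fun L => L X) this
    refine h'.trans ?_
    rw [ContinuousLinearMap.comp_apply, hg']
    exact fderiv_det_apply _ _
  have hdd := (hd.differentiableAt one_ne_zero).hasFDerivAt
  rw [(h.liouville_eventuallyEq hd.continuousAt).fderiv_eq]
  have hf := (((hdd.log h.det_ne_zero).mul_const (2⁻¹)).exp).fderiv
  simp only [← div_eq_mul_inv] at hf
  rw [hf]
  have hq : liouville (η x) = Real.exp (Real.log (gram (η x)).det / 2) :=
    (h.liouville_eventuallyEq hd.continuousAt).eq_of_nhds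
  rw [hq, LinearMap.trace_eq_matrix_trace ℝ b]
  have h0 := h.det_ne_zero
  simp only [smul_apply, hdet, smul_eq_mul]
  field_simp
  rfl

end Liouville

/-! ### Product rules and low-degree formulas for the exterior derivative -/

section Calculus

variable {H : Type*} [NormedAddCommGroup H] [NormedSpace ℝ H]
  {E : Type*} [NormedAddCommGroup E] [NormedSpace ℝ E]

theorem fderiv_form_two_apply {η : H → E [⋀^Fin 2]→L[ℝ] ℝ} {a b : H → E} {x : H}
    (hη : DifferentiableAt ℝ η x) (ha : DifferentiableAt ℝ a x) (hb : DifferentiableAt ℝ b x)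
    (v : H) :
    fderiv ℝ (fun y => η y ![a y, b y]) x v
      = fderiv ℝ η x v ![a x, b x] + η x ![fderiv ℝ a x v, b x] + η x ![a x, fderiv ℝ b x v] := by
  have e : (fun y => η y ![a y, b y]) = fun y => η y (fun i => (![a, b] : Fin 2 → H → E) i y) := by
    funext y
    congr 1
    funext i
    fin_cases i <;> rfl
  have h := fderiv_continuousAlternatingMap_apply_apply (f := η)
    (g := (![a, b] : Fin 2 → H → E)) (x := x) hη (fun i => by fin_cases i <;> assumption) v
  rw [e, h, Fin.sum_univ_two, add_assoc]
  congr 1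
  · congr 1
    funext i
    fin_cases i <;> rfl
  · congr 2
    · funext i
      fin_cases i <;> simp
    · funext i
      fin_cases i <;> simp

theorem fderiv_form_one_apply {η : H → E [⋀^Fin 1]→L[ℝ] ℝ} {a : H → E} {x : H}
    (hη : DifferentiableAt ℝ η x) (ha : DifferentiableAt ℝ a x) (v : H) :
    fderiv ℝ (fun y => η y ![a y]) x v
      = fderiv ℝ η x v ![a x] + η x ![fderiv ℝ a x v] := by
  have e : (fun y => η y ![a y]) = fun y => η y (fun i => (![a] : Fin 1 → H → E) i y) := by
    funext y
    congr 1
    funext i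
    fin_cases i; rfl
  have h := fderiv_continuousAlternatingMap_apply_apply (f := η)
    (g := (![a] : Fin 1 → H → E)) (x := x) hη (fun i => by fin_cases i; assumption) v
  rw [e, h, Fin.sum_univ_one]
  congr 2
  · funext i
    fin_cases i; rfl
  · funext i
    fin_cases i; simp

theorem extDeriv_two_apply (η : E → E [⋀^Fin 2]→L[ℝ] ℝ) (o x y z : E) :
    extDeriv η o ![x, y, z]
      = fderiv ℝ η o x ![y, z] - fderiv ℝ η o y ![x, z] + fderiv ℝ η o z ![x, y] := by
  have h0 : (0 : Fin 3).removeNth ![x, y, z] = ![y, z] := by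
    funext i; fin_cases i <;> rfl
  have h1 : (1 : Fin 3).removeNth ![x, y, z] = ![x, z] := by
    funext i; fin_cases i <;> rfl
  have h2 : (2 : Fin 3).removeNth ![x, y, z] = ![x, y] := by
    funext i; fin_cases i <;> rfl
  rw [extDeriv, ContinuousAlternatingMap.alternatizeUncurryFin_apply, Fin.sum_univ_three,
    h0, h1, h2]
  simp
  ring

theorem extDeriv_one_apply (η : E → E [⋀^Fin 1]→L[ℝ] ℝ) (o x y : E) :
    extDeriv η o ![x, y] = fderiv ℝ η o x ![y] - fderiv ℝ η o y ![x] := by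
  have h0 : (0 : Fin 2).removeNth ![x, y] = ![y] := by
    funext i; fin_cases i; rfl
  have h1 : (1 : Fin 2).removeNth ![x, y] = ![x] := by
    funext i; fin_cases i; rfl
  rw [extDeriv, ContinuousAlternatingMap.alternatizeUncurryFin_apply, Fin.sum_univ_two, h0, h1]
  simp
  ring

end Calculus

/-! ### Fields preserving the fiberwise restriction of a closed form -/

section Divergence

variable {V : Type*} [NormedAddCommGroup V] [NormedSpace ℝ V]
  {Z : Type*} [NormedAddCommGroup Z] [NormedSpace ℝ Z]

/-- The restriction of a form on a product to the second factor. -/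
def fiberPart {k : ℕ} (η : (V × Z) [⋀^Fin k]→L[ℝ] ℝ) : Z [⋀^Fin k]→L[ℝ] ℝ :=
  η.compContinuousLinearMap (ContinuousLinearMap.inr ℝ V Z)

theorem fiberPart_two_apply (η : (V × Z) [⋀^Fin 2]→L[ℝ] ℝ) (a b : Z) :
    fiberPart η ![a, b] = η ![(0, a), (0, b)] := comp_two_apply η _ a b

theorem ContDiffAt.fiberPart {H : Type*} [NormedAddCommGroup H] [NormedSpace ℝ H]
    [FiniteDimensional ℝ Z] {k : ℕ}
    {η : H → (V × Z) [⋀^Fin k]→L[ℝ] ℝ} {x : H} {n : WithTop ℕ∞} (h : ContDiffAt ℝ n η x) :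
    ContDiffAt ℝ n (fun y => fiberPart (η y)) x :=
  ContDiffWithinAt.alternating_comp (s := univ) h contDiffWithinAt_const

/-- A vector field on a product whose first component is constant and whose contraction with a
closed form is closed on the fibers preserves the restriction of the form to the fibers. -/
theorem fderiv_form_two_of_closed {η : V × Z → (V × Z) [⋀^Fin 2]→L[ℝ] ℝ} {X : V × Z → V × Z}
    {o : V × Z} {v : V} (hη : DifferentiableAt ℝ η o) (hd : extDeriv η o = 0)
    (hX : DifferentiableAt ℝ X o) (hX1 : ∀ᶠ o' in 𝓝 o, (X o').1 = v)
    (hcl : ∀ a b : Z, fderiv ℝ (fun o' => η o' ![X o', (0, b)]) o (0, a)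
      = fderiv ℝ (fun o' => η o' ![X o', (0, a)]) o (0, b)) (a b : Z) :
    fderiv ℝ η o (X o) ![(0, a), (0, b)]
      = -(η o ![(0, (fderiv ℝ X o (0, a)).2), (0, b)]
        + η o ![(0, a), (0, (fderiv ℝ X o (0, b)).2)]) := by
  have h1 : ∀ w, (fderiv ℝ X o w).1 = 0 := by
    intro w
    have h := (hX.hasFDerivAt.fst).fderiv
    have h' : fderiv ℝ (fun o' => (X o').1) o = 0 := by
      rw [Filter.EventuallyEq.fderiv_eq (f := fun _ => v) hX1]
      exact fderiv_const_apply v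
    rw [h'] at h
    exact (congrArg (fun L => L w) h).symm
  have h2 : ∀ w, ((0 : V), (fderiv ℝ X o w).2) = fderiv ℝ X o w := fun w =>
    Prod.ext (h1 w).symm rfl
  -- Cartan's formula by hand: closedness trades the derivative of `η` along `X` for derivatives
  -- along the fiber directions `a` and `b`, and `hcl` turns their difference into the two terms
  -- containing the derivative of `X`.
  have e := extDeriv_two_apply η o (X o) (0, a) (0, b)
  rw [hd] at e
  have ha := hcl a b
  rw [fderiv_form_two_apply hη hX (differentiableAt_const _),
    fderiv_form_two_apply hη hX (differentiableAt_const _)] at ha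
  have z : η o ![X o, 0] = 0 :=
    (η o).toAlternatingMap.map_coord_zero (m := ![X o, 0]) 1 rfl
  simp only [fderiv_const_apply, zero_apply, z] at ha
  rw [h2, h2, form_two_swap (η o) (0, a) (fderiv ℝ X o (0, b))]
  change (0 : ℝ) = _ at e
  linarith

variable [FiniteDimensional ℝ Z]

/-- The Liouville density on the fibers of a product. -/
def fiberDensity (η : V × Z → (V × Z) [⋀^Fin 2]→L[ℝ] ℝ) (o : V × Z) : ℝ :=
  liouville (fiberPart (η o))

/-- This is the continuity equation: along `X` the density changes by minus itself times the
divergence of the fiber component of `X`. -/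
theorem fderiv_fiberDensity {η : V × Z → (V × Z) [⋀^Fin 2]→L[ℝ] ℝ} {X : V × Z → V × Z}
    {o : V × Z} {v : V} (hη : ContDiffAt ℝ 1 η o) (hd : extDeriv η o = 0)
    (hnd : Nondeg (fiberPart (η o)))
    (hX : DifferentiableAt ℝ X o) (hX1 : ∀ᶠ o' in 𝓝 o, (X o').1 = v)
    (hcl : ∀ a b : Z, fderiv ℝ (fun o' => η o' ![X o', (0, b)]) o (0, a)
      = fderiv ℝ (fun o' => η o' ![X o', (0, a)]) o (0, b)) :
    fderiv ℝ (fiberDensity η) o (X o) = -(fiberDensity η o *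
      LinearMap.trace ℝ Z ((ContinuousLinearMap.snd ℝ V Z).comp
        ((fderiv ℝ X o).comp (ContinuousLinearMap.inr ℝ V Z)))) := by
  refine fderiv_liouville (ContDiffAt.fiberPart hη) hnd _ fun a b => ?_
  rw [← fderiv_alternating_apply_const ((ContDiffAt.fiberPart hη).differentiableAt one_ne_zero)]
  simp only [fiberPart_two_apply]
  rw [fderiv_alternating_apply_const (hη.differentiableAt one_ne_zero)]
  exact fderiv_form_two_of_closed (hη.differentiableAt one_ne_zero) hd hX hX1 hcl a b

end Divergence

/-! ### Parameter integrals and differentiation along a density-preserving field -/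

section Integration

open MeasureTheory

theorem integrableOn_of_compact {Z : Type*} [NormedAddCommGroup Z]
    [MeasurableSpace Z] [BorelSpace Z] (μ : Measure Z) [IsFiniteMeasureOnCompacts μ]
    {W K : Set Z} (hW : MeasurableSet W) (hK : IsCompact K)
    (hKW : K ⊆ W) {f : Z → ℝ} (hf : ContinuousOn f W) (h0 : ∀ z ∈ W, z ∉ K → f z = 0) :
    IntegrableOn f W μ :=
  ((hf.mono hKW).integrableOn_compact hK).of_forall_sdiff_eq_zero hW
    fun z hz => h0 z hz.1 hz.2

variable {V : Type*} [NormedAddCommGroup V] [NormedSpace ℝ V]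
  {Z : Type*} [NormedAddCommGroup Z] [NormedSpace ℝ Z]

/-- Smoothness is local, and `W` and the complement of `K` cover the second factor: on the former
the function is `G`, on the latter it is zero. -/
theorem contDiffOn_indicator {F' : Type*} [NormedAddCommGroup F'] [NormedSpace ℝ F']
    {U : Set V} {W K : Set Z} (hU : IsOpen U) (hW : IsOpen W) (hK : IsCompact K) (hKW : K ⊆ W)
    {G : V × Z → F'} {n : WithTop ℕ∞} (hG : ContDiffOn ℝ n G (U ×ˢ W))
    (hG0 : ∀ u ∈ U, ∀ z ∈ W, z ∉ K → G (u, z) = 0) :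
    ContDiffOn ℝ n (fun o : V × Z => W.indicator (fun z => G (o.1, z)) o.2) (U ×ˢ univ) := by
  rintro ⟨u, z⟩ ⟨hu, -⟩
  apply ContDiffAt.contDiffWithinAt
  by_cases hz : z ∈ K
  · have hm : U ×ˢ W ∈ 𝓝 (u, z) := (hU.prod hW).mem_nhds ⟨hu, hKW hz⟩
    refine (hG.contDiffAt hm).congr_of_eventuallyEq ?_
    filter_upwards [hm] with o ho
    exact indicator_of_mem ho.2 _
  · have hm : U ×ˢ Kᶜ ∈ 𝓝 (u, z) := (hU.prod hK.isClosed.isOpen_compl).mem_nhds ⟨hu, hz⟩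
    refine (contDiffAt_const (c := (0 : F'))).congr_of_eventuallyEq ?_
    filter_upwards [hm] with o ho
    by_cases hoW : o.2 ∈ W
    · rw [indicator_of_mem hoW]
      exact hG0 _ ho.1 _ hoW ho.2
    · exact indicator_of_notMem hoW _

variable [FiniteDimensional ℝ Z] [MeasurableSpace Z] [BorelSpace Z] (μ : Measure Z) [μ.IsAddHaarMeasure]

theorem integral_fderiv_apply_eq_zero {f : Z → ℝ} (hf : ContDiff ℝ 1 f) (hc : HasCompactSupport f)
    (w : Z) : Integrable (fun z => fderiv ℝ f z w) μ ∧ ∫ z, fderiv ℝ f z w ∂μ = 0 := by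
  have hi : Integrable (fun z => fderiv ℝ f z w) μ :=
    Continuous.integrable_of_hasCompactSupport
      ((hf.continuous_fderiv one_ne_zero).clm_apply continuous_const) (hc.fderiv_apply ℝ w)
  refine ⟨hi, ?_⟩
  -- Integration by parts against the constant function `1`.
  have h := integral_mul_fderiv_eq_neg_fderiv_mul_of_integrable (μ := μ) (f := fun _ : Z => (1 : ℝ))
    (g := f) (v := w) (by simp) (by simpa using hi)
    (by simpa using hf.continuous.integrable_of_hasCompactSupport hc)
    (fun _ _ => differentiableAt_const _) (fun x _ => hf.differentiable one_ne_zero x)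
  simpa using h

theorem integral_trace_fderiv_eq_zero {Y : Z → Z} (hY : ContDiff ℝ 1 Y)
    (hc : HasCompactSupport Y) : ∫ z, LinearMap.trace ℝ Z (fderiv ℝ Y z) ∂μ = 0 := by
  let b := Module.finBasis ℝ Z
  have h : ∀ z, LinearMap.trace ℝ Z (fderiv ℝ Y z)
      = ∑ i, fderiv ℝ (fun z => LinearMap.toContinuousLinearMap (b.coord i) (Y z)) z (b i) := by
    intro z
    rw [LinearMap.trace_eq_matrix_trace ℝ b, Matrix.trace]
    refine Finset.sum_congr rfl fun i _ => ?_
    have := ((LinearMap.toContinuousLinearMap (b.coord i)).hasFDerivAt.comp z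
      (hY.differentiable one_ne_zero z).hasFDerivAt).fderiv
    have h' := congrArg (fun L => L (b i)) this
    refine Eq.trans ?_ h'.symm
    simp [LinearMap.toMatrix_apply]
  have hi := fun i => integral_fderiv_apply_eq_zero μ
    (f := fun z => LinearMap.toContinuousLinearMap (b.coord i) (Y z))
    ((ContinuousLinearMap.contDiff _).comp hY)
    (hc.comp_left (g := LinearMap.toContinuousLinearMap (b.coord i)) (map_zero _)) (b i)
  simp_rw [h]
  rw [integral_finsetSum _ fun i _ => (hi i).1]
  exact Finset.sum_eq_zero fun i _ => (hi i).2

theorem contDiffOn_integral {U : Set V} {W K : Set Z} (hU : IsOpen U) (hW : IsOpen W)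
    (hK : IsCompact K) (hKW : K ⊆ W) {G : V × Z → ℝ} (hG : ContDiffOn ℝ ∞ G (U ×ˢ W))
    (hG0 : ∀ u ∈ U, ∀ z ∈ W, z ∉ K → G (u, z) = 0) :
    ContDiffOn ℝ ∞ (fun u => ∫ z in W, G (u, z) ∂μ) U := by
  -- The integral is the convolution of the constant `1` with the integrand extended by zero,
  -- evaluated at `0`. The reflection in the convolution is undone by the invariance of `μ` under
  -- negation.
  have h := contDiffOn_convolution_right_with_param_comp (μ := μ) (𝕜 := ℝ) (n := ⊤)
    (ContinuousLinearMap.mul ℝ ℝ) (s := U) (v := fun _ => (0 : Z)) contDiffOn_const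
    (f := fun _ => (1 : ℝ)) (g := fun u z => W.indicator (fun z => G (u, z)) z) (k := K) hU hK
    (fun u z hu hz => by
      by_cases hzW : z ∈ W
      · rw [indicator_of_mem hzW]; exact hG0 u hu z hzW hz
      · exact indicator_of_notMem hzW _)
    (locallyIntegrable_const 1) (contDiffOn_indicator hU hW hK hKW hG hG0)
  refine h.congr fun u _ => ?_
  rw [convolution]
  simp only [ContinuousLinearMap.mul_apply', one_mul, zero_sub]
  rw [integral_neg_eq_self (fun z => W.indicator (fun z => G (u, z)) z) μ,
    integral_indicator hW.measurableSet]

variable [FiniteDimensional ℝ V]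

theorem fderiv_integral_of_compact {U : Set V} {W K : Set Z} (hU : IsOpen U) (hW : IsOpen W)
    (hK : IsCompact K) (hKW : K ⊆ W) {G : V × Z → ℝ} (hG : ContDiffOn ℝ 1 G (U ×ˢ W))
    (hG0 : ∀ u ∈ U, ∀ z ∈ W, z ∉ K → G (u, z) = 0) {u₀ : V} (hu₀ : u₀ ∈ U) (v : V) :
    fderiv ℝ (fun u => ∫ z in W, G (u, z) ∂μ) u₀ v
      = ∫ z in W, fderiv ℝ G (u₀, z) (v, 0) ∂μ := by
  obtain ⟨r, hr, hrU⟩ := Metric.nhds_basis_closedBall.mem_iff.1 (hU.mem_nhds hu₀)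
  let F' : V → Z → V →L[ℝ] ℝ := fun u z =>
    (fderiv ℝ G (u, z)).comp (ContinuousLinearMap.inl ℝ V Z)
  have hdiff : ∀ u ∈ U, ∀ z ∈ W, HasFDerivAt G (fderiv ℝ G (u, z)) (u, z) := fun u hu z hz =>
    ((hG.contDiffAt ((hU.prod hW).mem_nhds ⟨hu, hz⟩)).differentiableAt one_ne_zero).hasFDerivAt
  have hF'c : ContinuousOn (fun o : V × Z => F' o.1 o.2) (U ×ˢ W) :=
    (hG.continuousOn_fderiv_of_isOpen (hU.prod hW) le_rfl).clm_comp continuousOn_const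
  have hF'0 : ∀ u ∈ U, ∀ z ∈ W, z ∉ K → F' u z = 0 := by
    intro u hu z hz hzK
    have : fderiv ℝ G (u, z) = 0 := by
      have hm : U ×ˢ (W ∩ Kᶜ) ∈ 𝓝 (u, z) :=
        (hU.prod (hW.inter hK.isClosed.isOpen_compl)).mem_nhds ⟨hu, hz, hzK⟩
      rw [Filter.EventuallyEq.fderiv_eq (f := fun _ => (0 : ℝ))]
      · exact fderiv_const_apply _
      · filter_upwards [hm] with o ho
        exact hG0 _ ho.1 _ ho.2.1 ho.2.2
    simp [F', this]
  -- The dominating function is this bound on `K` and zero elsewhere, since the derivative vanishes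
  -- off `K`.
  obtain ⟨C, hC⟩ := ((isCompact_closedBall u₀ r).prod hK).exists_bound_of_continuousOn
    (hF'c.mono (prod_mono hrU hKW))
  have hmeas : AEStronglyMeasurable (F' u₀) (μ.restrict W) :=
    (hF'c.comp (f := fun z => (u₀, z)) (by fun_prop)
      fun z hz => ⟨hu₀, hz⟩).aestronglyMeasurable hW.measurableSet
  have hbound : ∀ᵐ z ∂μ.restrict W, ∀ u ∈ Metric.closedBall u₀ r,
      ‖F' u z‖ ≤ K.indicator (fun _ => C) z := by
    filter_upwards [ae_restrict_mem hW.measurableSet] with z hz u hu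
    by_cases hzK : z ∈ K
    · rw [indicator_of_mem hzK]
      exact hC (u, z) ⟨hu, hzK⟩
    · rw [indicator_of_notMem hzK, hF'0 u (hrU hu) z hz hzK, norm_zero]
  have hbi : Integrable (K.indicator fun _ => C) (μ.restrict W) :=
    ((integrableOn_const hK.measure_lt_top.ne).integrable_indicator
      hK.isClosed.measurableSet).integrableOn
  have h := hasFDerivAt_integral_of_dominated_of_fderiv_le (𝕜 := ℝ) (μ := μ.restrict W)
    (F := fun u z => G (u, z)) (F' := F') (x₀ := u₀) (s := Metric.closedBall u₀ r)
    (bound := K.indicator fun _ => C) (Metric.closedBall_mem_nhds u₀ hr) ?_ ?_ hmeas hbound hbi ?_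
  · rw [h.fderiv, ContinuousLinearMap.integral_apply]
    · rfl
    · exact hbi.mono' hmeas
        (hbound.mono fun z hz => hz u₀ (Metric.mem_closedBall_self hr.le))
  · filter_upwards [hU.mem_nhds hu₀] with u hu
    exact (hG.continuousOn.comp (f := fun z => (u, z)) (by fun_prop)
      fun z hz => ⟨hu, hz⟩).aestronglyMeasurable hW.measurableSet
  · exact integrableOn_of_compact μ hW.measurableSet hK hKW
      (hG.continuousOn.comp (f := fun z => (u₀, z)) (by fun_prop) fun z hz => ⟨hu₀, hz⟩)
      (hG0 u₀ hu₀)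
  · filter_upwards [ae_restrict_mem hW.measurableSet] with z hz u hu
    exact (hdiff u (hrU hu) z hz).comp u (f := fun u => (u, z)) (hasFDerivAt_prodMk_left u z)

/-- With `G = g q`, `q` the density, the continuity equation gives `(X g) q = ∂_v G + div (G X₂)`,
where `X₂` is the fiber component of `X`. The field `G X₂` has compact support, so its divergence
integrates to zero, and `∂_v` passes under the integral sign. -/
theorem fderiv_fiberIntegral {U : Set V} {W K : Set Z} (hU : IsOpen U) (hW : IsOpen W)
    (hK : IsCompact K) (hKW : K ⊆ W)
    {η : V × Z → (V × Z) [⋀^Fin 2]→L[ℝ] ℝ} (hη : ContDiffOn ℝ ∞ η (U ×ˢ W))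
    (hd : ∀ o ∈ U ×ˢ W, extDeriv η o = 0) (hnd : ∀ o ∈ U ×ˢ W, Nondeg (fiberPart (η o)))
    {X : V × Z → V × Z} (hX : ContDiffOn ℝ ∞ X (U ×ˢ W)) {v : V} (hX1 : ∀ o ∈ U ×ˢ W, (X o).1 = v)
    (hcl : ∀ o ∈ U ×ˢ W, ∀ a b : Z, fderiv ℝ (fun o' => η o' ![X o', (0, b)]) o (0, a)
      = fderiv ℝ (fun o' => η o' ![X o', (0, a)]) o (0, b))
    {g : V × Z → ℝ} (hg : ContDiffOn ℝ ∞ g (U ×ˢ W))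
    (hg0 : ∀ u ∈ U, ∀ z ∈ W, z ∉ K → g (u, z) = 0) {u₀ : V} (hu₀ : u₀ ∈ U) :
    fderiv ℝ (fun u => ∫ z in W, g (u, z) * fiberDensity η (u, z) ∂μ) u₀ v
      = ∫ z in W, fderiv ℝ g (u₀, z) (X (u₀, z)) * fiberDensity η (u₀, z) ∂μ := by
  have hO : IsOpen (U ×ˢ W) := hU.prod hW
  have hq : ContDiffOn ℝ ∞ (fiberDensity η) (U ×ˢ W) := fun o ho =>
    (contDiffAt_liouville (ContDiffAt.fiberPart (hη.contDiffAt (hO.mem_nhds ho)))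
      (hnd o ho)).contDiffWithinAt
  let G : V × Z → ℝ := fun o => g o * fiberDensity η o
  have hG : ContDiffOn ℝ ∞ G (U ×ˢ W) := hg.mul hq
  have hG0 : ∀ u ∈ U, ∀ z ∈ W, z ∉ K → G (u, z) = 0 := fun u hu z hz hzK => by
    simp [G, hg0 u hu z hz hzK]
  rw [fderiv_integral_of_compact μ hU hW hK hKW (hG.of_le (by simp)) hG0 hu₀ v]
  let Y₀ : V × Z → Z := fun o => G o • (X o).2
  have hY₀ : ContDiffOn ℝ ∞ Y₀ (U ×ˢ W) := hG.smul hX.snd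
  have hY₀0 : ∀ u ∈ U, ∀ z ∈ W, z ∉ K → Y₀ (u, z) = 0 := fun u hu z hz hzK => by
    simp [Y₀, hG0 u hu z hz hzK]
  let Y : Z → Z := W.indicator fun z => Y₀ (u₀, z)
  have hY : ContDiff ℝ 1 Y := by
    have := (contDiffOn_indicator hU hW hK hKW hY₀ hY₀0).comp (s := univ) (f := fun z => (u₀, z))
      (by fun_prop) (fun z _ => ⟨hu₀, mem_univ _⟩)
    exact (contDiffOn_univ.1 this).of_le (by simp)
  have hYK : ∀ z, z ∉ K → Y z = 0 := fun z hz => by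
    by_cases hzW : z ∈ W
    · exact (indicator_of_mem hzW _).trans (hY₀0 u₀ hu₀ z hzW hz)
    · exact indicator_of_notMem hzW _
  have hYc : HasCompactSupport Y := HasCompactSupport.intro hK hYK
  have hY' : ∀ z, z ∉ K → fderiv ℝ Y z = 0 := fun z hz => by
    rw [Filter.EventuallyEq.fderiv_eq (f := fun _ => (0 : Z))]
    · exact fderiv_const_apply _
    · filter_upwards [hK.isClosed.isOpen_compl.mem_nhds hz] with z hz
      exact hYK z hz
  have hint := integral_trace_fderiv_eq_zero μ hY hYc
  rw [← setIntegral_eq_integral_of_forall_compl_eq_zero (s := W)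
    (fun z hz => by rw [hY' z (fun h => hz (hKW h))]; simp)] at hint
  have key : ∀ z ∈ W, fderiv ℝ g (u₀, z) (X (u₀, z)) * fiberDensity η (u₀, z)
      = fderiv ℝ G (u₀, z) (v, 0) + LinearMap.trace ℝ Z (fderiv ℝ Y z) := by
    intro z hz
    have ho : (u₀, z) ∈ U ×ˢ W := ⟨hu₀, hz⟩
    have hn := hO.mem_nhds ho
    have dq := ((hq.contDiffAt hn).differentiableAt (by simp))
    have dg := ((hg.contDiffAt hn).differentiableAt (by simp))
    have dG := ((hG.contDiffAt hn).differentiableAt (by simp))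
    have dX := ((hX.contDiffAt hn).differentiableAt (by simp))
    have hGX : fderiv ℝ G (u₀, z) (X (u₀, z))
        = g (u₀, z) * fderiv ℝ (fiberDensity η) (u₀, z) (X (u₀, z))
          + fiberDensity η (u₀, z) * fderiv ℝ g (u₀, z) (X (u₀, z)) := by
      have := (dg.hasFDerivAt.mul dq.hasFDerivAt).fderiv
      have h' := congrArg (fun L => L (X (u₀, z))) this
      refine h'.trans ?_
      simp
    have hdiv := fderiv_fiberDensity ((hη.contDiffAt hn).of_le (by simp)) (hd _ ho) (hnd _ ho)
      dX (v := v) (by filter_upwards [hn] with o' ho' using hX1 o' ho') (hcl _ ho)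
    have hsplit : X (u₀, z) = (v, 0) + (0, (X (u₀, z)).2) := by
      ext
      · simp [hX1 _ ho]
      · simp
    have hGs : fderiv ℝ G (u₀, z) (X (u₀, z))
        = fderiv ℝ G (u₀, z) (v, 0) + fderiv ℝ G (u₀, z) (0, (X (u₀, z)).2) := by
      conv_lhs => rw [hsplit]
      exact map_add _ _ _
    have hYd : fderiv ℝ Y z = G (u₀, z) • ((ContinuousLinearMap.snd ℝ V Z).comp
        ((fderiv ℝ X (u₀, z)).comp (ContinuousLinearMap.inr ℝ V Z)))
        + ((fderiv ℝ G (u₀, z)).comp (ContinuousLinearMap.inr ℝ V Z)).smulRight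
          (X (u₀, z)).2 := by
      have h1 : Y =ᶠ[𝓝 z] fun z => Y₀ (u₀, z) := by
        filter_upwards [hW.mem_nhds hz] with z hz
        exact indicator_of_mem hz _
      rw [h1.fderiv_eq]
      have h2 := (dG.hasFDerivAt.smul dX.hasFDerivAt.snd).comp z (f := fun z => (u₀, z))
        (hasFDerivAt_prodMk_right u₀ z)
      exact h2.fderiv
    rw [hYd]
    -- The derivative of `G X₂` is `G` times that of `X₂` plus a rank one map; the trace of the
    -- latter is the derivative of `G` along `X₂`.
    have htr : LinearMap.trace ℝ Z ((((fderiv ℝ G (u₀, z)).comp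
        (ContinuousLinearMap.inr ℝ V Z)).smulRight (X (u₀, z)).2 : Z →L[ℝ] Z) : Z →ₗ[ℝ] Z)
        = fderiv ℝ G (u₀, z) (0, (X (u₀, z)).2) := by
      have := LinearMap.trace_smulRight (R := ℝ) (M := Z) (((fderiv ℝ G (u₀, z)).comp
        (ContinuousLinearMap.inr ℝ V Z)) : Z →ₗ[ℝ] ℝ) (X (u₀, z)).2
      exact this
    rw [ContinuousLinearMap.toLinearMap_add, map_add, htr, ContinuousLinearMap.toLinearMap_smul, map_smul,
      smul_eq_mul]
    rw [hdiv] at hGX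
    simp only [G] at hGX hGs ⊢
    linarith
  rw [setIntegral_congr_fun hW.measurableSet key, integral_add, hint, add_zero]
  · refine integrableOn_of_compact μ hW.measurableSet hK hKW ?_ ?_
    · have := (hG.continuousOn_fderiv_of_isOpen hO (by simp)).clm_apply
        (continuousOn_const (c := ((v, 0) : V × Z)))
      exact this.comp (f := fun z => (u₀, z)) (by fun_prop) fun z hz => ⟨hu₀, hz⟩
    · intro z hz hzK
      have hm : U ×ˢ (W ∩ Kᶜ) ∈ 𝓝 (u₀, z) :=
        (hU.prod (hW.inter hK.isClosed.isOpen_compl)).mem_nhds ⟨hu₀, hz, hzK⟩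
      rw [Filter.EventuallyEq.fderiv_eq (f := fun _ => (0 : ℝ)), fderiv_const_apply]
      · rfl
      · filter_upwards [hm] with o ho
        exact hG0 _ ho.1 _ ho.2.1 ho.2.2
  · refine integrableOn_of_compact μ hW.measurableSet hK hKW ?_ ?_
    · have h1 : Continuous fun z => fderiv ℝ Y z := hY.continuous_fderiv one_ne_zero
      have h2 : Continuous fun L : Z →L[ℝ] Z => LinearMap.trace ℝ Z (L : Z →ₗ[ℝ] Z) :=
        ((LinearMap.trace ℝ Z).comp (ContinuousLinearMap.coeLM ℝ)).continuous_of_finiteDimensional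
      exact (h2.comp h1).continuousOn
    · intro z _ hzK
      rw [hY' z hzK]
      simp

end Integration

/-! ### Product coordinates on the total space adapted to the projection -/

section ProductCharts

variable {EN : Type*} [NormedAddCommGroup EN] [NormedSpace ℝ EN]
  {EF : Type*} [NormedAddCommGroup EF] [NormedSpace ℝ EF]
  {EP : Type*} [NormedAddCommGroup EP] [NormedSpace ℝ EP]
  {N : Type*} [TopologicalSpace N] [ChartedSpace EN N]
  {F : Type*} [TopologicalSpace F] [ChartedSpace EF F]
  {P : Type*} [TopologicalSpace P] [ChartedSpace EP P]
  {p : P → N}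

variable (EF) in
/-- The parametrization of a piece of the fiber over `u` by the inverse of a chart of the typical
fiber and a trivialization. -/
def fiberChart (e : Bundle.Trivialization F p) (u : N) (y₀ : F) (z : EF) : P :=
  fiberEmbedding e u ((extChartAt 𝓘(ℝ, EF) y₀).symm z)

variable (EN EF) in
/-- The parametrization of a piece of the total space by the inverses of charts of the base and of
the typical fiber and a trivialization. -/
def prodChart (e : Bundle.Trivialization F p) (u₀ : N) (y₀ : F) (o : EN × EF) : P :=
  fiberChart EF e ((extChartAt 𝓘(ℝ, EN) u₀).symm o.1) y₀ o.2

variable (EN EF) in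
/-- The inverse of `prodChart`. -/
def prodChartInv (e : Bundle.Trivialization F p) (u₀ : N) (y₀ : F) (x : P) : EN × EF :=
  (extChartAt 𝓘(ℝ, EN) u₀ (p x), extChartAt 𝓘(ℝ, EF) y₀ (e x).2)

variable (EN) in
/-- The part of the base over which `prodChart` is defined, in the chart at `u₀`. -/
def baseDomain (e : Bundle.Trivialization F p) (u₀ : N) : Set EN :=
  (extChartAt 𝓘(ℝ, EN) u₀).target ∩ (extChartAt 𝓘(ℝ, EN) u₀).symm ⁻¹' e.baseSet

variable (EN EF) in
/-- The domain of `prodChart`. -/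
def prodDomain (e : Bundle.Trivialization F p) (u₀ : N) (y₀ : F) : Set (EN × EF) :=
  baseDomain EN e u₀ ×ˢ (extChartAt 𝓘(ℝ, EF) y₀).target

variable (EN) in
/-- The part of the total space over the domain of a chart and of a trivialization. -/
def tube (e : Bundle.Trivialization F p) (u₀ : N) : Set P :=
  p ⁻¹' ((extChartAt 𝓘(ℝ, EN) u₀).source ∩ e.baseSet)

variable {e : Bundle.Trivialization F p} {u₀ : N} {y₀ : F} {o : EN × EF}

theorem isOpen_baseDomain : IsOpen (baseDomain EN e u₀) :=
  (continuousOn_extChartAt_symm u₀).isOpen_inter_preimage (isOpen_extChartAt_target u₀)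
    e.open_baseSet

theorem isOpen_prodDomain : IsOpen (prodDomain EN EF e u₀ y₀) :=
  isOpen_baseDomain.prod (isOpen_extChartAt_target y₀)

theorem center_mem_baseDomain (h : u₀ ∈ e.baseSet) :
    extChartAt 𝓘(ℝ, EN) u₀ u₀ ∈ baseDomain EN e u₀ :=
  ⟨mem_extChartAt_target u₀, by rw [mem_preimage, extChartAt_to_inv]; exact h⟩

theorem proj_fiberEmbedding {u : N} (hu : u ∈ e.baseSet) (y : F) : p (fiberEmbedding e u y) = u :=
  e.proj_symm_apply' hu

theorem apply_fiberEmbedding {u : N} (hu : u ∈ e.baseSet) (y : F) :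
    e (fiberEmbedding e u y) = (u, y) := e.apply_symm_apply' hu

theorem fiberEmbedding_apply {x : P} (hx : p x ∈ e.baseSet) :
    fiberEmbedding e (p x) (e x).2 = x := e.symm_apply_mk_proj (e.mem_source.2 hx)

theorem proj_fiberChart {u : N} (hu : u ∈ e.baseSet) (z : EF) : p (fiberChart EF e u y₀ z) = u :=
  proj_fiberEmbedding hu _

theorem snd_fiberChart {u : N} (hu : u ∈ e.baseSet) (z : EF) :
    (e (fiberChart EF e u y₀ z)).2 = (extChartAt 𝓘(ℝ, EF) y₀).symm z := by
  rw [fiberChart, apply_fiberEmbedding hu]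

theorem proj_prodChart (ho : o ∈ prodDomain EN EF e u₀ y₀) :
    p (prodChart EN EF e u₀ y₀ o) = (extChartAt 𝓘(ℝ, EN) u₀).symm o.1 :=
  proj_fiberChart ho.1.2 _

theorem snd_prodChart (ho : o ∈ prodDomain EN EF e u₀ y₀) :
    (e (prodChart EN EF e u₀ y₀ o)).2 = (extChartAt 𝓘(ℝ, EF) y₀).symm o.2 :=
  snd_fiberChart ho.1.2 _

theorem prodChart_mem_tube (ho : o ∈ prodDomain EN EF e u₀ y₀) :
    prodChart EN EF e u₀ y₀ o ∈ tube EN e u₀ := by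
  rw [tube, mem_preimage, proj_prodChart ho]
  exact ⟨(extChartAt 𝓘(ℝ, EN) u₀).map_target ho.1.1, ho.1.2⟩

theorem prodChartInv_prodChart (ho : o ∈ prodDomain EN EF e u₀ y₀) :
    prodChartInv EN EF e u₀ y₀ (prodChart EN EF e u₀ y₀ o) = o := by
  rw [prodChartInv, proj_prodChart ho, snd_prodChart ho,
    (extChartAt 𝓘(ℝ, EN) u₀).right_inv ho.1.1, (extChartAt 𝓘(ℝ, EF) y₀).right_inv ho.2]

theorem prodChart_prodChartInv {x : P} (hx : x ∈ tube EN e u₀)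
    (hy : (e x).2 ∈ (extChartAt 𝓘(ℝ, EF) y₀).source) :
    prodChart EN EF e u₀ y₀ (prodChartInv EN EF e u₀ y₀ x) = x := by
  rw [prodChart, prodChartInv, fiberChart, (extChartAt 𝓘(ℝ, EN) u₀).left_inv hx.1,
    (extChartAt 𝓘(ℝ, EF) y₀).left_inv hy, fiberEmbedding_apply hx.2]

theorem prodChartInv_mem {x : P} (hx : x ∈ tube EN e u₀)
    (hy : (e x).2 ∈ (extChartAt 𝓘(ℝ, EF) y₀).source) :
    prodChartInv EN EF e u₀ y₀ x ∈ prodDomain EN EF e u₀ y₀ :=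
  ⟨⟨(extChartAt 𝓘(ℝ, EN) u₀).map_source hx.1, by
    simpa only [prodChartInv, mem_preimage, (extChartAt 𝓘(ℝ, EN) u₀).left_inv hx.1] using hx.2⟩,
    (extChartAt 𝓘(ℝ, EF) y₀).map_source hy⟩

theorem exists_prodChart {x : P} (hx : x ∈ tube EN e u₀) :
    ∃ o ∈ prodDomain EN EF e u₀ (e x).2, prodChart EN EF e u₀ (e x).2 o = x :=
  ⟨_, prodChartInv_mem hx (mem_extChartAt_source _),
    prodChart_prodChartInv hx (mem_extChartAt_source _)⟩

theorem mem_tube_center {x : P} (hx : p x ∈ e.baseSet) : x ∈ tube EN e (p x) :=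
  ⟨mem_extChartAt_source _, hx⟩

variable {σ : Form EF F 2}

theorem isOpen_tube (S : SymplecticFibration EN EP p σ) : IsOpen (tube EN e u₀) :=
  ((isOpen_extChartAt_source u₀).inter e.open_baseSet).preimage S.contMDiff_proj.continuous

theorem isOpen_prodSource (S : SymplecticFibration EN EP p σ) :
    IsOpen (tube EN e u₀ ∩ (fun x => (e x).2) ⁻¹' (extChartAt 𝓘(ℝ, EF) y₀).source) := by
  refine ContinuousOn.isOpen_inter_preimage ?_ (isOpen_tube S) (isOpen_extChartAt_source y₀)
  exact continuous_snd.comp_continuousOn (e.toOpenPartialHomeomorph.continuousOn.mono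
    fun x (hx : x ∈ tube EN e u₀) => e.mem_source.2 hx.2)

variable (EN EF EP) in
/-- The derivative of `prodChart`. -/
def dChart (e : Bundle.Trivialization F p) (u₀ : N) (y₀ : F) (o : EN × EF) : EN × EF →L[ℝ] EP :=
  mfderiv 𝓘(ℝ, EN × EF) 𝓘(ℝ, EP) (prodChart EN EF e u₀ y₀) o

variable (EN EF EP) in
/-- The derivative of the inverse of `prodChart`. -/
def dChartInv (e : Bundle.Trivialization F p) (u₀ : N) (y₀ : F) (o : EN × EF) :
    EP →L[ℝ] EN × EF :=
  mfderiv 𝓘(ℝ, EP) 𝓘(ℝ, EN × EF) (prodChartInv EN EF e u₀ y₀) (prodChart EN EF e u₀ y₀ o)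

variable (EN EP) in
/-- The derivative of the projection of a fibration. -/
def dProj (p : P → N) (x : P) : EP →L[ℝ] EN := mfderiv 𝓘(ℝ, EP) 𝓘(ℝ, EN) p x

variable (EN) in
/-- The derivative of the inverse of the chart at `u₀`. -/
def dBase (u₀ : N) (t : EN) : EN →L[ℝ] EN :=
  mfderiv 𝓘(ℝ, EN) 𝓘(ℝ, EN) (extChartAt 𝓘(ℝ, EN) u₀).symm t

theorem along_prodChart_two (Ω : Form EP P 2) (a b : EN × EF) :
    Ω.along (prodChart EN EF e u₀ y₀) o ![a, b]
      = Ω (prodChart EN EF e u₀ y₀ o) ![dChart EN EF EP e u₀ y₀ o a, dChart EN EF EP e u₀ y₀ o b] :=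
  comp_two_apply (E := EP) (Ω (prodChart EN EF e u₀ y₀ o)) (dChart EN EF EP e u₀ y₀ o) a b

theorem comp_one_apply {E E' : Type*} [NormedAddCommGroup E] [NormedSpace ℝ E]
    [NormedAddCommGroup E'] [NormedSpace ℝ E']
    (η : E [⋀^Fin 1]→L[ℝ] ℝ) (T : E' →L[ℝ] E) (a : E') :
    η.compContinuousLinearMap T ![a] = η ![T a] := by
  rw [ContinuousAlternatingMap.compContinuousLinearMap_apply]
  congr 1
  funext i
  fin_cases i; rfl

theorem along_prodChart_one (α : Form EP P 1) (a : EN × EF) :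
    α.along (prodChart EN EF e u₀ y₀) o ![a]
      = α (prodChart EN EF e u₀ y₀ o) ![dChart EN EF EP e u₀ y₀ o a] :=
  comp_one_apply (E := EP) (α (prodChart EN EF e u₀ y₀ o)) (dChart EN EF EP e u₀ y₀ o) a

variable (S : SymplecticFibration EN EP p σ) [IsManifold 𝓘(ℝ, EN) ∞ N] [IsManifold 𝓘(ℝ, EF) ∞ F]

theorem contMDiffOn_prodChart (he : e ∈ S.atlas) :
    ContMDiffOn 𝓘(ℝ, EN × EF) 𝓘(ℝ, EP) ∞ (prodChart EN EF e u₀ y₀) (prodDomain EN EF e u₀ y₀) := by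
  have h1 : ContMDiffOn 𝓘(ℝ, EN × EF) 𝓘(ℝ, EN) ∞
      (fun o : EN × EF => (extChartAt 𝓘(ℝ, EN) u₀).symm o.1) (prodDomain EN EF e u₀ y₀) :=
    (contMDiffOn_extChartAt_symm u₀).comp (contDiff_fst.contMDiff.contMDiffOn)
      fun o ho => ho.1.1
  have h2 : ContMDiffOn 𝓘(ℝ, EN × EF) 𝓘(ℝ, EF) ∞
      (fun o : EN × EF => (extChartAt 𝓘(ℝ, EF) y₀).symm o.2) (prodDomain EN EF e u₀ y₀) :=
    (contMDiffOn_extChartAt_symm y₀).comp (contDiff_snd.contMDiff.contMDiffOn)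
      fun o ho => ho.2
  exact (S.contMDiffOn_symm e he).comp (h1.prodMk h2) fun o ho => e.mem_target.2 ho.1.2

theorem contMDiffOn_fiberChart (he : e ∈ S.atlas) {u : N} (hu : u ∈ e.baseSet) :
    ContMDiffOn 𝓘(ℝ, EF) 𝓘(ℝ, EP) ∞ (fiberChart EF e u y₀) (extChartAt 𝓘(ℝ, EF) y₀).target :=
  (S.contMDiffOn_symm e he).comp (contMDiffOn_const.prodMk (contMDiffOn_extChartAt_symm y₀))
    fun _ _ => e.mem_target.2 hu

theorem contMDiffOn_prodChartInv (he : e ∈ S.atlas) :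
    ContMDiffOn 𝓘(ℝ, EP) 𝓘(ℝ, EN × EF) ∞ (prodChartInv EN EF e u₀ y₀)
      (tube EN e u₀ ∩ (fun x => (e x).2) ⁻¹' (extChartAt 𝓘(ℝ, EF) y₀).source) := by
  refine ContMDiffOn.prodMk_space ?_ ?_
  · exact (contMDiffOn_extChartAt (I := 𝓘(ℝ, EN)) (x := u₀)).comp S.contMDiff_proj.contMDiffOn
      fun x hx => by simpa using hx.1.1
  · refine (contMDiffOn_extChartAt (I := 𝓘(ℝ, EF)) (x := y₀)).comp
      (contMDiff_snd.comp_contMDiffOn ((S.contMDiffOn e he).mono fun x hx => ?_))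
      fun x hx => by simpa using hx.2
    exact e.mem_source.2 hx.1.2

theorem mdifferentiableAt_prodChart (he : e ∈ S.atlas) (ho : o ∈ prodDomain EN EF e u₀ y₀) :
    MDifferentiableAt 𝓘(ℝ, EN × EF) 𝓘(ℝ, EP) (prodChart EN EF e u₀ y₀) o :=
  ((contMDiffOn_prodChart S he).contMDiffAt (isOpen_prodDomain.mem_nhds ho)).mdifferentiableAt
    (by simp)

theorem mdifferentiableAt_prodChartInv (he : e ∈ S.atlas) (ho : o ∈ prodDomain EN EF e u₀ y₀) :
    MDifferentiableAt 𝓘(ℝ, EP) 𝓘(ℝ, EN × EF) (prodChartInv EN EF e u₀ y₀)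
      (prodChart EN EF e u₀ y₀ o) := by
  refine ((contMDiffOn_prodChartInv S he).contMDiffAt
    ((isOpen_prodSource S).mem_nhds ?_)).mdifferentiableAt (by simp)
  refine ⟨prodChart_mem_tube ho, ?_⟩
  rw [mem_preimage, snd_prodChart ho]
  exact (extChartAt 𝓘(ℝ, EF) y₀).map_target ho.2

theorem dChartInv_dChart (he : e ∈ S.atlas) (ho : o ∈ prodDomain EN EF e u₀ y₀) (v : EN × EF) :
    dChartInv EN EF EP e u₀ y₀ o (dChart EN EF EP e u₀ y₀ o v) = v := by
  have h := mfderiv_comp o (mdifferentiableAt_prodChartInv S he ho)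
    (mdifferentiableAt_prodChart S he ho)
  have h' : prodChartInv EN EF e u₀ y₀ ∘ prodChart EN EF e u₀ y₀ =ᶠ[𝓝 o] id := by
    filter_upwards [isOpen_prodDomain.mem_nhds ho] with o ho
    exact prodChartInv_prodChart ho
  rw [h'.mfderiv_eq, mfderiv_id] at h
  exact (congrArg (fun L => L v) h).symm

theorem dChart_dChartInv (he : e ∈ S.atlas) (ho : o ∈ prodDomain EN EF e u₀ y₀) (ξ : EP) :
    dChart EN EF EP e u₀ y₀ o (dChartInv EN EF EP e u₀ y₀ o ξ) = ξ := by
  have h := mfderiv_comp (I' := 𝓘(ℝ, EN × EF)) (prodChart EN EF e u₀ y₀ o)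
    (g := prodChart EN EF e u₀ y₀) (I'' := 𝓘(ℝ, EP))
    (by rw [prodChartInv_prodChart ho]; exact mdifferentiableAt_prodChart S he ho)
    (mdifferentiableAt_prodChartInv S he ho)
  have h' : prodChart EN EF e u₀ y₀ ∘ prodChartInv EN EF e u₀ y₀
      =ᶠ[𝓝 (prodChart EN EF e u₀ y₀ o)] id := by
    have hm : prodChart EN EF e u₀ y₀ o ∈
        tube EN e u₀ ∩ (fun x => (e x).2) ⁻¹' (extChartAt 𝓘(ℝ, EF) y₀).source := by
      refine ⟨prodChart_mem_tube ho, ?_⟩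
      rw [mem_preimage, snd_prodChart ho]
      exact (extChartAt 𝓘(ℝ, EF) y₀).map_target ho.2
    filter_upwards [(isOpen_prodSource S).mem_nhds hm] with x hx
    exact prodChart_prodChartInv hx.1 hx.2
  rw [h'.mfderiv_eq, mfderiv_id] at h
  have h2 := congrArg (fun L => L ξ) h
  -- The chain rule leaves the derivative at `prodChartInv (prodChart o)`. Generalizing that point
  -- allows it to be replaced by `o`.
  have h3 : ∀ o' : EN × EF, o' = o →
      mfderiv 𝓘(ℝ, EN × EF) 𝓘(ℝ, EP) (prodChart EN EF e u₀ y₀) o'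
        (dChartInv EN EF EP e u₀ y₀ o ξ) = dChart EN EF EP e u₀ y₀ o
          (dChartInv EN EF EP e u₀ y₀ o ξ) := by
    rintro _ rfl; rfl
  exact (h3 _ (prodChartInv_prodChart ho)).symm.trans h2.symm

theorem dProj_dChart (he : e ∈ S.atlas) (ho : o ∈ prodDomain EN EF e u₀ y₀) (v : EN × EF) :
    dProj EN EP p (prodChart EN EF e u₀ y₀ o) (dChart EN EF EP e u₀ y₀ o v)
      = dBase EN u₀ o.1 v.1 := by
  have h := mfderiv_comp o ((S.contMDiff_proj _).mdifferentiableAt (by simp))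
    (mdifferentiableAt_prodChart S he ho)
  have h' : p ∘ prodChart EN EF e u₀ y₀ =ᶠ[𝓝 o]
      (extChartAt 𝓘(ℝ, EN) u₀).symm ∘ (Prod.fst : EN × EF → EN) := by
    filter_upwards [isOpen_prodDomain.mem_nhds ho] with o ho
    exact proj_prodChart ho
  have hfst : MDifferentiableAt 𝓘(ℝ, EN × EF) 𝓘(ℝ, EN) (Prod.fst : EN × EF → EN) o :=
    differentiableAt_fst.mdifferentiableAt
  have h2 := mfderiv_comp o (mdifferentiableAt_extChartAt_symm ho.1.1) hfst
  rw [h'.mfderiv_eq, h2] at h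
  have h3 := congrArg (fun L => L v) h
  refine Eq.trans h3.symm ?_
  change dBase EN u₀ o.1 (mfderiv 𝓘(ℝ, EN × EF) 𝓘(ℝ, EN) (Prod.fst : EN × EF → EN) o v) = _
  rw [mfderiv_eq_fderiv, fderiv_fst]
  rfl

theorem dBase_bijective {t : EN} (ht : t ∈ (extChartAt 𝓘(ℝ, EN) u₀).target) :
    Function.Bijective (dBase EN u₀ t) := by
  have h := (isInvertible_mfderivWithin_extChartAt_symm ht)
  rw [show range 𝓘(ℝ, EN) = univ by simp, mfderivWithin_univ] at h
  exact h.bijective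

theorem dProj_dChart_eq_zero_iff (he : e ∈ S.atlas) (ho : o ∈ prodDomain EN EF e u₀ y₀)
    (v : EN × EF) :
    dProj EN EP p (prodChart EN EF e u₀ y₀ o) (dChart EN EF EP e u₀ y₀ o v) = 0 ↔ v.1 = 0 := by
  rw [dProj_dChart S he ho, map_eq_zero_iff _ (dBase_bijective ho.1.1).1]

/-- In product coordinates the tangent spaces of the fibers are the second factor, so conditions on
vertical vectors become conditions on `fiberPart`. -/
theorem mem_vertical_iff (he : e ∈ S.atlas) (ho : o ∈ prodDomain EN EF e u₀ y₀) (ξ : EP) :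
    ξ ∈ vertical EN EP p (prodChart EN EF e u₀ y₀ o)
      ↔ ∃ w : EF, ξ = dChart EN EF EP e u₀ y₀ o (0, w) := by
  constructor
  · intro h
    have h0 : (dChartInv EN EF EP e u₀ y₀ o ξ).1 = 0 := by
      rw [← dProj_dChart_eq_zero_iff S he ho, dChart_dChartInv S he ho]
      exact h
    refine ⟨(dChartInv EN EF EP e u₀ y₀ o ξ).2, ?_⟩
    rw [← h0]
    exact (dChart_dChartInv S he ho ξ).symm
  · rintro ⟨w, rfl⟩
    exact (dProj_dChart_eq_zero_iff S he ho _).2 rfl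

theorem nondeg_along_prodChart (he : e ∈ S.atlas) {Ω : Form EP P 2}
    (hnd : FiberwiseNondegenerate EN p Ω) (ho : o ∈ prodDomain EN EF e u₀ y₀) :
    Nondeg (fiberPart (Ω.along (prodChart EN EF e u₀ y₀) o)) := by
  intro v hv
  have h := hnd (prodChart EN EF e u₀ y₀ o) (dChart EN EF EP e u₀ y₀ o (0, v))
    ((mem_vertical_iff S he ho _).2 ⟨v, rfl⟩) (fun w hw => by
      obtain ⟨b, rfl⟩ := (mem_vertical_iff S he ho w).1 hw
      have := hv b
      rwa [fiberPart_two_apply, along_prodChart_two] at this)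
  have h2 := dChartInv_dChart S he ho (0, v)
  rw [show dChart EN EF EP e u₀ y₀ o (0, v) = 0 from h, map_zero] at h2
  exact (congrArg Prod.snd h2).symm

theorem contMDiffOn_of_prodChart (he : e ∈ S.atlas) {f : P → ℝ}
    (hf : ∀ y₀, ContDiffOn ℝ ∞ (f ∘ prodChart EN EF e u₀ y₀) (prodDomain EN EF e u₀ y₀)) :
    ContMDiffOn 𝓘(ℝ, EP) 𝓘(ℝ, ℝ) ∞ f (tube EN e u₀) := by
  intro x hx
  apply ContMDiffAt.contMDiffWithinAt
  have hm := (isOpen_prodSource (y₀ := (e x).2) S).mem_nhds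
    (show x ∈ tube EN e u₀ ∩ _ from ⟨hx, mem_extChartAt_source (I := 𝓘(ℝ, EF)) (e x).2⟩)
  have h1 : ContMDiffAt 𝓘(ℝ, EP) 𝓘(ℝ, EN × EF) ∞ (prodChartInv EN EF e u₀ (e x).2) x :=
    (contMDiffOn_prodChartInv S he).contMDiffAt hm
  have h2 : ContMDiffAt 𝓘(ℝ, EN × EF) 𝓘(ℝ, ℝ) ∞ (f ∘ prodChart EN EF e u₀ (e x).2)
      (prodChartInv EN EF e u₀ (e x).2 x) :=
    ((hf _).contDiffAt (isOpen_prodDomain.mem_nhds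
      (prodChartInv_mem hx (mem_extChartAt_source _)))).contMDiffAt
  refine (h2.comp x h1).congr_of_eventuallyEq ?_
  filter_upwards [hm] with x' hx'
  exact (congrArg f (prodChart_prodChartInv hx'.1 hx'.2)).symm

theorem contDiffOn_comp_prodChart (he : e ∈ S.atlas) {f : P → ℝ}
    (hf : ContMDiffOn 𝓘(ℝ, EP) 𝓘(ℝ, ℝ) ∞ f (tube EN e u₀)) :
    ContDiffOn ℝ ∞ (f ∘ prodChart EN EF e u₀ y₀) (prodDomain EN EF e u₀ y₀) :=
  (hf.comp (contMDiffOn_prodChart S he) fun _ ho => prodChart_mem_tube ho).contDiffOn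

variable (EP) in
/-- The derivative of a function on the total space in the direction of a vector field. -/
def dirDeriv (f : P → ℝ) (X : P → EP) (x : P) : ℝ :=
  (mfderiv 𝓘(ℝ, EP) 𝓘(ℝ, ℝ) f x : EP →L[ℝ] ℝ) (X x)

theorem dirDeriv_prodChart (he : e ∈ S.atlas) {f : P → ℝ}
    (hf : ContMDiffOn 𝓘(ℝ, EP) 𝓘(ℝ, ℝ) ∞ f (tube EN e u₀)) (X : P → EP)
    (ho : o ∈ prodDomain EN EF e u₀ y₀) :
    dirDeriv EP f X (prodChart EN EF e u₀ y₀ o)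
      = fderiv ℝ (f ∘ prodChart EN EF e u₀ y₀) o
        (dChartInv EN EF EP e u₀ y₀ o (X (prodChart EN EF e u₀ y₀ o))) := by
  have h := mfderiv_comp o
    ((hf.contMDiffAt ((isOpen_tube S).mem_nhds (prodChart_mem_tube ho))).mdifferentiableAt (by simp))
    (mdifferentiableAt_prodChart S he ho)
  rw [← mfderiv_eq_fderiv, h]
  change _ = (mfderiv 𝓘(ℝ, EP) 𝓘(ℝ, ℝ) f (prodChart EN EF e u₀ y₀ o) : EP →L[ℝ] ℝ)
    (dChart EN EF EP e u₀ y₀ o _)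
  rw [dChart_dChartInv S he ho]
  rfl

variable [FiniteDimensional ℝ EN] [FiniteDimensional ℝ EF] [IsManifold 𝓘(ℝ, EP) ∞ P]

theorem contDiffOn_along_prodChart (he : e ∈ S.atlas) {k : ℕ} {α : Form EP P k}
    (hα : α.IsSmooth) :
    ContDiffOn ℝ ∞ (α.along (prodChart EN EF e u₀ y₀)) (prodDomain EN EF e u₀ y₀) :=
  hα.along_contDiffOn isOpen_prodDomain (contMDiffOn_prodChart S he)

theorem extDeriv_along_prodChart (he : e ∈ S.atlas) {k : ℕ} {α : Form EP P k}
    (hα : α.IsSmooth) (ho : o ∈ prodDomain EN EF e u₀ y₀) :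
    extDeriv (α.along (prodChart EN EF e u₀ y₀)) o = α.d.along (prodChart EN EF e u₀ y₀) o :=
  hα.extDeriv_along isOpen_prodDomain (contMDiffOn_prodChart S he) ho

theorem extDeriv_along_prodChart_of_closed (he : e ∈ S.atlas) {k : ℕ} {α : Form EP P k}
    (hα : α ∈ closedForms EP P k) (ho : o ∈ prodDomain EN EF e u₀ y₀) :
    extDeriv (α.along (prodChart EN EF e u₀ y₀)) o = 0 := by
  rw [extDeriv_along_prodChart S he hα.1 ho, hα.2]
  ext v
  rfl

end ProductCharts

/-! ### Integration over a fiber against the Liouville density -/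

section FiberIntegral

open MeasureTheory

theorem continuous_liouville {Z : Type*} [NormedAddCommGroup Z] [NormedSpace ℝ Z]
    [FiniteDimensional ℝ Z] : Continuous (liouville : (Z [⋀^Fin 2]→L[ℝ] ℝ) → ℝ) := by
  have h : Continuous fun η : Z [⋀^Fin 2]→L[ℝ] ℝ => (gram η).det :=
    (contDiff_det _ 0).continuous.comp
      (contDiff_iff_contDiffAt.2 fun _ => contDiffAt_gram (r := 0) contDiffAt_id).continuous
  exact (h.abs).sqrt

variable {EN : Type*} [NormedAddCommGroup EN] [NormedSpace ℝ EN]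
  {EF : Type*} [NormedAddCommGroup EF] [NormedSpace ℝ EF] [FiniteDimensional ℝ EF]
  {EP : Type*} [NormedAddCommGroup EP] [NormedSpace ℝ EP]
  {N : Type*} [TopologicalSpace N] [ChartedSpace EN N]
  {F : Type*} [TopologicalSpace F] [ChartedSpace EF F]
  {P : Type*} [TopologicalSpace P] [ChartedSpace EP P]
  {p : P → N} [MeasurableSpace EF] (μ : Measure EF)

/-- The integral of a function over the part of the fiber over `u` in the domain of a chart of the
typical fiber, with respect to the Liouville density of a `2`-form. -/
def chartIntegral (Ω : Form EP P 2) (e : Bundle.Trivialization F p) (u : N) (y₀ : F)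
    (f : P → ℝ) : ℝ :=
  ∫ z in (extChartAt 𝓘(ℝ, EF) y₀).target,
    f (fiberChart EF e u y₀ z) * liouville (Ω.along (fiberChart EF e u y₀) z) ∂μ

variable {σ : Form EF F 2} (S : SymplecticFibration EN EP p σ) (Ω : Form EP P 2)
  {e e' : Bundle.Trivialization F p} {u : N} {y₀ y₁ : F}

theorem apply_fiberChart_mem (hu : u ∈ e.baseSet) {z : EF}
    (hz : z ∈ (extChartAt 𝓘(ℝ, EF) y₀).target) :
    (e (fiberChart EF e u y₀ z)).2 ∈ (extChartAt 𝓘(ℝ, EF) y₀).source := by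
  rw [snd_fiberChart hu]
  exact (extChartAt 𝓘(ℝ, EF) y₀).map_target hz

theorem fiberChart_extChartAt {x : P} (hx : p x ∈ e.baseSet)
    (hy : (e x).2 ∈ (extChartAt 𝓘(ℝ, EF) y₀).source) :
    fiberChart EF e (p x) y₀ (extChartAt 𝓘(ℝ, EF) y₀ (e x).2) = x := by
  rw [fiberChart, (extChartAt 𝓘(ℝ, EF) y₀).left_inv hy, fiberEmbedding_apply hx]

theorem extChartAt_fiberChart (hu : u ∈ e.baseSet) {z : EF}
    (hz : z ∈ (extChartAt 𝓘(ℝ, EF) y₀).target) :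
    extChartAt 𝓘(ℝ, EF) y₀ (e (fiberChart EF e u y₀ z)).2 = z := by
  rw [snd_fiberChart hu, (extChartAt 𝓘(ℝ, EF) y₀).right_inv hz]

theorem chartIntegral_congr (hu : u ∈ e.baseSet) {f g : P → ℝ} (h : ∀ x, p x = u → f x = g x) :
    chartIntegral μ Ω e u y₀ f = chartIntegral μ Ω e u y₀ g := by
  refine integral_congr_ae (Filter.Eventually.of_forall fun z => ?_)
  change f _ * _ = g _ * _
  rw [h _ (proj_fiberChart hu z)]

variable [BorelSpace EF] [μ.IsAddHaarMeasure] [IsManifold 𝓘(ℝ, EF) ∞ F] [IsManifold 𝓘(ℝ, EP) ∞ P]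
  [IsManifold 𝓘(ℝ, EN) ∞ N]

/-- `fiberChart` is the restriction of `prodChart` to a slice. Integrals over single fibers are
thereby parameter integrals in product coordinates. -/
theorem along_fiberChart {u₀ : N} {o : EN × EF} (he : e ∈ S.atlas)
    (ho : o ∈ prodDomain EN EF e u₀ y₀) :
    Ω.along (fiberChart EF e ((extChartAt 𝓘(ℝ, EN) u₀).symm o.1) y₀) o.2
      = fiberPart (Ω.along (prodChart EN EF e u₀ y₀) o) := by
  have h1 : HasFDerivAt (fun z : EF => (o.1, z)) (ContinuousLinearMap.inr ℝ EN EF) o.2 :=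
    hasFDerivAt_prodMk_right o.1 o.2
  have h2 := Form.pullback_comp_apply (E := EF) (E' := EN × EF) (f := fun z : EF => (o.1, z))
    (x := o.2) (g := prodChart EN EF e u₀ y₀) Ω (mdifferentiableAt_prodChart S he ho)
    h1.differentiableAt.mdifferentiableAt
  refine h2.trans ?_
  have h3 := Form.pullback_vec (Ω.along (prodChart EN EF e u₀ y₀)) (fun z : EF => (o.1, z)) o.2
  rw [h1.fderiv] at h3
  exact h3

/-- Integrals over a part of a fiber contained in the domains of two charts agree. -/
theorem chartIntegral_change (he : e ∈ S.atlas) (he' : e' ∈ S.atlas)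
    (hu : u ∈ e.baseSet)
    (hu' : u ∈ e'.baseSet) {f : P → ℝ}
    (hf : ∀ x, p x = u → (e x).2 ∉ (extChartAt 𝓘(ℝ, EF) y₀).source → f x = 0)
    (hf' : ∀ x, p x = u → (e' x).2 ∉ (extChartAt 𝓘(ℝ, EF) y₁).source → f x = 0) :
    chartIntegral μ Ω e u y₀ f = chartIntegral μ Ω e' u y₁ f := by
  set ψ := extChartAt 𝓘(ℝ, EF) y₀ with hψ
  set ψ' := extChartAt 𝓘(ℝ, EF) y₁ with hψ'
  let Θ := fiberChart EF e u y₀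
  let Θ' := fiberChart EF e' u y₁
  have hΘc : ContMDiffOn 𝓘(ℝ, EF) 𝓘(ℝ, EP) ∞ Θ ψ.target := contMDiffOn_fiberChart S he hu
  have hΘc' : ContMDiffOn 𝓘(ℝ, EF) 𝓘(ℝ, EP) ∞ Θ' ψ'.target := contMDiffOn_fiberChart S he' hu'
  have hpΘ : ∀ z, p (Θ z) = u := proj_fiberChart hu
  have hpΘ' : ∀ z, p (Θ' z) = u := proj_fiberChart hu'
  let s := ψ.target ∩ (fun z => (e' (Θ z)).2) ⁻¹' ψ'.source
  let s' := ψ'.target ∩ (fun z => (e (Θ' z)).2) ⁻¹' ψ.source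
  have hsnd : ContMDiffOn 𝓘(ℝ, EF) 𝓘(ℝ, EF) ∞ (fun z => (e' (Θ z)).2) ψ.target :=
    contMDiff_snd.comp_contMDiffOn ((S.contMDiffOn e' he').comp hΘc fun z _ =>
      e'.mem_source.2 (by rw [hpΘ]; exact hu'))
  have hsnd' : ContMDiffOn 𝓘(ℝ, EF) 𝓘(ℝ, EF) ∞ (fun z => (e (Θ' z)).2) ψ'.target :=
    contMDiff_snd.comp_contMDiffOn ((S.contMDiffOn e he).comp hΘc' fun z _ =>
      e.mem_source.2 (by rw [hpΘ']; exact hu))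
  have hs : IsOpen s := hsnd.continuousOn.isOpen_inter_preimage (isOpen_extChartAt_target y₀)
    (isOpen_extChartAt_source y₁)
  have hs' : IsOpen s' := hsnd'.continuousOn.isOpen_inter_preimage (isOpen_extChartAt_target y₁)
    (isOpen_extChartAt_source y₀)
  -- The transition map between the two fiber charts. From `Θ' ∘ T = Θ` on the overlap `s`,
  -- `liouville_comp` supplies exactly the Jacobian factor of the change of variables; off the
  -- overlap `f` vanishes.
  let T : EF → EF := fun z => ψ' (e' (Θ z)).2
  have hT : ContMDiffOn 𝓘(ℝ, EF) 𝓘(ℝ, EF) ∞ T s :=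
    (contMDiffOn_extChartAt (x := y₁)).comp (hsnd.mono inter_subset_left)
      fun z hz => by
        rw [← extChartAt_source 𝓘(ℝ, EF)]
        exact hz.2
  have hTd : ∀ z ∈ s, ContDiffAt ℝ ∞ T z := fun z hz =>
    (hT.contMDiffAt (hs.mem_nhds hz)).contDiffAt
  have hΘT : ∀ z ∈ s, Θ' (T z) = Θ z := by
    intro z hz
    have := fiberChart_extChartAt (EF := EF) (e := e') (x := Θ z) (y₀ := y₁)
      (by rw [hpΘ]; exact hu') hz.2
    rwa [hpΘ] at this
  have hTs : T '' s = s' := by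
    apply Subset.antisymm
    · rintro _ ⟨z, hz, rfl⟩
      refine ⟨ψ'.map_source hz.2, ?_⟩
      rw [mem_preimage, hΘT z hz]
      exact apply_fiberChart_mem hu hz.1
    · intro z' hz'
      have h1 : Θ (ψ (e (Θ' z')).2) = Θ' z' := by
        have := fiberChart_extChartAt (EF := EF) (e := e) (x := Θ' z') (y₀ := y₀)
          (by rw [hpΘ']; exact hu) hz'.2
        rwa [hpΘ'] at this
      refine ⟨ψ (e (Θ' z')).2, ⟨ψ.map_source hz'.2, ?_⟩, ?_⟩
      · rw [mem_preimage, h1]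
        exact apply_fiberChart_mem hu' hz'.1
      · change ψ' (e' (Θ (ψ (e (Θ' z')).2))).2 = z'
        rw [h1]
        exact extChartAt_fiberChart hu' hz'.1
  have hTinj : InjOn T s := by
    intro z₁ h₁ z₂ h₂ h
    have : Θ z₁ = Θ z₂ := by rw [← hΘT z₁ h₁, ← hΘT z₂ h₂, h]
    rw [← extChartAt_fiberChart hu h₁.1, ← extChartAt_fiberChart hu h₂.1]
    exact congrArg (fun x => ψ (e x).2) this
  have hL : ∀ z ∈ s, liouville (Ω.along Θ z)
      = |(fderiv ℝ T z).det| * liouville (Ω.along Θ' (T z)) := by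
    intro z hz
    rw [← liouville_comp]
    congr 1
    rw [← Form.pullback_vec (Ω.along Θ') T z]
    have h1 : MDifferentiableAt 𝓘(ℝ, EF) 𝓘(ℝ, EP) Θ' (T z) :=
      (hΘc'.contMDiffAt ((isOpen_extChartAt_target y₁).mem_nhds
        (ψ'.map_source hz.2))).mdifferentiableAt (by simp)
    have h2 := Form.pullback_comp_apply (E := EF) (E' := EF) Ω h1
      ((hT.contMDiffAt (hs.mem_nhds hz)).mdifferentiableAt (by simp))
    refine Eq.trans (Form.pullback_congr Ω ?_) h2
    filter_upwards [hs.mem_nhds hz] with z hz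
    exact (hΘT z hz).symm
  have e1 : chartIntegral μ Ω e u y₀ f = ∫ z in s, f (Θ z) * liouville (Ω.along Θ z) ∂μ := by
    refine setIntegral_eq_of_subset_of_forall_sdiff_eq_zero
      (isOpen_extChartAt_target y₀).measurableSet inter_subset_left fun z hz => ?_
    change f (Θ z) * _ = 0
    rw [hf' _ (hpΘ z) fun h => hz.2 ⟨hz.1, h⟩, zero_mul]
  have e2 : chartIntegral μ Ω e' u y₁ f = ∫ z in s', f (Θ' z) * liouville (Ω.along Θ' z) ∂μ := by
    refine setIntegral_eq_of_subset_of_forall_sdiff_eq_zero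
      (isOpen_extChartAt_target y₁).measurableSet inter_subset_left fun z hz => ?_
    change f (Θ' z) * _ = 0
    rw [hf _ (hpΘ' z) fun h => hz.2 ⟨hz.1, h⟩, zero_mul]
  rw [e1, e2, ← hTs, integral_image_eq_integral_abs_det_fderiv_smul μ hs.measurableSet
    (fun z hz => ((hTd z hz).differentiableAt (by simp)).hasFDerivAt.hasFDerivWithinAt) hTinj]
  refine setIntegral_congr_fun hs.measurableSet fun z hz => ?_
  simp only [smul_eq_mul]
  rw [hL z hz, hΘT z hz]
  ring

variable {Ω}

theorem continuousOn_chartIntegrand (hΩ : Ω.IsSmooth) (he : e ∈ S.atlas) (hu : u ∈ e.baseSet)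
    {f : P → ℝ} (hf : ContinuousOn f (p ⁻¹' {u})) :
    ContinuousOn (fun z => f (fiberChart EF e u y₀ z)
      * liouville (Ω.along (fiberChart EF e u y₀) z)) (extChartAt 𝓘(ℝ, EF) y₀).target := by
  have h := contMDiffOn_fiberChart (y₀ := y₀) S he hu
  refine ContinuousOn.mul (hf.comp h.continuousOn fun z _ => proj_fiberChart hu z) ?_
  exact continuous_liouville.comp_continuousOn
    (hΩ.along_contDiffOn (isOpen_extChartAt_target y₀) h).continuousOn

theorem integrableOn_chartIntegrand (hΩ : Ω.IsSmooth) (he : e ∈ S.atlas) (hu : u ∈ e.baseSet)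
    {f : P → ℝ} (hf : ContinuousOn f (p ⁻¹' {u})) {K : Set F} (hK : IsCompact K)
    (hKy : K ⊆ (extChartAt 𝓘(ℝ, EF) y₀).source)
    (hfK : ∀ x, p x = u → (e x).2 ∉ K → f x = 0) :
    IntegrableOn (fun z => f (fiberChart EF e u y₀ z)
      * liouville (Ω.along (fiberChart EF e u y₀) z)) (extChartAt 𝓘(ℝ, EF) y₀).target μ := by
  refine integrableOn_of_compact μ (isOpen_extChartAt_target y₀).measurableSet
    (K := extChartAt 𝓘(ℝ, EF) y₀ '' K)
    (hK.image_of_continuousOn ((continuousOn_extChartAt y₀).mono hKy)) ?_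
    (continuousOn_chartIntegrand S hΩ he hu hf) ?_
  · rintro _ ⟨y, hy, rfl⟩
    exact (extChartAt 𝓘(ℝ, EF) y₀).map_source (hKy hy)
  · intro z hz hzK
    rw [hfK _ (proj_fiberChart hu z), zero_mul]
    rw [snd_fiberChart hu]
    exact fun h => hzK ⟨_, h, (extChartAt 𝓘(ℝ, EF) y₀).right_inv hz⟩

theorem chartIntegral_sum (hΩ : Ω.IsSmooth) (he : e ∈ S.atlas) (hu : u ∈ e.baseSet)
    {ι : Type*} (t : Finset ι) {f : ι → P → ℝ} (hf : ∀ i ∈ t, ContinuousOn (f i) (p ⁻¹' {u}))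
    {K : Set F} (hK : IsCompact K) (hKy : K ⊆ (extChartAt 𝓘(ℝ, EF) y₀).source)
    (hfK : ∀ i ∈ t, ∀ x, p x = u → (e x).2 ∉ K → f i x = 0) :
    chartIntegral μ Ω e u y₀ (fun x => ∑ i ∈ t, f i x)
      = ∑ i ∈ t, chartIntegral μ Ω e u y₀ (f i) := by
  simp only [chartIntegral, Finset.sum_mul]
  exact integral_finsetSum _ fun i hi =>
    integrableOn_chartIntegrand μ S hΩ he hu (hf i hi) hK hKy (hfK i hi)

theorem chartIntegral_const_mul (c : ℝ) (f : P → ℝ) :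
    chartIntegral μ Ω e u y₀ (fun x => c * f x) = c * chartIntegral μ Ω e u y₀ f := by
  simp only [chartIntegral, mul_assoc]
  exact integral_const_mul _ _

section Partition

variable [CompactSpace F] (ρ : SmoothPartitionOfUnity F 𝓘(ℝ, EF) F univ)

/-- The finite set of indices of the nonzero functions of a partition of unity on a compact
manifold. -/
def partIndex : Finset F :=
  ρ.locallyFinite.finite_nonempty_of_compact.toFinset

theorem apply_eq_zero_of_notMem_partIndex {i : F} (hi : i ∉ partIndex ρ) (y : F) : ρ i y = 0 := by
  by_contra h
  exact hi ((Set.Finite.mem_toFinset _).2 ⟨y, h⟩)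

theorem sum_partIndex (y : F) : ∑ i ∈ partIndex ρ, ρ i y = 1 := by
  rw [← ρ.sum_eq_one (mem_univ y)]
  refine (finsum_eq_sum_of_support_subset _ fun i hi => ?_).symm
  by_contra h
  exact hi (apply_eq_zero_of_notMem_partIndex ρ h y)

variable (Ω e u) in
/-- The integral of a function over the fiber over `u`, with respect to the Liouville density of
a `2`-form. -/
def fiberIntegral (f : P → ℝ) : ℝ :=
  ∑ i ∈ partIndex ρ, chartIntegral μ Ω e u i (fun x => ρ i (e x).2 * f x)

variable {ρ}

theorem fiberIntegral_congr (hu : u ∈ e.baseSet) {f g : P → ℝ} (h : ∀ x, p x = u → f x = g x) :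
    fiberIntegral μ Ω e u ρ f = fiberIntegral μ Ω e u ρ g :=
  Finset.sum_congr rfl fun i _ => chartIntegral_congr μ Ω hu fun x hx => by rw [h x hx]

theorem continuousOn_snd (hu : u ∈ e.baseSet) : ContinuousOn (fun x => (e x).2) (p ⁻¹' {u}) :=
  continuous_snd.comp_continuousOn (e.toOpenPartialHomeomorph.continuousOn.mono
    fun x (hx : p x = u) => e.mem_source.2 (by rw [hx]; exact hu))

theorem continuousOn_partition_mul (hu : u ∈ e.baseSet) {f : P → ℝ}
    (hf : ContinuousOn f (p ⁻¹' {u})) (i : F) :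
    ContinuousOn (fun x => ρ i (e x).2 * f x) (p ⁻¹' {u}) :=
  ((ρ i).contMDiff.continuous.comp_continuousOn (continuousOn_snd hu)).mul hf

theorem partition_mul_eq_zero (i : F) {f : P → ℝ} {x : P} (hx : (e x).2 ∉ tsupport (ρ i)) :
    ρ i (e x).2 * f x = 0 := by
  rw [image_eq_zero_of_notMem_tsupport hx, zero_mul]


theorem tsupport_subset_source (hρ : ρ.IsSubordinate fun y => (chartAt EF y).source)
    (i : F) : tsupport (ρ i) ⊆ (extChartAt 𝓘(ℝ, EF) i).source := by
  rw [extChartAt_source]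
  exact hρ i

theorem fiberIntegral_sum (hρ : ρ.IsSubordinate fun y => (chartAt EF y).source)
    (hΩ : Ω.IsSmooth) (he : e ∈ S.atlas) (hu : u ∈ e.baseSet)
    {ι : Type*} (t : Finset ι) {f : ι → P → ℝ} (hf : ∀ i ∈ t, ContinuousOn (f i) (p ⁻¹' {u})) :
    fiberIntegral μ Ω e u ρ (fun x => ∑ i ∈ t, f i x)
      = ∑ i ∈ t, fiberIntegral μ Ω e u ρ (f i) := by
  simp only [fiberIntegral]
  rw [Finset.sum_comm]
  refine Finset.sum_congr rfl fun j _ => ?_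
  rw [← chartIntegral_sum μ S hΩ he hu t
    (fun i hi => continuousOn_partition_mul hu (hf i hi) j)
    (isClosed_tsupport (ρ j)).isCompact (tsupport_subset_source hρ j)
    (fun i _ x _ hx => partition_mul_eq_zero j hx)]
  exact chartIntegral_congr μ Ω hu fun x _ => Finset.mul_sum _ _ _

theorem fiberIntegral_const_mul (c : ℝ) (f : P → ℝ) :
    fiberIntegral μ Ω e u ρ (fun x => c * f x) = c * fiberIntegral μ Ω e u ρ f := by
  simp only [fiberIntegral, Finset.mul_sum]
  refine Finset.sum_congr rfl fun j _ => ?_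
  rw [← chartIntegral_const_mul]
  congr 1
  funext x
  ring

theorem fiberIntegral_add (hρ : ρ.IsSubordinate fun y => (chartAt EF y).source)
    (hΩ : Ω.IsSmooth) (he : e ∈ S.atlas) (hu : u ∈ e.baseSet)
    {f g : P → ℝ} (hf : ContinuousOn f (p ⁻¹' {u})) (hg : ContinuousOn g (p ⁻¹' {u})) :
    fiberIntegral μ Ω e u ρ (fun x => f x + g x)
      = fiberIntegral μ Ω e u ρ f + fiberIntegral μ Ω e u ρ g := by
  have h := fiberIntegral_sum μ S hρ hΩ he hu (Finset.univ : Finset (Fin 2)) (f := ![f, g])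
    (fun i _ => by fin_cases i <;> assumption)
  simpa [Fin.sum_univ_two] using h

/-- A function supported in the domain of a single chart is integrated in this chart. -/
theorem chartIntegral_eq_fiberIntegral (hρ : ρ.IsSubordinate fun y => (chartAt EF y).source)
    (hΩ : Ω.IsSmooth) (he : e ∈ S.atlas) (he' : e' ∈ S.atlas)
    (hu : u ∈ e.baseSet) (hu' : u ∈ e'.baseSet) {f : P → ℝ} (hf : ContinuousOn f (p ⁻¹' {u}))
    {K : Set F} (hK : IsCompact K) (hKy : K ⊆ (extChartAt 𝓘(ℝ, EF) y₀).source)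
    (hfK : ∀ x, p x = u → (e' x).2 ∉ K → f x = 0) :
    chartIntegral μ Ω e' u y₀ f = fiberIntegral μ Ω e u ρ f := by
  -- The functions `ρ i` of the other trivialization sum to `1`. Each resulting piece is supported
  -- in two charts at once, so it can be moved from one to the other.
  have h1 : chartIntegral μ Ω e' u y₀ f
      = chartIntegral μ Ω e' u y₀ (fun x => ∑ i ∈ partIndex ρ, ρ i (e x).2 * f x) :=
    chartIntegral_congr μ Ω hu' fun x _ => by
      rw [← Finset.sum_mul, sum_partIndex, one_mul]
  rw [h1, chartIntegral_sum μ S hΩ he' hu' _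
    (fun i _ => continuousOn_partition_mul hu hf i) hK hKy
    (fun i _ x hx hxK => by rw [hfK x hx hxK, mul_zero])]
  refine Finset.sum_congr rfl fun i _ => ?_
  refine chartIntegral_change μ S Ω he' he hu' hu ?_ ?_
  · intro x hx hy
    rw [hfK x hx fun h => hy (hKy h), mul_zero]
  · intro x _ hy
    exact partition_mul_eq_zero i fun h => hy (tsupport_subset_source hρ i h)

theorem chartIntegral_partition (hρ : ρ.IsSubordinate fun y => (chartAt EF y).source)
    (hΩ : Ω.IsSmooth) (he : e ∈ S.atlas) (he' : e' ∈ S.atlas)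
    (hu : u ∈ e.baseSet) (hu' : u ∈ e'.baseSet) {f : P → ℝ} (hf : ContinuousOn f (p ⁻¹' {u}))
    (i : F) :
    chartIntegral μ Ω e' u i (fun x => ρ i (e' x).2 * f x)
      = fiberIntegral μ Ω e u ρ (fun x => ρ i (e' x).2 * f x) :=
  chartIntegral_eq_fiberIntegral μ S hρ hΩ he he' hu hu' (continuousOn_partition_mul hu' hf i)
    (isClosed_tsupport (ρ i)).isCompact (tsupport_subset_source hρ i)
    (fun _ _ hx => partition_mul_eq_zero i hx)

/-- The integral over a fiber does not depend on the trivialization. -/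
theorem fiberIntegral_change (hρ : ρ.IsSubordinate fun y => (chartAt EF y).source)
    (hΩ : Ω.IsSmooth) (he : e ∈ S.atlas) (he' : e' ∈ S.atlas)
    (hu : u ∈ e.baseSet) (hu' : u ∈ e'.baseSet) {f : P → ℝ} (hf : ContinuousOn f (p ⁻¹' {u})) :
    fiberIntegral μ Ω e' u ρ f = fiberIntegral μ Ω e u ρ f := by
  -- Each piece cut off by `ρ i` in `e'` is an integral over the whole fiber computed with `e`; by
  -- additivity the cutoffs then sum to `1`.
  rw [fiberIntegral, Finset.sum_congr rfl fun i _ =>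
    chartIntegral_partition μ S hρ hΩ he he' hu hu' hf i,
    ← fiberIntegral_sum μ S hρ hΩ he hu _ fun i _ => continuousOn_partition_mul hu' hf i]
  refine fiberIntegral_congr μ hu fun x _ => ?_
  rw [← Finset.sum_mul, sum_partIndex, one_mul]

/-- The Liouville volume of a fiber is positive. -/
theorem fiberIntegral_one_pos [Nonempty F] (hρ : ρ.IsSubordinate fun y => (chartAt EF y).source)
    (hΩ : Ω.IsSmooth) (hnd : FiberwiseNondegenerate EN p Ω) (he : e ∈ S.atlas)
    (hu : u ∈ e.baseSet) : 0 < fiberIntegral μ Ω e u ρ (fun _ => 1) := by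
  have hq : ∀ i, ∀ z ∈ (extChartAt 𝓘(ℝ, EF) i).target,
      0 < liouville (Ω.along (fiberChart EF e u i) z) := by
    intro i z hz
    have ho : (extChartAt 𝓘(ℝ, EN) u u, z) ∈ prodDomain EN EF e u i :=
      ⟨center_mem_baseDomain hu, hz⟩
    have h := along_fiberChart S Ω he ho
    rw [extChartAt_to_inv] at h
    rw [h]
    exact (nondeg_along_prodChart S he hnd ho).liouville_pos
  obtain ⟨y⟩ := ‹Nonempty F›
  obtain ⟨i, hi, hy⟩ : ∃ i ∈ partIndex ρ, 0 < ρ i y := by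
    by_contra! h
    have := Finset.sum_nonpos h
    rw [sum_partIndex] at this
    linarith
  refine Finset.sum_pos' (fun j _ => ?_) ⟨i, hi, ?_⟩
  · refine setIntegral_nonneg (isOpen_extChartAt_target j).measurableSet fun z hz => ?_
    exact mul_nonneg (mul_nonneg (ρ.nonneg _ _) zero_le_one) (hq j z hz).le
  · have hc := continuousOn_partition_mul (ρ := ρ) hu (continuousOn_const (c := (1 : ℝ))) i
    have hi' := integrableOn_chartIntegrand μ S hΩ he hu hc
      (isClosed_tsupport (ρ i)).isCompact (tsupport_subset_source hρ i)
      (fun x _ hx => partition_mul_eq_zero (f := fun _ => 1) i hx)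
    have hco := continuousOn_chartIntegrand (y₀ := i) S hΩ he hu hc
    have hm := (isOpen_extChartAt_target (I := 𝓘(ℝ, EF)) i).measurableSet
    rw [chartIntegral, setIntegral_pos_iff_support_of_nonneg_ae _ hi']
    · have hym := (tsupport_subset_source hρ i) (subset_tsupport _ hy.ne')
      have hzm := (extChartAt 𝓘(ℝ, EF) i).map_source hym
      -- The integrand is positive on a nonempty open set of coordinates around `y`, and such a set
      -- has positive Haar measure.
      refine lt_of_lt_of_le (IsOpen.measure_pos μ (hco.isOpen_inter_preimage
        (isOpen_extChartAt_target i) isOpen_Ioi) ⟨extChartAt 𝓘(ℝ, EF) i y, hzm, ?_⟩)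
        (measure_mono fun z hz => ⟨(mem_Ioi.1 hz.2).ne', hz.1⟩)
      refine mul_pos (mul_pos ?_ one_pos) (hq i _ hzm)
      rw [snd_fiberChart hu, (extChartAt 𝓘(ℝ, EF) i).left_inv hym]
      exact hy
    · refine (ae_restrict_iff' hm).2 (Filter.Eventually.of_forall fun z hz => ?_)
      exact mul_nonneg (mul_nonneg (ρ.nonneg _ _) zero_le_one) (hq i z hz).le

end Partition

end FiberIntegral

/-! ### Solving for a vector with prescribed contraction, smoothly in parameters -/

section Musical

variable {V : Type*} [NormedAddCommGroup V] [NormedSpace ℝ V]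
  {Z : Type*} [NormedAddCommGroup Z] [NormedSpace ℝ Z] [FiniteDimensional ℝ Z]
  {H : Type*} [NormedAddCommGroup H] [NormedSpace ℝ H]

/-- A `2`-form as a map from vectors to covectors. -/
def flat (η : Z [⋀^Fin 2]→L[ℝ] ℝ) : Z →L[ℝ] Z →L[ℝ] ℝ :=
  LinearMap.toContinuousLinearMap
    ((LinearMap.toContinuousLinearMap : (Z →ₗ[ℝ] ℝ) ≃ₗ[ℝ] Z →L[ℝ] ℝ).toLinearMap ∘ₗ bilin η)

@[simp] theorem flat_apply (η : Z [⋀^Fin 2]→L[ℝ] ℝ) (a b : Z) : flat η a b = η ![a, b] := rfl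

theorem Nondeg.flat_isInvertible {η : Z [⋀^Fin 2]→L[ℝ] ℝ} (h : Nondeg η) :
    (flat η).IsInvertible := by
  have hinj : Function.Injective (flat η) := by
    rw [injective_iff_map_eq_zero]
    intro v hv
    exact h v fun w => congrArg (fun L => L w) hv
  have hdim : Module.finrank ℝ Z = Module.finrank ℝ (Z →L[ℝ] ℝ) := by
    rw [← (LinearMap.toContinuousLinearMap : (Z →ₗ[ℝ] ℝ) ≃ₗ[ℝ] Z →L[ℝ] ℝ).finrank_eq]
    exact (Subspace.dual_finrank_eq (K := ℝ) (V := Z)).symm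
  exact ⟨(LinearEquiv.ofInjectiveOfFinrankEq (flat η).toLinearMap hinj
    hdim).toContinuousLinearEquiv, by ext; rfl⟩

theorem contDiffWithinAt_clm_of_apply {G : Type*} [NormedAddCommGroup G] [NormedSpace ℝ G]
    {f : H → Z →L[ℝ] G} {s : Set H} {x : H} {n : WithTop ℕ∞}
    (h : ∀ z, ContDiffWithinAt ℝ n (fun y => f y z) s x) : ContDiffWithinAt ℝ n f s x := by
  let b := Module.finBasis ℝ Z
  have hf : f = fun y => ∑ i, ContinuousLinearMap.smulRightL ℝ Z G
      (LinearMap.toContinuousLinearMap (b.coord i)) (f y (b i)) := by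
    funext y
    ext z
    conv_lhs => rw [← b.sum_repr z, map_sum]
    simp
  rw [hf]
  exact ContDiffWithinAt.sum fun i _ =>
    (ContinuousLinearMap.contDiff _).comp_contDiffWithinAt (h _)

theorem contDiffAt_flat {η : H → Z [⋀^Fin 2]→L[ℝ] ℝ} {x : H} {n : WithTop ℕ∞}
    (h : ContDiffAt ℝ n η x) : ContDiffAt ℝ n (fun y => flat (η y)) x := by
  refine contDiffWithinAt_clm_of_apply (s := univ) fun a =>
    contDiffWithinAt_clm_of_apply fun b => ?_
  exact ContDiffWithinAt.alternating_apply (s := univ) h contDiffWithinAt_const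

theorem form_one_add {E : Type*} [NormedAddCommGroup E] [NormedSpace ℝ E]
    (θ : E [⋀^Fin 1]→L[ℝ] ℝ) (a b : E) : θ ![a + b] = θ ![a] + θ ![b] :=
  θ.toMultilinearMap.cons_add ![] a b

theorem form_one_smul {E : Type*} [NormedAddCommGroup E] [NormedSpace ℝ E]
    (θ : E [⋀^Fin 1]→L[ℝ] ℝ) (r : ℝ) (a : E) : θ ![r • a] = r * θ ![a] :=
  θ.toMultilinearMap.cons_smul ![] r a

theorem form_two_sub_left {E : Type*} [NormedAddCommGroup E] [NormedSpace ℝ E]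
    (η : E [⋀^Fin 2]→L[ℝ] ℝ) (a b c : E) : η ![a - b, c] = η ![a, c] - η ![b, c] := by
  have h1 : a - b = a + (-1 : ℝ) • b := by simp [sub_eq_add_neg]
  rw [h1, form_two_add_left, form_two_smul_left]
  ring

/-- The covector `w ↦ θ(w) - η(v, w)` on the second factor of a product. -/
def defect (η : (V × Z) [⋀^Fin 2]→L[ℝ] ℝ) (θ : (V × Z) [⋀^Fin 1]→L[ℝ] ℝ) (v : V) :
    Z →L[ℝ] ℝ :=
  LinearMap.toContinuousLinearMap
    (({ toFun := fun x => θ ![x]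
        map_add' := form_one_add θ
        map_smul' := form_one_smul θ } - bilin η (v, 0)) ∘ₗ LinearMap.inr ℝ V Z)

@[simp] theorem defect_apply (η : (V × Z) [⋀^Fin 2]→L[ℝ] ℝ) (θ : (V × Z) [⋀^Fin 1]→L[ℝ] ℝ)
    (v : V) (w : Z) : defect η θ v w = θ ![(0, w)] - η ![(v, 0), (0, w)] := rfl

/-- The vector with first component `v` whose contraction with `η` agrees with `θ` on the second
factor of a product. -/
def solveField (η : (V × Z) [⋀^Fin 2]→L[ℝ] ℝ) (θ : (V × Z) [⋀^Fin 1]→L[ℝ] ℝ) (v : V) : V × Z :=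
  (v, (flat (fiberPart η)).inverse (defect η θ v))

theorem solveField_spec {η : (V × Z) [⋀^Fin 2]→L[ℝ] ℝ} (h : Nondeg (fiberPart η))
    (θ : (V × Z) [⋀^Fin 1]→L[ℝ] ℝ) (v : V) (w : Z) :
    η ![solveField η θ v, (0, w)] = θ ![(0, w)] := by
  have h1 : flat (fiberPart η) ((flat (fiberPart η)).inverse (defect η θ v)) = defect η θ v :=
    congrArg (fun L => L (defect η θ v)) h.flat_isInvertible.self_comp_inverse
  have h2 := congrArg (fun L => L w) h1
  simp only [flat_apply, defect_apply, fiberPart_two_apply] at h2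
  have h3 : solveField η θ v = (v, 0) + (0, (flat (fiberPart η)).inverse (defect η θ v)) := by
    simp [solveField]
  rw [h3, form_two_add_left, h2]
  ring

theorem contDiffAt_solveField {η : H → (V × Z) [⋀^Fin 2]→L[ℝ] ℝ}
    {θ : H → (V × Z) [⋀^Fin 1]→L[ℝ] ℝ} {x : H} {n : WithTop ℕ∞} (hη : ContDiffAt ℝ n η x)
    (hθ : ContDiffAt ℝ n θ x) (h : Nondeg (fiberPart (η x))) (v : V) :
    ContDiffAt ℝ n (fun y => solveField (η y) (θ y) v) x := by
  refine contDiffAt_const.prodMk ?_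
  refine ContDiffAt.clm_apply ?_ ?_
  · exact ContDiffAt.comp x h.flat_isInvertible.contDiffAt_map_inverse
      (contDiffAt_flat (ContDiffAt.fiberPart hη))
  · refine contDiffWithinAt_clm_of_apply (s := univ) fun w => ?_
    simp only [defect_apply]
    exact (ContDiffWithinAt.alternating_apply hθ contDiffWithinAt_const).sub
      (ContDiffWithinAt.alternating_apply hη contDiffWithinAt_const)

end Musical

/-! ### Differentiating fiber integrals along solution fields -/

section Transport

open MeasureTheory

variable {EN : Type*} [NormedAddCommGroup EN] [NormedSpace ℝ EN] [FiniteDimensional ℝ EN]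
  {EF : Type*} [NormedAddCommGroup EF] [NormedSpace ℝ EF] [FiniteDimensional ℝ EF]
  {EP : Type*} [NormedAddCommGroup EP] [NormedSpace ℝ EP]
  {N : Type*} [TopologicalSpace N] [ChartedSpace EN N] [IsManifold 𝓘(ℝ, EN) ∞ N]
  {F : Type*} [TopologicalSpace F] [ChartedSpace EF F] [IsManifold 𝓘(ℝ, EF) ∞ F]
  {P : Type*} [TopologicalSpace P] [ChartedSpace EP P] [IsManifold 𝓘(ℝ, EP) ∞ P]
  {p : P → N} {σ : Form EF F 2} (S : SymplecticFibration EN EP p σ) {Ω : Form EP P 2}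
  {e : Bundle.Trivialization F p} {u₀ : N} {y₀ : F} {o : EN × EF}

variable (EN) in
/-- The vector `ξ` projects to `ν`, and its contraction with `Ω` agrees with `θ` on the fiber. -/
def IsSolution (p : P → N) (Ω : Form EP P 2) (θ : Form EP P 1) (x : P) (ν : EN) (ξ : EP) : Prop :=
  dProj EN EP p x ξ = ν ∧ ∀ w : EP, w ∈ vertical EN EP p x →
    (Ω x : EP [⋀^Fin 2]→L[ℝ] ℝ) ![ξ, w] = (θ x : EP [⋀^Fin 1]→L[ℝ] ℝ) ![w]

/-- The difference of two solutions is vertical and orthogonal to all vertical vectors, so fiberwise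
nondegeneracy kills it. -/
theorem IsSolution.unique (hnd : FiberwiseNondegenerate EN p Ω) {θ : Form EP P 1} {x : P} {ν : EN}
    {ξ ξ' : EP} (h : IsSolution EN p Ω θ x ν ξ) (h' : IsSolution EN p Ω θ x ν ξ') : ξ = ξ' := by
  rw [← sub_eq_zero]
  have hv : ξ - ξ' ∈ vertical EN EP p x := by
    change dProj EN EP p x (ξ - ξ') = 0
    rw [map_sub, h.1, h'.1, sub_self]
  refine hnd x _ hv fun w hw => ?_
  exact (form_two_sub_left (E := EP) (Ω x) ξ ξ' w).trans (sub_eq_zero.2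
    ((h.2 w hw).trans (h'.2 w hw).symm))

theorem isSolution_prodChart (he : e ∈ S.atlas) (hnd : FiberwiseNondegenerate EN p Ω)
    (ho : o ∈ prodDomain EN EF e u₀ y₀) (θ : Form EP P 1) (v : EN) :
    IsSolution EN p Ω θ (prodChart EN EF e u₀ y₀ o) (dBase EN u₀ o.1 v)
      (dChart EN EF EP e u₀ y₀ o (solveField (Ω.along (prodChart EN EF e u₀ y₀) o)
        (θ.along (prodChart EN EF e u₀ y₀) o) v)) := by
  refine ⟨dProj_dChart S he ho _, fun w hw => ?_⟩
  obtain ⟨b, rfl⟩ := (mem_vertical_iff S he ho w).1 hw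
  have h1 := solveField_spec (nondeg_along_prodChart S he hnd ho)
    (θ.along (prodChart EN EF e u₀ y₀) o) v b
  rw [along_prodChart_two, along_prodChart_one] at h1
  exact h1

theorem exists_isSolution (S : SymplecticFibration EN EP p σ) (hnd : FiberwiseNondegenerate EN p Ω) (θ : Form EP P 1) (x : P)
    (ν : EN) : ∃ ξ, IsSolution EN p Ω θ x ν ξ := by
  obtain ⟨e, he, hx⟩ := S.covers (p x)
  obtain ⟨o, ho, hox⟩ := exists_prodChart (EF := EF) (mem_tube_center (EN := EN) hx)
  obtain ⟨v, rfl⟩ := (dBase_bijective ho.1.1).2 ν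
  have := isSolution_prodChart S he hnd ho θ v
  rw [hox] at this
  exact ⟨_, this⟩

variable {θ : Form EP P 1} {X : P → EP} {v : EN}

/-- Uniqueness forces any pointwise solution to be `solveField` in every product chart. Fields
picked by choice at each point are therefore smooth. -/
theorem dChartInv_solution (he : e ∈ S.atlas) (hnd : FiberwiseNondegenerate EN p Ω)
    (hX : ∀ x ∈ tube EN e u₀,
      IsSolution EN p Ω θ x (dBase EN u₀ (extChartAt 𝓘(ℝ, EN) u₀ (p x)) v) (X x))
    (ho : o ∈ prodDomain EN EF e u₀ y₀) :
    dChartInv EN EF EP e u₀ y₀ o (X (prodChart EN EF e u₀ y₀ o))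
      = solveField (Ω.along (prodChart EN EF e u₀ y₀) o)
        (θ.along (prodChart EN EF e u₀ y₀) o) v := by
  have h1 := hX _ (prodChart_mem_tube ho)
  rw [proj_prodChart ho, (extChartAt 𝓘(ℝ, EN) u₀).right_inv ho.1.1] at h1
  rw [h1.unique hnd (isSolution_prodChart S he hnd ho θ v), dChartInv_dChart S he ho]

theorem contDiffOn_solveField (he : e ∈ S.atlas) (hΩ : Ω.IsSmooth)
    (hnd : FiberwiseNondegenerate EN p Ω) (hθ : θ.IsSmooth) :
    ContDiffOn ℝ ∞ (fun o => solveField (Ω.along (prodChart EN EF e u₀ y₀) o)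
      (θ.along (prodChart EN EF e u₀ y₀) o) v) (prodDomain EN EF e u₀ y₀) := fun _ ho =>
  (contDiffAt_solveField
    ((contDiffOn_along_prodChart S he hΩ).contDiffAt (isOpen_prodDomain.mem_nhds ho))
    ((contDiffOn_along_prodChart S he hθ).contDiffAt (isOpen_prodDomain.mem_nhds ho))
    (nondeg_along_prodChart S he hnd ho) v).contDiffWithinAt

theorem contMDiffOn_dirDeriv (he : e ∈ S.atlas) (hΩ : Ω.IsSmooth)
    (hnd : FiberwiseNondegenerate EN p Ω) (hθ : θ.IsSmooth)
    (hX : ∀ x ∈ tube EN e u₀,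
      IsSolution EN p Ω θ x (dBase EN u₀ (extChartAt 𝓘(ℝ, EN) u₀ (p x)) v) (X x))
    {f : P → ℝ} (hf : ContMDiffOn 𝓘(ℝ, EP) 𝓘(ℝ, ℝ) ∞ f (tube EN e u₀)) :
    ContMDiffOn 𝓘(ℝ, EP) 𝓘(ℝ, ℝ) ∞ (dirDeriv EP f X) (tube EN e u₀) := by
  refine contMDiffOn_of_prodChart S he fun y₀ => ?_
  have h1 : ContDiffOn ℝ ∞ (fun o => fderiv ℝ (f ∘ prodChart EN EF e u₀ y₀) o
      (solveField (Ω.along (prodChart EN EF e u₀ y₀) o)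
        (θ.along (prodChart EN EF e u₀ y₀) o) v)) (prodDomain EN EF e u₀ y₀) :=
    ((contDiffOn_comp_prodChart S he hf).fderiv_of_isOpen isOpen_prodDomain (by simp)).clm_apply
      (contDiffOn_solveField S he hΩ hnd hθ)
  refine h1.congr fun o ho => ?_
  rw [Function.comp_apply, dirDeriv_prodChart S he hf X ho, dChartInv_solution S he hnd hX ho]

theorem contMDiffOn_form_apply (he : e ∈ S.atlas) (hΩ : Ω.IsSmooth)
    (hnd : FiberwiseNondegenerate EN p Ω) (hθ : θ.IsSmooth)
    (hX : ∀ x ∈ tube EN e u₀,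
      IsSolution EN p Ω θ x (dBase EN u₀ (extChartAt 𝓘(ℝ, EN) u₀ (p x)) v) (X x))
    {α : Form EP P 1} (hα : α.IsSmooth) :
    ContMDiffOn 𝓘(ℝ, EP) 𝓘(ℝ, ℝ) ∞ (fun x => (α x : EP [⋀^Fin 1]→L[ℝ] ℝ) ![X x])
      (tube EN e u₀) := by
  refine contMDiffOn_of_prodChart S he fun y₀ => ?_
  have h1 : ContDiffOn ℝ ∞ (fun o => α.along (prodChart EN EF e u₀ y₀) o
      ![solveField (Ω.along (prodChart EN EF e u₀ y₀) o)
        (θ.along (prodChart EN EF e u₀ y₀) o) v]) (prodDomain EN EF e u₀ y₀) := fun o ho =>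
    ContDiffWithinAt.alternating_apply (contDiffOn_along_prodChart S he hα o ho)
      (contDiffWithinAt_pi.2 fun i => by
        fin_cases i; exact contDiffOn_solveField S he hΩ hnd hθ o ho)
  refine h1.congr fun o ho => ?_
  rw [Function.comp_apply, ← dChartInv_solution S he hnd hX ho, along_prodChart_one,
    dChart_dChartInv S he ho]

theorem continuousOn_fiber {f : P → ℝ}
    (hf : ContMDiffOn 𝓘(ℝ, EP) 𝓘(ℝ, ℝ) ∞ f (tube EN e u₀)) {t : EN} (ht : t ∈ baseDomain EN e u₀) :
    ContinuousOn f (p ⁻¹' {(extChartAt 𝓘(ℝ, EN) u₀).symm t}) := by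
  refine hf.continuousOn.mono fun x (hx : p x = _) => ?_
  rw [tube, mem_preimage, hx]
  exact ⟨(extChartAt 𝓘(ℝ, EN) u₀).map_target ht.1, ht.2⟩

variable [MeasurableSpace EF] [BorelSpace EF] (μ : Measure EF) [μ.IsAddHaarMeasure]

theorem chartIntegral_prodChart (he : e ∈ S.atlas) (f : P → ℝ) {t : EN}
    (ht : t ∈ baseDomain EN e u₀) :
    chartIntegral μ Ω e ((extChartAt 𝓘(ℝ, EN) u₀).symm t) y₀ f
      = ∫ z in (extChartAt 𝓘(ℝ, EF) y₀).target, (f ∘ prodChart EN EF e u₀ y₀) (t, z)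
        * fiberDensity (Ω.along (prodChart EN EF e u₀ y₀)) (t, z) ∂μ := by
  refine setIntegral_congr_fun (isOpen_extChartAt_target y₀).measurableSet fun z hz => ?_
  have := along_fiberChart S Ω he (o := (t, z)) (y₀ := y₀) ⟨ht, hz⟩
  simp only at this ⊢
  rw [this]
  rfl

theorem contDiffOn_fiberDensity (he : e ∈ S.atlas) (hΩ : Ω.IsSmooth)
    (hnd : FiberwiseNondegenerate EN p Ω) :
    ContDiffOn ℝ ∞ (fiberDensity (Ω.along (prodChart EN EF e u₀ y₀)))
      (prodDomain EN EF e u₀ y₀) := fun _ ho =>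
  (contDiffAt_liouville (ContDiffAt.fiberPart
    ((contDiffOn_along_prodChart S he hΩ).contDiffAt (isOpen_prodDomain.mem_nhds ho)))
    (nondeg_along_prodChart S he hnd ho)).contDiffWithinAt

section Chart

variable {K : Set F} (hK : IsCompact K) (hKy : K ⊆ (extChartAt 𝓘(ℝ, EF) y₀).source)
  {f : P → ℝ} (hf : ContMDiffOn 𝓘(ℝ, EP) 𝓘(ℝ, ℝ) ∞ f (tube EN e u₀))
  (hfK : ∀ x ∈ tube EN e u₀, (e x).2 ∉ K → f x = 0)

theorem isCompact_image_extChartAt (hK : IsCompact K)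
    (hKy : K ⊆ (extChartAt 𝓘(ℝ, EF) y₀).source) :
    IsCompact (extChartAt 𝓘(ℝ, EF) y₀ '' K)
      ∧ extChartAt 𝓘(ℝ, EF) y₀ '' K ⊆ (extChartAt 𝓘(ℝ, EF) y₀).target := by
  refine ⟨hK.image_of_continuousOn ((continuousOn_extChartAt y₀).mono hKy), ?_⟩
  rintro _ ⟨y, hy, rfl⟩
  exact (extChartAt 𝓘(ℝ, EF) y₀).map_source (hKy hy)

theorem comp_prodChart_eq_zero (hfK : ∀ x ∈ tube EN e u₀, (e x).2 ∉ K → f x = 0) {t : EN}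
    (ht : t ∈ baseDomain EN e u₀) {z : EF} (hz : z ∈ (extChartAt 𝓘(ℝ, EF) y₀).target)
    (hzK : z ∉ extChartAt 𝓘(ℝ, EF) y₀ '' K) : (f ∘ prodChart EN EF e u₀ y₀) (t, z) = 0 := by
  have ho : (t, z) ∈ prodDomain EN EF e u₀ y₀ := ⟨ht, hz⟩
  refine hfK _ (prodChart_mem_tube ho) ?_
  rw [snd_prodChart ho]
  exact fun h => hzK ⟨_, h, (extChartAt 𝓘(ℝ, EF) y₀).right_inv hz⟩

theorem contDiffOn_chartIntegral (he : e ∈ S.atlas) (hΩ : Ω.IsSmooth)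
    (hnd : FiberwiseNondegenerate EN p Ω)
    (hK : IsCompact K) (hKy : K ⊆ (extChartAt 𝓘(ℝ, EF) y₀).source)
    (hf : ContMDiffOn 𝓘(ℝ, EP) 𝓘(ℝ, ℝ) ∞ f (tube EN e u₀))
    (hfK : ∀ x ∈ tube EN e u₀, (e x).2 ∉ K → f x = 0) :
    ContDiffOn ℝ ∞ (fun t => chartIntegral μ Ω e ((extChartAt 𝓘(ℝ, EN) u₀).symm t) y₀ f)
      (baseDomain EN e u₀) := by
  obtain ⟨h1, h2⟩ := isCompact_image_extChartAt hK hKy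
  refine (contDiffOn_integral μ isOpen_baseDomain (isOpen_extChartAt_target y₀) h1 h2
    (G := fun o => (f ∘ prodChart EN EF e u₀ y₀) o
      * fiberDensity (Ω.along (prodChart EN EF e u₀ y₀)) o)
    ((contDiffOn_comp_prodChart S he hf).mul (contDiffOn_fiberDensity S he hΩ hnd))
    fun t ht z hz hzK => ?_).congr fun t ht => chartIntegral_prodChart S μ he f ht
  rw [comp_prodChart_eq_zero hfK ht hz hzK, zero_mul]

/-- Differentiation of an integral over a piece of the fibers. -/
theorem fderiv_chartIntegral (he : e ∈ S.atlas) (hΩ : Ω ∈ closedForms EP P 2)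
    (hnd : FiberwiseNondegenerate EN p Ω) (hθ : θ.IsSmooth)
    (hθd : ∀ x, ∀ a ∈ vertical EN EP p x, ∀ b ∈ vertical EN EP p x, θ.d x ![a, b] = 0)
    (hX : ∀ x ∈ tube EN e u₀,
      IsSolution EN p Ω θ x (dBase EN u₀ (extChartAt 𝓘(ℝ, EN) u₀ (p x)) v) (X x))
    (hK : IsCompact K) (hKy : K ⊆ (extChartAt 𝓘(ℝ, EF) y₀).source)
    (hf : ContMDiffOn 𝓘(ℝ, EP) 𝓘(ℝ, ℝ) ∞ f (tube EN e u₀))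
    (hfK : ∀ x ∈ tube EN e u₀, (e x).2 ∉ K → f x = 0) {t : EN} (ht : t ∈ baseDomain EN e u₀) :
    fderiv ℝ (fun t => chartIntegral μ Ω e ((extChartAt 𝓘(ℝ, EN) u₀).symm t) y₀ f) t v
      = chartIntegral μ Ω e ((extChartAt 𝓘(ℝ, EN) u₀).symm t) y₀ (dirDeriv EP f X) := by
  obtain ⟨h1, h2⟩ := isCompact_image_extChartAt hK hKy
  have hev : (fun t => chartIntegral μ Ω e ((extChartAt 𝓘(ℝ, EN) u₀).symm t) y₀ f) =ᶠ[𝓝 t]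
      fun t => ∫ z in (extChartAt 𝓘(ℝ, EF) y₀).target, (f ∘ prodChart EN EF e u₀ y₀) (t, z)
        * fiberDensity (Ω.along (prodChart EN EF e u₀ y₀)) (t, z) ∂μ := by
    filter_upwards [isOpen_baseDomain.mem_nhds ht] with t ht
    exact chartIntegral_prodChart S μ he f ht
  rw [hev.fderiv_eq, chartIntegral_prodChart S μ he _ ht]
  rw [fderiv_fiberIntegral μ isOpen_baseDomain (isOpen_extChartAt_target y₀) h1 h2
    (contDiffOn_along_prodChart S he hΩ.1)
    (fun o ho => extDeriv_along_prodChart_of_closed S he hΩ ho)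
    (fun o ho => nondeg_along_prodChart S he hnd ho)
    (contDiffOn_solveField (v := v) S he hΩ.1 hnd hθ) (fun o _ => rfl) ?_
    (contDiffOn_comp_prodChart S he hf)
    (fun t ht z hz hzK => comp_prodChart_eq_zero hfK ht hz hzK) ht]
  · refine setIntegral_congr_fun (isOpen_extChartAt_target y₀).measurableSet fun z hz => ?_
    have ho : (t, z) ∈ prodDomain EN EF e u₀ y₀ := ⟨ht, hz⟩
    simp only [Function.comp_apply]
    rw [dirDeriv_prodChart S he hf X ho, dChartInv_solution S he hnd hX ho]
  -- In fiber directions the contraction of `Ω` with the field is `θ`, so the closedness condition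
  -- is the vanishing of `θ.d` on pairs of vertical vectors.
  · intro o ho a b
    have hev : ∀ c : EF, (fun o' => Ω.along (prodChart EN EF e u₀ y₀) o'
        ![solveField (Ω.along (prodChart EN EF e u₀ y₀) o')
          (θ.along (prodChart EN EF e u₀ y₀) o') v, (0, c)])
        =ᶠ[𝓝 o] fun o' => θ.along (prodChart EN EF e u₀ y₀) o' ![(0, c)] := fun c => by
      filter_upwards [isOpen_prodDomain.mem_nhds ho] with o' ho'
      exact solveField_spec (nondeg_along_prodChart S he hnd ho') _ v c
    have hdθ : DifferentiableAt ℝ (θ.along (prodChart EN EF e u₀ y₀)) o :=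
      ((contDiffOn_along_prodChart S he hθ).contDiffAt
        (isOpen_prodDomain.mem_nhds ho)).differentiableAt (by simp)
    rw [(hev a).fderiv_eq, (hev b).fderiv_eq, fderiv_alternating_apply_const hdθ,
      fderiv_alternating_apply_const hdθ, ← sub_eq_zero, ← extDeriv_one_apply,
      extDeriv_along_prodChart S he hθ ho, along_prodChart_two]
    exact hθd _ _ ((mem_vertical_iff S he ho _).2 ⟨a, rfl⟩) _
      ((mem_vertical_iff S he ho _).2 ⟨b, rfl⟩)

end Chart

variable [CompactSpace F] {ρ : SmoothPartitionOfUnity F 𝓘(ℝ, EF) F univ}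
  {f : P → ℝ}

theorem contMDiffOn_partition_mul (he : e ∈ S.atlas)
    (hf : ContMDiffOn 𝓘(ℝ, EP) 𝓘(ℝ, ℝ) ∞ f (tube EN e u₀)) (i : F) :
    ContMDiffOn 𝓘(ℝ, EP) 𝓘(ℝ, ℝ) ∞ (fun x => ρ i (e x).2 * f x) (tube EN e u₀) := by
  refine ContMDiffOn.mul ((ρ i).contMDiff.comp_contMDiffOn ?_) hf
  exact contMDiff_snd.comp_contMDiffOn ((S.contMDiffOn e he).mono fun x hx => e.mem_source.2 hx.2)

theorem contDiffOn_fiberIntegral (hρ : ρ.IsSubordinate fun y => (chartAt EF y).source)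
    (he : e ∈ S.atlas) (hΩ : Ω.IsSmooth) (hnd : FiberwiseNondegenerate EN p Ω)
    (hf : ContMDiffOn 𝓘(ℝ, EP) 𝓘(ℝ, ℝ) ∞ f (tube EN e u₀)) :
    ContDiffOn ℝ ∞ (fun t => fiberIntegral μ Ω e ((extChartAt 𝓘(ℝ, EN) u₀).symm t) ρ f)
      (baseDomain EN e u₀) :=
  ContDiffOn.sum fun i _ => contDiffOn_chartIntegral S μ he hΩ hnd
    (isClosed_tsupport (ρ i)).isCompact (tsupport_subset_source hρ i)
    (contMDiffOn_partition_mul S he hf i) fun _ _ hx => partition_mul_eq_zero i hx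

theorem dirDeriv_partition_mul_eq_zero (S : SymplecticFibration EN EP p σ) (i : F) {x : P} (hx : x ∈ tube EN e u₀)
    (hxi : (e x).2 ∉ tsupport (ρ i)) :
    dirDeriv EP (fun x => ρ i (e x).2 * f x) X x = 0 := by
  have hc : ContinuousOn (fun x => (e x).2) (tube EN e u₀) :=
    continuous_snd.comp_continuousOn (e.toOpenPartialHomeomorph.continuousOn.mono
      fun x (hx : x ∈ tube EN e u₀) => e.mem_source.2 hx.2)
  have hev : (fun x => ρ i (e x).2 * f x) =ᶠ[𝓝 x] fun _ => (0 : ℝ) := by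
    filter_upwards [(hc.isOpen_inter_preimage (isOpen_tube S)
      (isClosed_tsupport (ρ i)).isOpen_compl).mem_nhds ⟨hx, hxi⟩] with x' hx'
    exact partition_mul_eq_zero i hx'.2
  rw [dirDeriv, hev.mfderiv_eq, mfderiv_const]
  rfl

/-- The derivatives falling on the cutoffs cancel in the sum, because the cutoffs add up to `1`. -/
theorem sum_dirDeriv_partition_mul (he : e ∈ S.atlas)
    (hf : ContMDiffOn 𝓘(ℝ, EP) 𝓘(ℝ, ℝ) ∞ f (tube EN e u₀)) {x : P} (hx : x ∈ tube EN e u₀) :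
    ∑ i ∈ partIndex ρ, dirDeriv EP (fun x => ρ i (e x).2 * f x) X x = dirDeriv EP f X x := by
  obtain ⟨o, ho, hox⟩ := exists_prodChart (EF := EF) hx
  generalize (e x).2 = y₀ at ho hox
  subst hox
  rw [dirDeriv_prodChart S he hf X ho, Finset.sum_congr rfl fun i _ =>
    dirDeriv_prodChart S he (contMDiffOn_partition_mul (ρ := ρ) S he hf i) X ho]
  have h : f ∘ prodChart EN EF e u₀ y₀ = fun o => ∑ i ∈ partIndex ρ,
      ((fun x => ρ i (e x).2 * f x) ∘ prodChart EN EF e u₀ y₀) o := by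
    funext o
    simp only [Function.comp_apply]
    rw [← Finset.sum_mul, sum_partIndex, one_mul]
  rw [h, fderiv_fun_sum fun i _ => ((contDiffOn_comp_prodChart S he
    (contMDiffOn_partition_mul (ρ := ρ) S he hf i)).contDiffAt
      (isOpen_prodDomain.mem_nhds ho)).differentiableAt (by simp)]
  simp

/-- Differentiation under the integral over the fibers, along a vector field that preserves the
Liouville densities of the fibers. -/
theorem fderiv_fiberIntegral_eq (hρ : ρ.IsSubordinate fun y => (chartAt EF y).source)
    (he : e ∈ S.atlas) (hΩ : Ω ∈ closedForms EP P 2)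
    (hnd : FiberwiseNondegenerate EN p Ω) (hθ : θ.IsSmooth)
    (hθd : ∀ x, ∀ a ∈ vertical EN EP p x, ∀ b ∈ vertical EN EP p x, θ.d x ![a, b] = 0)
    (hX : ∀ x ∈ tube EN e u₀,
      IsSolution EN p Ω θ x (dBase EN u₀ (extChartAt 𝓘(ℝ, EN) u₀ (p x)) v) (X x))
    (hf : ContMDiffOn 𝓘(ℝ, EP) 𝓘(ℝ, ℝ) ∞ f (tube EN e u₀)) {t : EN} (ht : t ∈ baseDomain EN e u₀) :
    fderiv ℝ (fun t => fiberIntegral μ Ω e ((extChartAt 𝓘(ℝ, EN) u₀).symm t) ρ f) t v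
      = fiberIntegral μ Ω e ((extChartAt 𝓘(ℝ, EN) u₀).symm t) ρ (dirDeriv EP f X) := by
  set u := (extChartAt 𝓘(ℝ, EN) u₀).symm t with hu_def
  have hu : u ∈ e.baseSet := ht.2
  have hmem : ∀ x, p x = u → x ∈ tube EN e u₀ := fun x hx => by
    rw [tube, mem_preimage, hx]
    exact ⟨(extChartAt 𝓘(ℝ, EN) u₀).map_target ht.1, ht.2⟩
  have hfi := fun i => contMDiffOn_partition_mul (ρ := ρ) S he hf i
  have hdc := fun i => continuousOn_fiber (contMDiffOn_dirDeriv S he hΩ.1 hnd hθ hX (hfi i)) ht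
  simp only [fiberIntegral]
  rw [fderiv_fun_sum fun i _ => ((contDiffOn_chartIntegral S μ he hΩ.1 hnd
    (isClosed_tsupport (ρ i)).isCompact (tsupport_subset_source hρ i) (hfi i)
    fun _ _ hx => partition_mul_eq_zero i hx).contDiffAt
      (isOpen_baseDomain.mem_nhds ht)).differentiableAt (by simp)]
  rw [sum_apply]
  -- Each derivative includes one of the cutoff, and these cancel only after summation. The chart
  -- integrals are therefore first rewritten as integrals over the whole fiber, where they can be
  -- added.
  have h1 : ∀ i ∈ partIndex ρ, fderiv ℝ (fun t => chartIntegral μ Ω e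
      ((extChartAt 𝓘(ℝ, EN) u₀).symm t) i (fun x => ρ i (e x).2 * f x)) t v
      = fiberIntegral μ Ω e u ρ (dirDeriv EP (fun x => ρ i (e x).2 * f x) X) := by
    intro i _
    rw [fderiv_chartIntegral S μ he hΩ hnd hθ hθd hX
      (isClosed_tsupport (ρ i)).isCompact (tsupport_subset_source hρ i) (hfi i)
      (fun _ _ hx => partition_mul_eq_zero i hx) ht]
    exact chartIntegral_eq_fiberIntegral μ S hρ hΩ.1 he he hu hu (hdc i)
      (isClosed_tsupport (ρ i)).isCompact (tsupport_subset_source hρ i)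
      fun x hx hxi => dirDeriv_partition_mul_eq_zero S i (hmem x hx) hxi
  rw [Finset.sum_congr rfl h1, ← fiberIntegral_sum μ S hρ hΩ.1 he hu _ fun i _ => hdc i]
  exact fiberIntegral_congr μ hu fun x hx => sum_dirDeriv_partition_mul S he hf (hmem x hx)

end Transport

/-! ### The curvature identity for two horizontal fields -/

section Commutator

variable {V : Type*} [NormedAddCommGroup V] [NormedSpace ℝ V]
  {Z : Type*} [NormedAddCommGroup Z] [NormedSpace ℝ Z]

theorem fderiv_fst_of_eventually_const {X : V × Z → V × Z} {o : V × Z} {v : V}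
    (hX : DifferentiableAt ℝ X o) (hv : ∀ᶠ o' in 𝓝 o, (X o').1 = v) (w : V × Z) :
    (fderiv ℝ X o w).1 = 0 := by
  have h := (hX.hasFDerivAt.fst).fderiv
  have h2 : (fun o' => (X o').1) =ᶠ[𝓝 o] fun _ => v := hv
  rw [h2.fderiv_eq, fderiv_fun_const] at h
  exact (congrArg (fun L => L w) h).symm

theorem eq_of_fst_eq_zero {a : V × Z} (h : a.1 = 0) : a = (0, a.2) := Prod.ext h rfl

/-- The vertical derivative of the curvature function of two horizontal fields, in terms of a
vertical field whose contraction with the closed form `η` is `α` on the fibers. -/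
theorem fderiv_apply_sub_fderiv_apply {η : V × Z → (V × Z) [⋀^Fin 2]→L[ℝ] ℝ}
    {α : V × Z → (V × Z) [⋀^Fin 1]→L[ℝ] ℝ} {X W Y : V × Z → V × Z} {o : V × Z} {v w : V}
    (hη : DifferentiableAt ℝ η o) (hα : DifferentiableAt ℝ α o) (hd : extDeriv η o = 0)
    (hX : DifferentiableAt ℝ X o) (hW : DifferentiableAt ℝ W o) (hY : DifferentiableAt ℝ Y o)
    (hX1 : ∀ᶠ o' in 𝓝 o, (X o').1 = v) (hW1 : ∀ᶠ o' in 𝓝 o, (W o').1 = w)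
    (hY1 : ∀ᶠ o' in 𝓝 o, (Y o').1 = 0)
    (hXη : ∀ᶠ o' in 𝓝 o, ∀ c, η o' ![X o', (0, c)] = 0)
    (hWη : ∀ᶠ o' in 𝓝 o, ∀ c, η o' ![W o', (0, c)] = 0)
    (hYη : ∀ c, η o ![Y o, (0, c)] = α o ![(0, c)]) :
    fderiv ℝ (fun o' => α o' ![W o']) o (X o) - fderiv ℝ (fun o' => α o' ![X o']) o (W o)
      = extDeriv α o ![X o, W o] - fderiv ℝ (fun o' => η o' ![X o', W o']) o (Y o) := by
  -- `η(A, Y)` vanishes near `o`, because `A` is orthogonal to the fibers and `Y` is vertical; this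
  -- is the product rule for its derivative along `b`, where the term with the derivative of `Y`,
  -- again vertical, drops out.
  have key : ∀ {A : V × Z → V × Z}, DifferentiableAt ℝ A o →
      (∀ᶠ o' in 𝓝 o, ∀ c, η o' ![A o', (0, c)] = 0) → ∀ b,
      fderiv ℝ η o b ![A o, Y o] = - η o ![fderiv ℝ A o b, Y o] := by
    intro A hA hAη b
    have h0 : (fun o' => η o' ![A o', Y o']) =ᶠ[𝓝 o] fun _ => 0 := by
      filter_upwards [hAη, hY1] with o' h1 h2
      rw [eq_of_fst_eq_zero h2]
      exact h1 _
    have h1 := fderiv_form_two_apply hη hA hY b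
    rw [h0.fderiv_eq, eq_of_fst_eq_zero (fderiv_fst_of_eventually_const hY hY1 b),
      hAη.self_of_nhds] at h1
    have h2 : fderiv ℝ (fun _ : V × Z => (0 : ℝ)) o b = 0 := by simp
    linarith
  -- The vector here is the bracket of `X` and `W`. It is vertical because both first components are
  -- constant, so the contraction of `η` with `Y` evaluates on it as `α`.
  have hR1 : (fderiv ℝ W o (X o) - fderiv ℝ X o (W o)).1 = 0 := by
    rw [Prod.fst_sub, fderiv_fst_of_eventually_const hW hW1, fderiv_fst_of_eventually_const hX hX1,
      sub_zero]
  have hR : η o ![Y o, fderiv ℝ W o (X o) - fderiv ℝ X o (W o)]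
      = α o ![fderiv ℝ W o (X o) - fderiv ℝ X o (W o)] := by
    rw [eq_of_fst_eq_zero hR1]
    exact hYη _
  have hRη : η o ![Y o, fderiv ℝ W o (X o) - fderiv ℝ X o (W o)]
      = η o ![fderiv ℝ X o (W o), Y o] - η o ![fderiv ℝ W o (X o), Y o] := by
    rw [form_two_swap, form_two_sub_left]
    ring
  have hRα : α o ![fderiv ℝ W o (X o) - fderiv ℝ X o (W o)]
      = α o ![fderiv ℝ W o (X o)] - α o ![fderiv ℝ X o (W o)] := by
    rw [sub_eq_add_neg, form_one_add, ← neg_one_smul ℝ, form_one_smul]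
    ring
  have hH := fderiv_form_two_apply hη hX hW (Y o)
  rw [eq_of_fst_eq_zero (fderiv_fst_of_eventually_const hW hW1 (Y o)), hXη.self_of_nhds,
    form_two_swap _ (fderiv ℝ X o (Y o)),
    eq_of_fst_eq_zero (fderiv_fst_of_eventually_const hX hX1 (Y o)), hWη.self_of_nhds] at hH
  -- Closedness on `X`, `W`, `Y`, combined with `key`, expresses `η(Y, [X, W])` as minus the
  -- derivative of `η(X, W)` along `Y`.
  have hc := extDeriv_two_apply η o (X o) (W o) (Y o)
  rw [hd, key hW hWη, key hX hXη] at hc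
  rw [fderiv_form_one_apply hα hW, fderiv_form_one_apply hα hX, extDeriv_one_apply, hH]
  have h0 : (0 : (V × Z) [⋀^Fin 3]→L[ℝ] ℝ) ![X o, W o, Y o] = 0 := rfl
  linarith

end Commutator

/-! ### Curvature identity on the total space and mean values over fibers -/

section Core

open MeasureTheory

variable {EN : Type*} [NormedAddCommGroup EN] [NormedSpace ℝ EN] [FiniteDimensional ℝ EN]
  {EF : Type*} [NormedAddCommGroup EF] [NormedSpace ℝ EF] [FiniteDimensional ℝ EF]
  {EP : Type*} [NormedAddCommGroup EP] [NormedSpace ℝ EP]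
  {N : Type*} [TopologicalSpace N] [ChartedSpace EN N] [IsManifold 𝓘(ℝ, EN) ∞ N]
  {F : Type*} [TopologicalSpace F] [ChartedSpace EF F] [IsManifold 𝓘(ℝ, EF) ∞ F]
  {P : Type*} [TopologicalSpace P] [ChartedSpace EP P] [IsManifold 𝓘(ℝ, EP) ∞ P]
  {p : P → N} {σ : Form EF F 2} (S : SymplecticFibration EN EP p σ) {Ω : Form EP P 2}
  {e : Bundle.Trivialization F p} {u₀ : N} {y₀ : F} {o : EN × EF}

section Fields

variable {θ θ' α : Form EP P 1} {X X' Y : P → EP} {v v' : EN}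

theorem contMDiffOn_form_two_apply (he : e ∈ S.atlas) (hΩ : Ω.IsSmooth)
    (hnd : FiberwiseNondegenerate EN p Ω) (hθ : θ.IsSmooth) (hθ' : θ'.IsSmooth)
    (hX : ∀ x ∈ tube EN e u₀,
      IsSolution EN p Ω θ x (dBase EN u₀ (extChartAt 𝓘(ℝ, EN) u₀ (p x)) v) (X x))
    (hX' : ∀ x ∈ tube EN e u₀,
      IsSolution EN p Ω θ' x (dBase EN u₀ (extChartAt 𝓘(ℝ, EN) u₀ (p x)) v') (X' x)) :
    ContMDiffOn 𝓘(ℝ, EP) 𝓘(ℝ, ℝ) ∞ (fun x => (Ω x : EP [⋀^Fin 2]→L[ℝ] ℝ) ![X x, X' x])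
      (tube EN e u₀) := by
  refine contMDiffOn_of_prodChart S he fun y₀ => ?_
  have h1 : ContDiffOn ℝ ∞ (fun o => Ω.along (prodChart EN EF e u₀ y₀) o
      ![solveField (Ω.along (prodChart EN EF e u₀ y₀) o)
        (θ.along (prodChart EN EF e u₀ y₀) o) v,
        solveField (Ω.along (prodChart EN EF e u₀ y₀) o)
        (θ'.along (prodChart EN EF e u₀ y₀) o) v']) (prodDomain EN EF e u₀ y₀) := fun o ho =>
    ContDiffWithinAt.alternating_apply (contDiffOn_along_prodChart S he hΩ o ho)
      (contDiffWithinAt_pi.2 fun i => by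
        fin_cases i
        · exact contDiffOn_solveField S he hΩ hnd hθ o ho
        · exact contDiffOn_solveField S he hΩ hnd hθ' o ho)
  refine h1.congr fun o ho => ?_
  rw [Function.comp_apply, ← dChartInv_solution S he hnd hX ho,
    ← dChartInv_solution S he hnd hX' ho, along_prodChart_two,
    dChart_dChartInv S he ho, dChart_dChartInv S he ho]

/-- Cartan's formula for a `1`-form and two horizontal lifts. -/
theorem dirDeriv_apply_sub_dirDeriv_apply (he : e ∈ S.atlas) (hΩ : Ω ∈ closedForms EP P 2)
    (hnd : FiberwiseNondegenerate EN p Ω) (hα : α.IsSmooth)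
    (hX : ∀ x ∈ tube EN e u₀,
      IsSolution EN p Ω 0 x (dBase EN u₀ (extChartAt 𝓘(ℝ, EN) u₀ (p x)) v) (X x))
    (hX' : ∀ x ∈ tube EN e u₀,
      IsSolution EN p Ω 0 x (dBase EN u₀ (extChartAt 𝓘(ℝ, EN) u₀ (p x)) v') (X' x))
    (hY : ∀ x ∈ tube EN e u₀,
      IsSolution EN p Ω α x (dBase EN u₀ (extChartAt 𝓘(ℝ, EN) u₀ (p x)) 0) (Y x))
    {x : P} (hx : x ∈ tube EN e u₀) :
    dirDeriv EP (fun x => (α x : EP [⋀^Fin 1]→L[ℝ] ℝ) ![X' x]) X x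
      - dirDeriv EP (fun x => (α x : EP [⋀^Fin 1]→L[ℝ] ℝ) ![X x]) X' x
      = (α.d x : EP [⋀^Fin 2]→L[ℝ] ℝ) ![X x, X' x]
        - dirDeriv EP (fun x => (Ω x : EP [⋀^Fin 2]→L[ℝ] ℝ) ![X x, X' x]) Y x := by
  have h0 : (0 : Form EP P 1).IsSmooth := Form.IsSmooth.zero
  obtain ⟨o, ho, hox⟩ := exists_prodChart (EF := EF) hx
  generalize (e x).2 = y₀ at ho hox
  subst hox
  set Ψ := prodChart EN EF e u₀ y₀ with hΨ
  rw [dirDeriv_prodChart S he (contMDiffOn_form_apply S he hΩ.1 hnd h0 hX' hα) X ho,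
    dirDeriv_prodChart S he (contMDiffOn_form_apply S he hΩ.1 hnd h0 hX hα) X' ho,
    dirDeriv_prodChart S he (contMDiffOn_form_two_apply S he hΩ.1 hnd h0 h0 hX hX') Y ho]
  have hev1 : ∀ {A : P → EP} {θ : Form EP P 1} {a : EN}, (∀ x ∈ tube EN e u₀,
      IsSolution EN p Ω θ x (dBase EN u₀ (extChartAt 𝓘(ℝ, EN) u₀ (p x)) a) (A x)) →
      (fun x => (α x : EP [⋀^Fin 1]→L[ℝ] ℝ) ![A x]) ∘ Ψ =ᶠ[𝓝 o] fun o =>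
        α.along Ψ o ![solveField (Ω.along Ψ o) (θ.along Ψ o) a] := fun {A θ a} hA => by
    filter_upwards [isOpen_prodDomain.mem_nhds ho] with o ho
    rw [← dChartInv_solution S he hnd hA ho, along_prodChart_one, dChart_dChartInv S he ho]
    rfl
  have hev2 : (fun x => (Ω x : EP [⋀^Fin 2]→L[ℝ] ℝ) ![X x, X' x]) ∘ Ψ =ᶠ[𝓝 o] fun o =>
        Ω.along Ψ o ![solveField (Ω.along Ψ o) ((0 : Form EP P 1).along Ψ o) v,
          solveField (Ω.along Ψ o) ((0 : Form EP P 1).along Ψ o) v'] := by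
    filter_upwards [isOpen_prodDomain.mem_nhds ho] with o ho
    rw [← dChartInv_solution S he hnd hX ho, ← dChartInv_solution S he hnd hX' ho,
      along_prodChart_two, dChart_dChartInv S he ho, dChart_dChartInv S he ho]
    rfl
  rw [(hev1 hX).fderiv_eq, (hev1 hX').fderiv_eq, hev2.fderiv_eq,
    dChartInv_solution S he hnd hX ho, dChartInv_solution S he hnd hX' ho,
    dChartInv_solution S he hnd hY ho]
  have hdiff : ∀ {θ : Form EP P 1} {a : EN}, θ.IsSmooth → DifferentiableAt ℝ
      (fun o => solveField (Ω.along Ψ o) (θ.along Ψ o) a) o := fun hθ =>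
    ((contDiffOn_solveField S he hΩ.1 hnd hθ).contDiffAt
      (isOpen_prodDomain.mem_nhds ho)).differentiableAt (by simp)
  have hspec : ∀ a : EN, ∀ᶠ o' in 𝓝 o, ∀ c : EF, Ω.along Ψ o'
      ![solveField (Ω.along Ψ o') ((0 : Form EP P 1).along Ψ o') a, (0, c)] = 0 := fun a => by
    filter_upwards [isOpen_prodDomain.mem_nhds ho] with o ho c
    exact solveField_spec (nondeg_along_prodChart S he hnd ho) _ _ _
  rw [fderiv_apply_sub_fderiv_apply (v := v) (w := v')
    (((contDiffOn_along_prodChart S he hΩ.1).contDiffAt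
      (isOpen_prodDomain.mem_nhds ho)).differentiableAt (by simp))
    (((contDiffOn_along_prodChart S he hα).contDiffAt
      (isOpen_prodDomain.mem_nhds ho)).differentiableAt (by simp))
    (extDeriv_along_prodChart_of_closed S he hΩ ho) (hdiff h0) (hdiff h0) (hdiff hα)
    (Filter.Eventually.of_forall fun _ => rfl) (Filter.Eventually.of_forall fun _ => rfl)
    (Filter.Eventually.of_forall fun _ => rfl) (hspec v) (hspec v')
    (fun c => solveField_spec (nondeg_along_prodChart S he hnd ho) _ _ _)]
  rw [extDeriv_along_prodChart S he hα ho, ← dChartInv_solution S he hnd hX ho,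
    ← dChartInv_solution S he hnd hX' ho, along_prodChart_two, dChart_dChartInv S he ho,
    dChart_dChartInv S he ho]

end Fields

section Average

variable [MeasurableSpace EF] [BorelSpace EF] (μ : Measure EF) [μ.IsAddHaarMeasure]
  [CompactSpace F] (ρ : SmoothPartitionOfUnity F 𝓘(ℝ, EF) F univ) (Ω)

/-- The mean value of a function over a fiber with respect to the Liouville density. -/
def fiberAverage (u : N) (f : P → ℝ) : ℝ :=
  fiberIntegral μ Ω (S.covers u).choose u ρ f / fiberIntegral μ Ω (S.covers u).choose u ρ fun _ => 1

variable {ρ Ω}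

theorem fiberAverage_congr {u : N} {f g : P → ℝ} (h : ∀ x, p x = u → f x = g x) :
    fiberAverage S Ω μ ρ u f = fiberAverage S Ω μ ρ u g := by
  rw [fiberAverage, fiberIntegral_congr μ (S.covers u).choose_spec.2 h, fiberAverage]

theorem fiberAverage_const_mul {u : N} (c : ℝ) (f : P → ℝ) :
    fiberAverage S Ω μ ρ u (fun x => c * f x) = c * fiberAverage S Ω μ ρ u f := by
  rw [fiberAverage, fiberIntegral_const_mul, fiberAverage, mul_div_assoc]

theorem fiberAverage_add (hρ : ρ.IsSubordinate fun y => (chartAt EF y).source) (hΩ : Ω.IsSmooth)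
    {u : N} {f g : P → ℝ} (hf : ContinuousOn f (p ⁻¹' {u})) (hg : ContinuousOn g (p ⁻¹' {u})) :
    fiberAverage S Ω μ ρ u (fun x => f x + g x)
      = fiberAverage S Ω μ ρ u f + fiberAverage S Ω μ ρ u g := by
  obtain ⟨he, hu⟩ := (S.covers u).choose_spec
  rw [fiberAverage, fiberIntegral_add μ S hρ hΩ he hu hf hg, fiberAverage, fiberAverage, add_div]

theorem fiberAverage_sub (hρ : ρ.IsSubordinate fun y => (chartAt EF y).source) (hΩ : Ω.IsSmooth)
    {u : N} {f g : P → ℝ} (hf : ContinuousOn f (p ⁻¹' {u})) (hg : ContinuousOn g (p ⁻¹' {u})) :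
    fiberAverage S Ω μ ρ u (fun x => f x - g x)
      = fiberAverage S Ω μ ρ u f - fiberAverage S Ω μ ρ u g := by
  rw [sub_eq_add_neg _ (fiberAverage S Ω μ ρ u g), ← neg_one_mul (fiberAverage S Ω μ ρ u g),
    ← fiberAverage_const_mul,
    ← fiberAverage_add (g := fun x => -1 * g x) S μ hρ hΩ hf (continuousOn_const.mul hg)]
  exact fiberAverage_congr S μ fun x _ => by ring

/-- The trivialization chosen in the definition depends on `u`. Replacing it by a fixed `e` is what
permits differentiation in `u`. -/
theorem fiberAverage_eq (hρ : ρ.IsSubordinate fun y => (chartAt EF y).source) (hΩ : Ω.IsSmooth)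
    (he : e ∈ S.atlas) {u : N} (hu : u ∈ e.baseSet) {f : P → ℝ}
    (hf : ContinuousOn f (p ⁻¹' {u})) : fiberAverage S Ω μ ρ u f
      = fiberIntegral μ Ω e u ρ f / fiberIntegral μ Ω e u ρ fun _ => 1 := by
  obtain ⟨he', hu'⟩ := (S.covers u).choose_spec
  rw [fiberAverage, fiberIntegral_change μ S hρ hΩ he he' hu hu' hf,
    fiberIntegral_change μ S hρ hΩ he he' hu hu' continuousOn_const]

variable [Nonempty F]

theorem fiberAverage_const (hρ : ρ.IsSubordinate fun y => (chartAt EF y).source) (hΩ : Ω.IsSmooth)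
    (hnd : FiberwiseNondegenerate EN p Ω) {u : N} (c : ℝ) :
    fiberAverage S Ω μ ρ u (fun _ => c) = c := by
  obtain ⟨he, hu⟩ := (S.covers u).choose_spec
  have h := fiberAverage_const_mul S μ (Ω := Ω) (ρ := ρ) (u := u) c fun _ => 1
  rw [mul_one] at h
  rw [h, fiberAverage, div_self (fiberIntegral_one_pos μ S hρ hΩ hnd he hu).ne', mul_one]

variable {f : P → ℝ} {t : EN}

theorem eventuallyEq_fiberAverage (hρ : ρ.IsSubordinate fun y => (chartAt EF y).source)
    (he : e ∈ S.atlas) (hΩ : Ω.IsSmooth)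
    (hf : ContMDiffOn 𝓘(ℝ, EP) 𝓘(ℝ, ℝ) ∞ f (tube EN e u₀)) (ht : t ∈ baseDomain EN e u₀) :
    (fun t => fiberAverage S Ω μ ρ ((extChartAt 𝓘(ℝ, EN) u₀).symm t) f) =ᶠ[𝓝 t] fun t =>
      fiberIntegral μ Ω e ((extChartAt 𝓘(ℝ, EN) u₀).symm t) ρ f
        / fiberIntegral μ Ω e ((extChartAt 𝓘(ℝ, EN) u₀).symm t) ρ fun _ => 1 := by
  filter_upwards [isOpen_baseDomain.mem_nhds ht] with t ht
  exact fiberAverage_eq S μ hρ hΩ he ht.2 (continuousOn_fiber hf ht)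

theorem contDiffAt_fiberAverage (hρ : ρ.IsSubordinate fun y => (chartAt EF y).source)
    (he : e ∈ S.atlas) (hΩ : Ω.IsSmooth) (hnd : FiberwiseNondegenerate EN p Ω)
    (hf : ContMDiffOn 𝓘(ℝ, EP) 𝓘(ℝ, ℝ) ∞ f (tube EN e u₀)) (ht : t ∈ baseDomain EN e u₀) :
    ContDiffAt ℝ ∞ (fun t => fiberAverage S Ω μ ρ ((extChartAt 𝓘(ℝ, EN) u₀).symm t) f) t := by
  refine ContDiffAt.congr_of_eventuallyEq ?_ (eventuallyEq_fiberAverage S μ hρ he hΩ hf ht)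
  have hn := isOpen_baseDomain.mem_nhds ht
  exact ((contDiffOn_fiberIntegral S μ hρ he hΩ hnd hf).contDiffAt hn).div
    ((contDiffOn_fiberIntegral S μ hρ he hΩ hnd contMDiffOn_const).contDiffAt hn)
    (fiberIntegral_one_pos μ S hρ hΩ hnd he ht.2).ne'

theorem fderiv_fiberAverage {θ : Form EP P 1} {X : P → EP} {v : EN}
    (hρ : ρ.IsSubordinate fun y => (chartAt EF y).source)
    (he : e ∈ S.atlas) (hΩ : Ω ∈ closedForms EP P 2)
    (hnd : FiberwiseNondegenerate EN p Ω) (hθ : θ.IsSmooth)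
    (hθd : ∀ x, ∀ a ∈ vertical EN EP p x, ∀ b ∈ vertical EN EP p x, θ.d x ![a, b] = 0)
    (hX : ∀ x ∈ tube EN e u₀,
      IsSolution EN p Ω θ x (dBase EN u₀ (extChartAt 𝓘(ℝ, EN) u₀ (p x)) v) (X x))
    (hf : ContMDiffOn 𝓘(ℝ, EP) 𝓘(ℝ, ℝ) ∞ f (tube EN e u₀)) (ht : t ∈ baseDomain EN e u₀) :
    fderiv ℝ (fun t => fiberAverage S Ω μ ρ ((extChartAt 𝓘(ℝ, EN) u₀).symm t) f) t v
      = fiberAverage S Ω μ ρ ((extChartAt 𝓘(ℝ, EN) u₀).symm t) (dirDeriv EP f X) := by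
  have hn := isOpen_baseDomain.mem_nhds ht
  have h1 : ContMDiffOn 𝓘(ℝ, EP) 𝓘(ℝ, ℝ) ∞ (fun _ : P => (1 : ℝ)) (tube EN e u₀) :=
    contMDiffOn_const
  have hpos := fiberIntegral_one_pos μ S hρ hΩ.1 hnd he ht.2
  -- The volume of the fibers has zero derivative, by the formula for integrals applied to the
  -- function `1`. In the product rule for mean times volume only the derivative of the mean
  -- survives.
  have hd1 : fderiv ℝ (fun t => fiberIntegral μ Ω e ((extChartAt 𝓘(ℝ, EN) u₀).symm t) ρ
      fun _ => 1) t v = 0 := by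
    rw [fderiv_fiberIntegral_eq S μ hρ he hΩ hnd hθ hθd hX h1 ht]
    have : dirDeriv EP (fun _ : P => (1 : ℝ)) X = fun _ => 0 * 0 := by
      funext x
      rw [dirDeriv, mfderiv_const]
      exact (zero_mul _).symm
    rw [this, fiberIntegral_const_mul, zero_mul]
  have hprod : (fun t => fiberIntegral μ Ω e ((extChartAt 𝓘(ℝ, EN) u₀).symm t) ρ f) =ᶠ[𝓝 t]
      fun t => fiberAverage S Ω μ ρ ((extChartAt 𝓘(ℝ, EN) u₀).symm t) f
        * fiberIntegral μ Ω e ((extChartAt 𝓘(ℝ, EN) u₀).symm t) ρ fun _ => 1 := by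
    filter_upwards [hn, eventuallyEq_fiberAverage S μ hρ he hΩ.1 hf ht] with t ht' h
    rw [h, div_mul_cancel₀ _ (fiberIntegral_one_pos μ S hρ hΩ.1 hnd he ht'.2).ne']
  have hdf := fderiv_fiberIntegral_eq S μ hρ he hΩ hnd hθ hθd hX hf ht
  rw [hprod.fderiv_eq, fderiv_fun_mul
    ((contDiffAt_fiberAverage S μ hρ he hΩ.1 hnd hf ht).differentiableAt (by simp))
    (((contDiffOn_fiberIntegral S μ hρ he hΩ.1 hnd h1).contDiffAt hn).differentiableAt
      (by simp))] at hdf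
  simp only [add_apply, smul_apply, smul_eq_mul, hd1, mul_zero, zero_add] at hdf
  rw [fiberAverage_eq S μ hρ hΩ.1 he ht.2
      (continuousOn_fiber (contMDiffOn_dirDeriv S he hΩ.1 hnd hθ hX hf) ht), ← hdf,
    mul_div_cancel_left₀ _ hpos.ne']

end Average

end Core

/-! ### A primitive on the base by averaging a primitive on the total space -/

section BasePrimitive

open MeasureTheory

variable {EN : Type*} [NormedAddCommGroup EN] [NormedSpace ℝ EN] [FiniteDimensional ℝ EN]
  {EF : Type*} [NormedAddCommGroup EF] [NormedSpace ℝ EF] [FiniteDimensional ℝ EF]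
  {EP : Type*} [NormedAddCommGroup EP] [NormedSpace ℝ EP]
  {N : Type*} [TopologicalSpace N] [ChartedSpace EN N] [IsManifold 𝓘(ℝ, EN) ∞ N]
  {F : Type*} [TopologicalSpace F] [ChartedSpace EF F] [IsManifold 𝓘(ℝ, EF) ∞ F]
  {P : Type*} [TopologicalSpace P] [ChartedSpace EP P] [IsManifold 𝓘(ℝ, EP) ∞ P]
  {p : P → N} {σ : Form EF F 2} (S : SymplecticFibration EN EP p σ) {Ω : Form EP P 2}
  {e : Bundle.Trivialization F p} {u₀ : N}

section Lift

variable (hnd : FiberwiseNondegenerate EN p Ω)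

/-- The vector over `ν` whose contraction with `Ω` agrees with `θ` on the fiber. -/
def lift (θ : Form EP P 1) (x : P) (ν : EN) : EP := (exists_isSolution S hnd θ x ν).choose

theorem lift_spec (θ : Form EP P 1) (x : P) (ν : EN) :
    IsSolution EN p Ω θ x ν (lift S hnd θ x ν) := (exists_isSolution S hnd θ x ν).choose_spec

/-- The lift is chosen pointwise; its linearity comes from uniqueness, as both sides solve the same
conditions. -/
theorem lift_add (x : P) (ν ν' : EN) :
    lift S hnd 0 x (ν + ν') = lift S hnd 0 x ν + lift S hnd 0 x ν' := by
  have h := lift_spec S hnd 0 x ν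
  have h' := lift_spec S hnd 0 x ν'
  refine (lift_spec S hnd 0 x _).unique hnd ⟨by rw [map_add, h.1, h'.1], fun w hw => ?_⟩
  refine (form_two_add_left (E := EP) (Ω x) _ _ w).trans ?_
  exact (congrArg₂ (· + ·) (h.2 w hw) (h'.2 w hw)).trans (add_zero _)

theorem lift_smul (x : P) (r : ℝ) (ν : EN) :
    lift S hnd 0 x (r • ν) = r • lift S hnd 0 x ν := by
  have h := lift_spec S hnd 0 x ν
  refine (lift_spec S hnd 0 x _).unique hnd ⟨by rw [map_smul, h.1], fun w hw => ?_⟩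
  refine (form_two_smul_left (E := EP) (Ω x) _ _ w).trans ?_
  exact (congrArg (r * ·) (h.2 w hw)).trans (mul_zero _)

variable (u₀) in
/-- The lift of the coordinate vector field `v` of the chart at `u₀`. -/
def liftField (θ : Form EP P 1) (v : EN) (x : P) : EP :=
  lift S hnd θ x (dBase EN u₀ (extChartAt 𝓘(ℝ, EN) u₀ (p x)) v)

theorem liftField_spec (θ : Form EP P 1) (v : EN) (x : P) :
    IsSolution EN p Ω θ x (dBase EN u₀ (extChartAt 𝓘(ℝ, EN) u₀ (p x)) v)
      (liftField S u₀ hnd θ v x) := lift_spec S hnd θ x _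

end Lift

variable [MeasurableSpace EF] [BorelSpace EF] (μ : Measure EF) [μ.IsAddHaarMeasure]
  [CompactSpace F] {ρ : SmoothPartitionOfUnity F 𝓘(ℝ, EF) F univ}
  (hρ : ρ.IsSubordinate fun y => (chartAt EF y).source)
  (hnd : FiberwiseNondegenerate EN p Ω) {α : Form EP P 1}

theorem continuousOn_form_lift (S : SymplecticFibration EN EP p σ)
    (hnd : FiberwiseNondegenerate EN p Ω) (hΩ : Ω.IsSmooth) (hα : α.IsSmooth) (u : N) (ν : EN) :
    ContinuousOn (fun x => (α x : EP [⋀^Fin 1]→L[ℝ] ℝ) ![(lift S hnd 0 x ν : EP)]) (p ⁻¹' {u}) := by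
  obtain ⟨e, he, hu⟩ := S.covers u
  obtain ⟨v, rfl⟩ := (dBase_bijective (mem_extChartAt_target (I := 𝓘(ℝ, EN)) u)).2 ν
  have h := continuousOn_fiber (contMDiffOn_form_apply S he hΩ hnd Form.IsSmooth.zero
    (fun x _ => liftField_spec (u₀ := u) S hnd 0 v x) hα) (center_mem_baseDomain hu)
  rw [extChartAt_to_inv] at h
  refine h.congr fun x (hx : p x = u) => ?_
  simp only [liftField]
  rw [hx]

variable (α) in
/-- The `1`-form on the base whose value on a vector is the mean value over the fiber of the value
of `α` on the horizontal lift of the vector. -/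
def averageForm (hρ : ρ.IsSubordinate fun y => (chartAt EF y).source) (hΩ : Ω.IsSmooth)
    (hα : α.IsSmooth) : Form EN N 1 := fun u =>
  ContinuousAlternatingMap.ofSubsingleton ℝ EN ℝ (0 : Fin 1) (LinearMap.toContinuousLinearMap
    { toFun := fun ν => fiberAverage S Ω μ ρ u fun x =>
        (α x : EP [⋀^Fin 1]→L[ℝ] ℝ) ![(lift S hnd 0 x ν : EP)]
      map_add' := fun ν ν' => by
        rw [← fiberAverage_add S μ hρ hΩ (continuousOn_form_lift S hnd hΩ hα u ν)
          (continuousOn_form_lift S hnd hΩ hα u ν')]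
        refine fiberAverage_congr S μ fun x _ => ?_
        rw [lift_add]
        exact form_one_add (E := EP) (α x) _ _
      map_smul' := fun r ν => by
        rw [RingHom.id_apply, smul_eq_mul, ← fiberAverage_const_mul]
        refine fiberAverage_congr S μ fun x _ => ?_
        rw [lift_smul]
        exact form_one_smul (E := EP) (α x) r _ })

theorem averageForm_inChart (hΩ : Ω.IsSmooth) (hα : α.IsSmooth) (u₀ : N) {t : EN}
    (ht : t ∈ (extChartAt 𝓘(ℝ, EN) u₀).target) (v : Fin 1 → EN) :
    (averageForm S μ hnd α hρ hΩ hα).inChart u₀ t v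
      = fiberAverage S Ω μ ρ ((extChartAt 𝓘(ℝ, EN) u₀).symm t) fun x =>
        (α x : EP [⋀^Fin 1]→L[ℝ] ℝ) ![(liftField S u₀ hnd 0 (v 0) x : EP)] := by
  refine Eq.trans (b := fiberAverage S Ω μ ρ ((extChartAt 𝓘(ℝ, EN) u₀).symm t) fun x =>
    (α x : EP [⋀^Fin 1]→L[ℝ] ℝ) ![(lift S hnd 0 x (dBase EN u₀ t (v 0)) : EP)]) rfl ?_
  refine fiberAverage_congr S μ fun x hx => ?_
  rw [liftField, hx, (extChartAt 𝓘(ℝ, EN) u₀).right_inv ht]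

variable [Nonempty F]

theorem contDiffAt_averageForm_inChart (hΩ : Ω.IsSmooth) (hα : α.IsSmooth) (u : N) :
    ContDiffAt ℝ ∞ ((averageForm S μ hnd α hρ hΩ hα).inChart u) (extChartAt 𝓘(ℝ, EN) u u) := by
  refine contDiffWithinAt_alternating_of_apply (s := univ) fun v => ?_
  obtain ⟨e, he, hu⟩ := S.covers u
  refine ContDiffAt.congr_of_eventuallyEq (contDiffAt_fiberAverage S μ hρ he hΩ hnd
    (contMDiffOn_form_apply S he hΩ hnd Form.IsSmooth.zero
      (fun x _ => liftField_spec (u₀ := u) S hnd 0 (v 0) x) hα) (center_mem_baseDomain hu)) ?_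
  filter_upwards [extChartAt_target_mem_nhds (I := 𝓘(ℝ, EN)) u] with t ht
  exact averageForm_inChart S μ hρ hnd hΩ hα u ht v

/-- Differentiation of means along horizontal lifts and the curvature identity leave the mean of
`β(v, w) - Y(Ω(X, W))`, with `Y` vertical and dual to `α` on the fibers. The second term has mean
zero because `Y` preserves the density and covers the zero field. -/
theorem averageForm_d (hΩ : Ω ∈ closedForms EP P 2) (hα : α.IsSmooth) {β : Form EN N 2}
    (hβ : Form.pullback p β = α.d) : (averageForm S μ hnd α hρ hΩ.1 hα).d = β := by
  refine funext fun u => Form.d_eq_of_center ?_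
  obtain ⟨e, he, hu⟩ := S.covers u
  set t := extChartAt 𝓘(ℝ, EN) u u with ht_def
  have ht : t ∈ baseDomain EN e u := center_mem_baseDomain hu
  have h0 : (0 : Form EP P 1).IsSmooth := Form.IsSmooth.zero
  have h0d : ∀ x, ∀ a ∈ vertical EN EP p x, ∀ b ∈ vertical EN EP p x,
      (0 : Form EP P 1).d x ![a, b] = 0 := fun x a _ b _ => by
    rw [Form.d_zero]; rfl
  have hαβ : ∀ x (a b : EP), (α.d x : EP [⋀^Fin 2]→L[ℝ] ℝ) ![a, b]
      = (β (p x) : EN [⋀^Fin 2]→L[ℝ] ℝ) ![dProj EN EP p x a, dProj EN EP p x b] := fun x a b => by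
    rw [← hβ]
    exact comp_two_apply (E := EN) (β (p x)) (dProj EN EP p x) a b
  -- A primitive of a pulled back form is closed on every fiber, so the vertical field dual to it
  -- preserves the Liouville density.
  have hαd : ∀ x, ∀ a ∈ vertical EN EP p x, ∀ b ∈ vertical EN EP p x, α.d x ![a, b] = 0 :=
    fun x a ha b _ => by
      refine (hαβ x a b).trans ?_
      rw [show dProj EN EP p x a = 0 from ha]
      exact (β (p x) : EN [⋀^Fin 2]→L[ℝ] ℝ).map_coord_zero 0 rfl
  have hsp := fun (θ : Form EP P 1) (v : EN) (x : P) (_ : x ∈ tube EN e u) =>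
    liftField_spec (u₀ := u) S hnd θ v x
  have hf := fun v => contMDiffOn_form_apply S he hΩ.1 hnd h0 (hsp 0 v) hα
  have hH := fun v w => contMDiffOn_form_two_apply S he hΩ.1 hnd h0 h0 (hsp 0 v) (hsp 0 w)
  have hD := fun v w => fderiv_fiberAverage S μ hρ he hΩ hnd h0 h0d (hsp 0 v) (hf w) ht
  -- The field of `α` over the base vector `0`: the left side is a derivative in direction `0`, so
  -- the mean on the right is zero.
  have hD0 := fun v w => fderiv_fiberAverage S μ hρ he hΩ hnd hα hαd (hsp α 0) (hH v w) ht
  have hcont := fun {g : P → ℝ} (hg : ContMDiffOn 𝓘(ℝ, EP) 𝓘(ℝ, ℝ) ∞ g (tube EN e u)) =>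
    continuousOn_fiber hg ht
  have hsub : ∀ {g g' : P → ℝ}, ContMDiffOn 𝓘(ℝ, EP) 𝓘(ℝ, ℝ) ∞ g (tube EN e u) →
      ContMDiffOn 𝓘(ℝ, EP) 𝓘(ℝ, ℝ) ∞ g' (tube EN e u) →
      fiberAverage S Ω μ ρ ((extChartAt 𝓘(ℝ, EN) u).symm t) (fun x => g x - g' x)
        = fiberAverage S Ω μ ρ ((extChartAt 𝓘(ℝ, EN) u).symm t) g
          - fiberAverage S Ω μ ρ ((extChartAt 𝓘(ℝ, EN) u).symm t) g' := fun hg hg' =>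
    fiberAverage_sub S μ hρ hΩ.1 (hcont hg) (hcont hg')
  have hγ := contDiffAt_averageForm_inChart S μ hρ hnd hΩ.1 hα u
  have hfd : ∀ v w, fderiv ℝ ((averageForm S μ hnd α hρ hΩ.1 hα).inChart u) t v ![w]
      = fiberAverage S Ω μ ρ ((extChartAt 𝓘(ℝ, EN) u).symm t)
        (dirDeriv EP (fun x => (α x : EP [⋀^Fin 1]→L[ℝ] ℝ) ![(liftField S u hnd 0 w x : EP)])
          (liftField S u hnd 0 v)) := fun v w => by
    rw [← fderiv_alternating_apply_const (hγ.differentiableAt (by simp)), ← hD]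
    refine congrArg (fun L : EN →L[ℝ] ℝ => L v) (Filter.EventuallyEq.fderiv_eq ?_)
    filter_upwards [extChartAt_target_mem_nhds (I := 𝓘(ℝ, EN)) u] with t ht
    exact averageForm_inChart S μ hρ hnd hΩ.1 hα u ht ![w]
  ext vw
  obtain ⟨v, w, rfl⟩ : ∃ v w, vw = ![v, w] := ⟨vw 0, vw 1, by
    funext i; fin_cases i <;> rfl⟩
  rw [extDeriv_one_apply, hfd, hfd, ← hsub (contMDiffOn_dirDeriv S he hΩ.1 hnd h0 (hsp 0 v) (hf w))
    (contMDiffOn_dirDeriv S he hΩ.1 hnd h0 (hsp 0 w) (hf v))]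
  have hx : ∀ x, p x = (extChartAt 𝓘(ℝ, EN) u).symm t → x ∈ tube EN e u := fun x hx => by
    rw [extChartAt_to_inv] at hx
    rw [tube, mem_preimage, hx]
    exact ⟨mem_extChartAt_source u, hu⟩
  have hval : ∀ x, p x = (extChartAt 𝓘(ℝ, EN) u).symm t →
      dirDeriv EP (fun x => (α x : EP [⋀^Fin 1]→L[ℝ] ℝ) ![(liftField S u hnd 0 w x : EP)])
          (liftField S u hnd 0 v) x
        - dirDeriv EP (fun x => (α x : EP [⋀^Fin 1]→L[ℝ] ℝ) ![(liftField S u hnd 0 v x : EP)])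
          (liftField S u hnd 0 w) x
      = β.inChart u t ![v, w] - dirDeriv EP (fun x => (Ω x : EP [⋀^Fin 2]→L[ℝ] ℝ)
          ![(liftField S u hnd 0 v x : EP), (liftField S u hnd 0 w x : EP)]) (liftField S u hnd α 0) x := by
    intro x hpx
    rw [dirDeriv_apply_sub_dirDeriv_apply S he hΩ hnd hα (hsp 0 v) (hsp 0 w) (hsp α 0) (hx x hpx),
      hαβ, (liftField_spec S hnd 0 v x).1, (liftField_spec S hnd 0 w x).1, hpx,
      (extChartAt 𝓘(ℝ, EN) u).right_inv ht.1]
    congr 1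
    exact (comp_two_apply (E := EN) (β ((extChartAt 𝓘(ℝ, EN) u).symm t)) (dBase EN u t) v w).symm
  rw [fiberAverage_congr S μ hval, hsub contMDiffOn_const
    (contMDiffOn_dirDeriv S he hΩ.1 hnd hα (hsp α 0) (hH v w)), ← hD0, map_zero, sub_zero,
    fiberAverage_const S μ hρ hΩ.1 hnd]

variable [T2Space F]

/-- A form on the base of a symplectic fibration is exact if its pullback to the total space is. -/
theorem mem_exactForms_of_pullback (S : SymplecticFibration EN EP p σ) (hΩ : Ω ∈ closedForms EP P 2)
    (hnd : FiberwiseNondegenerate EN p Ω) {β : Form EN N 2}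
    (hβ : Form.pullback p β ∈ exactForms EP P 1) : β ∈ exactForms EN N 1 := by
  obtain ⟨α, hα, hαβ⟩ := hβ
  obtain ⟨ρ, hρ⟩ := SmoothPartitionOfUnity.exists_isSubordinate_chartAt_source 𝓘(ℝ, EF) F
  exact ⟨averageForm S Measure.addHaar hnd α hρ hΩ.1 hα,
    Form.isSmooth_of_center (contDiffAt_averageForm_inChart S _ hρ hnd hΩ.1 hα),
    averageForm_d S _ hρ hnd hΩ hα hαβ.symm⟩

end BasePrimitive

/-! ### Closed horizontal forms descend to the base -/

section BasicForms

variable {EN : Type*} [NormedAddCommGroup EN] [NormedSpace ℝ EN] [FiniteDimensional ℝ EN]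
  {EF : Type*} [NormedAddCommGroup EF] [NormedSpace ℝ EF] [FiniteDimensional ℝ EF]
  {EP : Type*} [NormedAddCommGroup EP] [NormedSpace ℝ EP]
  {N : Type*} [TopologicalSpace N] [ChartedSpace EN N] [IsManifold 𝓘(ℝ, EN) ∞ N]
  {F : Type*} [TopologicalSpace F] [ChartedSpace EF F] [IsManifold 𝓘(ℝ, EF) ∞ F]
  {P : Type*} [TopologicalSpace P] [ChartedSpace EP P] [IsManifold 𝓘(ℝ, EP) ∞ P]
  {p : P → N} {σ : Form EF F 2} (S : SymplecticFibration EN EP p σ) {Ω τ : Form EP P 2}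

theorem exists_dProj_eq (S : SymplecticFibration EN EP p σ) (x : P) (ν : EN) :
    ∃ ξ, dProj EN EP p x ξ = ν := by
  obtain ⟨e, he, hx⟩ := S.covers (p x)
  obtain ⟨o, ho, hox⟩ := exists_prodChart (EF := EF) (mem_tube_center (EN := EN) hx)
  obtain ⟨v, rfl⟩ := (dBase_bijective ho.1.1).2 ν
  have := dProj_dChart S he ho (v, 0)
  rw [hox] at this
  exact ⟨_, this⟩

theorem exists_proj_eq [Nonempty F] (S : SymplecticFibration EN EP p σ) (u : N) :
    ∃ x, p x = u := by
  obtain ⟨e, he, hu⟩ := S.covers u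
  exact ⟨_, proj_fiberEmbedding hu (Classical.arbitrary F)⟩

theorem pullback_two_apply (β : Form EN N 2) (x : P) (a b : EP) :
    (Form.pullback (E := EP) p β x : EP [⋀^Fin 2]→L[ℝ] ℝ) ![a, b]
      = (β (p x) : EN [⋀^Fin 2]→L[ℝ] ℝ) ![dProj EN EP p x a, dProj EN EP p x b] :=
  comp_two_apply (E := EN) (β (p x)) (dProj EN EP p x) a b

theorem form_two_ext {E : Type*} [NormedAddCommGroup E] [NormedSpace ℝ E]
    {η η' : E [⋀^Fin 2]→L[ℝ] ℝ} (h : ∀ a b, η ![a, b] = η' ![a, b]) : η = η' := by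
  ext v
  have hv : v = ![v 0, v 1] := by
    funext i; fin_cases i <;> rfl
  rw [hv]
  exact h _ _

theorem pullback_proj_injective [Nonempty F] (S : SymplecticFibration EN EP p σ) :
    Function.Injective (Form.pullback (E := EP) (E' := EN) p : Form EN N 2 → Form EP P 2) := by
  intro β β' h
  funext u
  obtain ⟨x, rfl⟩ := exists_proj_eq S u
  refine form_two_ext (E := EN) fun v w => ?_
  obtain ⟨a, rfl⟩ := exists_dProj_eq S x v
  obtain ⟨b, rfl⟩ := exists_dProj_eq S x w
  exact (pullback_two_apply β x a b).symm.trans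
    ((congrArg (fun τ : Form EP P 2 => (τ x : EP [⋀^Fin 2]→L[ℝ] ℝ) ![a, b]) h).trans
      (pullback_two_apply β' x a b))

/-- The inverse of a chart of the base factors through the projection of the total space. -/
theorem inChart_eventuallyEq {e : Bundle.Trivialization F p} (he : e ∈ S.atlas) {u : N}
    (hu : u ∈ e.baseSet) (y : F) {k : ℕ} (β : Form EN N k) :
    β.inChart u =ᶠ[𝓝 (extChartAt 𝓘(ℝ, EN) u u)] (Form.pullback (E := EP) p β).along
      fun t => prodChart EN EF e u y (t, extChartAt 𝓘(ℝ, EF) y y) := by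
  filter_upwards [isOpen_baseDomain.mem_nhds (center_mem_baseDomain hu)] with t ht
  have ho : ∀ {t}, t ∈ baseDomain EN e u →
      (t, extChartAt 𝓘(ℝ, EF) y y) ∈ prodDomain EN EF e u y := fun ht =>
    ⟨ht, mem_extChartAt_target y⟩
  have hs : MDifferentiableAt 𝓘(ℝ, EN) 𝓘(ℝ, EP)
      (fun t : EN => prodChart EN EF e u y (t, extChartAt 𝓘(ℝ, EF) y y)) t :=
    MDifferentiableAt.comp t (mdifferentiableAt_prodChart S he (ho ht))
      (f := fun t : EN => (t, extChartAt 𝓘(ℝ, EF) y y))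
      (differentiableAt_id.prodMk (differentiableAt_const _)).mdifferentiableAt
  have h := Form.pullback_comp_apply (E := EN) β (x := t)
    (S.contMDiff_proj.mdifferentiableAt (by simp)) hs
  rw [Form.along, ← h, Form.inChart_eq_pullback]
  refine Form.pullback_congr β ?_
  filter_upwards [isOpen_baseDomain.mem_nhds ht] with t ht
  exact (proj_prodChart (ho ht)).symm

/-- Fixing the fiber coordinate gives smooth local sections of `p`, and pulling `p^*β` back along
them recovers `β` in a chart. Smoothness and closedness are inherited. -/
theorem mem_closedForms_of_pullback [Nonempty F] (S : SymplecticFibration EN EP p σ) {k : ℕ}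
    {β : Form EN N k} (h : Form.pullback p β ∈ closedForms EP P k) : β ∈ closedForms EN N k := by
  have key : ∀ u : N, ∃ f : EN → P, ∃ U, IsOpen U ∧ ContMDiffOn 𝓘(ℝ, EN) 𝓘(ℝ, EP) ∞ f U ∧
      extChartAt 𝓘(ℝ, EN) u u ∈ U ∧ β.inChart u =ᶠ[𝓝 (extChartAt 𝓘(ℝ, EN) u u)]
        (Form.pullback (E := EP) p β).along f := by
    intro u
    obtain ⟨e, he, hu⟩ := S.covers u
    let y : F := Classical.arbitrary F
    refine ⟨_, baseDomain EN e u, isOpen_baseDomain, ?_, center_mem_baseDomain hu,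
      inChart_eventuallyEq S he hu y β⟩
    exact (contMDiffOn_prodChart S he).comp
      (contDiff_id.prodMk contDiff_const).contMDiff.contMDiffOn
      fun t ht => ⟨ht, mem_extChartAt_target y⟩
  refine ⟨Form.isSmooth_of_center fun u => ?_, funext fun u => Form.d_eq_of_center ?_⟩
  · obtain ⟨f, U, hU, hf, hu, hev⟩ := key u
    exact ((h.1.along_contDiffOn hU hf).contDiffAt (hU.mem_nhds hu)).congr_of_eventuallyEq hev
  · obtain ⟨f, U, hU, hf, hu, hev⟩ := key u
    rw [hev.extDeriv_eq, h.1.extDeriv_along hU hf hu, h.2]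
    rfl

theorem form_two_apply_eq {E E' : Type*} [NormedAddCommGroup E] [NormedSpace ℝ E]
    [NormedAddCommGroup E'] [NormedSpace ℝ E'] {η : E [⋀^Fin 2]→L[ℝ] ℝ} {T : E →L[ℝ] E'}
    (hη : ∀ a, T a = 0 → ∀ b, η ![a, b] = 0) {a a' b b' : E} (ha : T a = T a') (hb : T b = T b') :
    η ![a, b] = η ![a', b'] := by
  have h : ∀ {a a' : E}, T a = T a' → ∀ b, η ![a, b] = η ![a', b] := fun {a a'} h b => by
    rw [← sub_eq_zero, ← form_two_sub_left]
    exact hη _ (by rw [map_sub, h, sub_self]) b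
  rw [h ha, form_two_swap, h hb, ← form_two_swap]

/-- A form is horizontal if it vanishes when one of its arguments is tangent to the fibers. -/
def IsHorizontal (EN : Type*) [NormedAddCommGroup EN] [NormedSpace ℝ EN]
    [ChartedSpace EN N] (p : P → N) (τ : Form EP P 2) : Prop :=
  ∀ x, ∀ a ∈ vertical EN EP p x, ∀ b : EP,
    (τ x : EP [⋀^Fin 2]→L[ℝ] ℝ) ![(a : EP), b] = 0

theorem isHorizontal_pullback (β : Form EN N 2) : IsHorizontal EN p (Form.pullback (E := EP) p β) :=
  fun x a ha b => by
    refine (pullback_two_apply (EP := EP) β x a b).trans ?_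
    rw [show dProj EN EP p x a = 0 from ha]
    exact (β (p x) : EN [⋀^Fin 2]→L[ℝ] ℝ).map_coord_zero 0 rfl

theorem IsHorizontal.apply_eq (hτ : IsHorizontal EN p τ) {x : P} {a a' b b' : EP}
    (ha : dProj EN EP p x a = dProj EN EP p x a') (hb : dProj EN EP p x b = dProj EN EP p x b') :
    (τ x : EP [⋀^Fin 2]→L[ℝ] ℝ) ![a, b] = (τ x : EP [⋀^Fin 2]→L[ℝ] ℝ) ![a', b'] :=
  form_two_apply_eq (E := EP) (T := dProj EN EP p x) (hτ x) ha hb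

/-- In the expansion of `dη((0, c), v, w) = 0` the other two terms differentiate values of `η` with
`(0, c)` in one slot, and these vanish near `o`. -/
theorem fderiv_eq_zero_of_horizontal {V Z : Type*} [NormedAddCommGroup V] [NormedSpace ℝ V]
    [NormedAddCommGroup Z] [NormedSpace ℝ Z] {η : V × Z → (V × Z) [⋀^Fin 2]→L[ℝ] ℝ} {o : V × Z}
    (hη : DifferentiableAt ℝ η o) (hd : extDeriv η o = 0)
    (h : ∀ᶠ o' in 𝓝 o, ∀ c b, η o' ![(0, c), b] = 0) (c : Z) (v w : V × Z) :
    fderiv ℝ η o (0, c) ![v, w] = 0 := by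
  have h1 : ∀ b x, fderiv ℝ η o x ![(0, c), b] = 0 := fun b x => by
    have h0 : (fun o' => η o' ![(0, c), b]) =ᶠ[𝓝 o] fun _ => 0 := by
      filter_upwards [h] with o' h
      exact h c b
    rw [← fderiv_alternating_apply_const hη, h0.fderiv_eq]
    simp
  have h2 := extDeriv_two_apply η o (0, c) v w
  rw [hd, h1, h1] at h2
  have h0 : (0 : (V × Z) [⋀^Fin 3]→L[ℝ] ℝ) ![(0, c), v, w] = 0 := rfl
  linarith

variable (hnd : FiberwiseNondegenerate EN p Ω)

/-- The values of a closed horizontal form on horizontal lifts are constant along the fibers. -/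
theorem IsHorizontal.isLocallyConstant (hnd : FiberwiseNondegenerate EN p Ω)
    (hτ : IsHorizontal EN p τ) (hcl : τ ∈ closedForms EP P 2)
    {e : Bundle.Trivialization F p} (he : e ∈ S.atlas) {u : N} (hu : u ∈ e.baseSet) (ν ν' : EN) :
    IsLocallyConstant fun y => (τ (fiberEmbedding e u y) : EP [⋀^Fin 2]→L[ℝ] ℝ)
      ![(lift S hnd 0 (fiberEmbedding e u y) ν : EP), (lift S hnd 0 (fiberEmbedding e u y) ν' : EP)] := by
  rw [IsLocallyConstant.iff_eventually_eq]
  intro y₀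
  obtain ⟨v, rfl⟩ := (dBase_bijective (mem_extChartAt_target (I := 𝓘(ℝ, EN)) u)).2 ν
  obtain ⟨w, rfl⟩ := (dBase_bijective (mem_extChartAt_target (I := 𝓘(ℝ, EN)) u)).2 ν'
  set t := extChartAt 𝓘(ℝ, EN) u u with ht
  set Ψ := prodChart EN EF e u y₀ with hΨ
  have ho : ∀ z ∈ (extChartAt 𝓘(ℝ, EF) y₀).target, (t, z) ∈ prodDomain EN EF e u y₀ :=
    fun z hz => ⟨center_mem_baseDomain hu, hz⟩
  have hdiff : ∀ z ∈ (extChartAt 𝓘(ℝ, EF) y₀).target, DifferentiableAt ℝ (τ.along Ψ) (t, z) :=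
    fun z hz => ((contDiffOn_along_prodChart S he hcl.1).contDiffAt
      (isOpen_prodDomain.mem_nhds (ho z hz))).differentiableAt (by simp)
  -- A horizontal form depends only on the projections of its arguments, so the lifts may be
  -- replaced by the constant coordinate vectors `(v, 0)` and `(w, 0)`.
  let g : EF → ℝ := fun z => τ.along Ψ (t, z) ![(v, 0), (w, 0)]
  have hg : ∀ z ∈ (extChartAt 𝓘(ℝ, EF) y₀).target, HasFDerivAt g (0 : EF →L[ℝ] ℝ) z := by
    intro z hz
    have h1 : DifferentiableAt ℝ (fun o => τ.along Ψ o ![(v, 0), (w, 0)]) (t, z) :=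
      ContDiffAt.differentiableAt (n := ∞) (ContDiffWithinAt.alternating_apply (s := univ)
        ((contDiffOn_along_prodChart S he hcl.1).contDiffAt (isOpen_prodDomain.mem_nhds (ho z hz)))
        contDiffWithinAt_const) (by simp)
    have h2 := h1.hasFDerivAt.comp z (hasFDerivAt_prodMk_right t z)
    refine h2.congr_fderiv ?_
    ext c
    change fderiv ℝ (fun o => τ.along Ψ o ![(v, 0), (w, 0)]) (t, z) (0, c) = 0
    rw [fderiv_alternating_apply_const (hdiff z hz)]
    refine fderiv_eq_zero_of_horizontal (hdiff z hz)
      (extDeriv_along_prodChart_of_closed S he hcl (ho z hz)) ?_ c _ _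
    filter_upwards [isOpen_prodDomain.mem_nhds (ho z hz)] with o ho c b
    rw [along_prodChart_two]
    exact hτ _ _ ((mem_vertical_iff S he ho _).2 ⟨c, rfl⟩) _
  have hval : ∀ y ∈ (extChartAt 𝓘(ℝ, EF) y₀).source,
      (τ (fiberEmbedding e u y) : EP [⋀^Fin 2]→L[ℝ] ℝ)
        ![(lift S hnd 0 (fiberEmbedding e u y) (dBase EN u t v) : EP),
          (lift S hnd 0 (fiberEmbedding e u y) (dBase EN u t w) : EP)]
        = g (extChartAt 𝓘(ℝ, EF) y₀ y) := by
    intro y hy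
    have hz := (extChartAt 𝓘(ℝ, EF) y₀).map_source hy
    have hx : Ψ (t, extChartAt 𝓘(ℝ, EF) y₀ y) = fiberEmbedding e u y := by
      simp only [hΨ, prodChart, fiberChart, ht]
      rw [extChartAt_to_inv, (extChartAt 𝓘(ℝ, EF) y₀).left_inv hy]
    rw [← hx]
    refine (hτ.apply_eq ?_ ?_).trans (along_prodChart_two τ _ _).symm
    · exact (lift_spec S hnd 0 _ _).1.trans (dProj_dChart S he (ho _ hz) (v, 0)).symm
    · exact (lift_spec S hnd 0 _ _).1.trans (dProj_dChart S he (ho _ hz) (w, 0)).symm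
  -- The chart target need not be connected, so the vanishing derivative is integrated on a ball
  -- inside it.
  obtain ⟨r, hr, hball⟩ := Metric.isOpen_iff.1 (isOpen_extChartAt_target (I := 𝓘(ℝ, EF)) y₀) _
    (mem_extChartAt_target y₀)
  filter_upwards [extChartAt_source_mem_nhds (I := 𝓘(ℝ, EF)) y₀,
    (continuousAt_extChartAt (I := 𝓘(ℝ, EF)) y₀).preimage_mem_nhds (Metric.ball_mem_nhds _ hr)]
    with y hy hyr
  rw [hval y hy, hval y₀ (mem_extChartAt_source y₀)]
  exact Metric.isOpen_ball.is_const_of_fderiv_eq_zero (𝕜 := ℝ) (convex_ball _ r).isPreconnected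
    (fun z hz => (hg z (hball hz)).differentiableAt.differentiableWithinAt)
    (fun z hz => (hg z (hball hz)).fderiv) hyr (Metric.mem_ball_self hr)

theorem IsHorizontal.apply_eq_of_proj_eq [PreconnectedSpace F] (hnd : FiberwiseNondegenerate EN p Ω)
    (S : SymplecticFibration EN EP p σ)
    (hτ : IsHorizontal EN p τ) (hcl : τ ∈ closedForms EP P 2) {x x' : P} (hx : p x = p x')
    (ν ν' : EN) :
    (τ x : EP [⋀^Fin 2]→L[ℝ] ℝ) ![(lift S hnd 0 x ν : EP), (lift S hnd 0 x ν' : EP)]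
      = (τ x' : EP [⋀^Fin 2]→L[ℝ] ℝ) ![(lift S hnd 0 x' ν : EP), (lift S hnd 0 x' ν' : EP)] := by
  obtain ⟨e, he, hu⟩ := S.covers (p x)
  have h := (hτ.isLocallyConstant S hnd hcl he hu ν ν').apply_eq_of_preconnectedSpace
    (e x).2 (e x').2
  rw [fiberEmbedding_apply hu] at h
  rw [hx] at h hu
  rwa [fiberEmbedding_apply hu] at h

/-- The horizontal lift as a linear map. -/
def liftMap (x : P) : EN →L[ℝ] EP :=
  LinearMap.toContinuousLinearMap
    { toFun := lift S hnd 0 x, map_add' := lift_add S hnd x, map_smul' := lift_smul S hnd x }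

/-- A closed horizontal form on the total space is the pullback of a unique closed form. -/
theorem IsHorizontal.existsUnique_pullback [ConnectedSpace F] (S : SymplecticFibration EN EP p σ)
    (hnd : FiberwiseNondegenerate EN p Ω)
    (hτ : IsHorizontal EN p τ) (hcl : τ ∈ closedForms EP P 2) :
    ∃! β : closedForms EN N 2, Form.pullback p (β : Form EN N 2) = τ := by
  -- A section without any regularity suffices: the values do not depend on the point of the fiber,
  -- and smoothness of `β` is deduced afterwards from that of its pullback.
  choose s hs using exists_proj_eq S
  let β : Form EN N 2 := fun u =>
    ContinuousAlternatingMap.compContinuousLinearMap (M := EP) (M' := EN) (τ (s u)) (liftMap S hnd (s u))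
  have hβ : Form.pullback p β = τ := by
    funext x
    refine form_two_ext (E := EP) fun a b => (pullback_two_apply β x a b).trans ?_
    refine (comp_two_apply (E := EP) (τ (s (p x))) (liftMap S hnd (s (p x))) _ _).trans ?_
    refine (hτ.apply_eq_of_proj_eq hnd S hcl (hs (p x)) (dProj EN EP p x a)
      (dProj EN EP p x b)).trans ?_
    exact hτ.apply_eq (lift_spec S hnd 0 x _).1 (lift_spec S hnd 0 x _).1
  refine ⟨⟨β, mem_closedForms_of_pullback S (by rw [hβ]; exact hcl)⟩, hβ, fun β' hβ' => ?_⟩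
  exact Subtype.ext (pullback_proj_injective S (hβ'.trans hβ.symm))

end BasicForms

/-! ### Forms with the same distribution and their cohomology classes -/

section Classification

variable {EN : Type*} [NormedAddCommGroup EN] [NormedSpace ℝ EN] [FiniteDimensional ℝ EN]
  {EF : Type*} [NormedAddCommGroup EF] [NormedSpace ℝ EF] [FiniteDimensional ℝ EF]
  {EP : Type*} [NormedAddCommGroup EP] [NormedSpace ℝ EP]
  {N : Type*} [TopologicalSpace N] [ChartedSpace EN N] [IsManifold 𝓘(ℝ, EN) ∞ N]
  {F : Type*} [TopologicalSpace F] [ChartedSpace EF F] [IsManifold 𝓘(ℝ, EF) ∞ F]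
  {P : Type*} [TopologicalSpace P] [ChartedSpace EP P] [IsManifold 𝓘(ℝ, EP) ∞ P]
  {p : P → N} {σ : Form EF F 2}

/-- The vector `c` over the projection of `b` lies in the common distribution, so both forms vanish
on it paired with `a`. The remainder `b - c` is vertical, where the two forms agree. -/
theorem isHorizontal_sub (S : SymplecticFibration EN EP p σ) {Ω Ω' : closedForms EP P 2}
    (hnd : FiberwiseNondegenerate EN p (Ω : Form EP P 2))
    (h : Ω' ∈ sameFiberAndDistribution EN p (Ω : Form EP P 2)) :
    IsHorizontal EN p ((Ω : Form EP P 2) - (Ω' : Form EP P 2)) := by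
  intro x a ha b
  obtain ⟨c, hc⟩ := exists_isSolution S hnd 0 x (dProj EN EP p x b)
  have hc1 : c ∈ distribution EN p (Ω : Form EP P 2) x := hc.2
  have hc2 : c ∈ distribution EN p (Ω' : Form EP P 2) x := by rwa [h.2 x]
  have hv : b - c ∈ vertical EN EP p x := by
    change dProj EN EP p x (b - c) = 0
    rw [map_sub, hc.1, sub_self]
  have h1 := h.1 x (b - c) hv a ha
  have key : ∀ (η η' : EP [⋀^Fin 2]→L[ℝ] ℝ) (a : EP), η ![c, a] = 0 → η' ![c, a] = 0 →
      η' ![b - c, a] = η ![b - c, a] → (η - η') ![a, b] = 0 := by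
    intro η η' a h1 h2 h3
    rw [form_two_sub_left, form_two_sub_left, h1, h2] at h3
    rw [form_two_swap]
    change -(η ![b, a] - η' ![b, a]) = 0
    linarith
  exact key _ _ a (hc1 a ha) (hc2 a ha) h1

theorem pullback_mem_closedForms {β : Form EN N 2} (hp : ContMDiff 𝓘(ℝ, EP) 𝓘(ℝ, EN) ∞ p)
    [FiniteDimensional ℝ EP] (hβ : β ∈ closedForms EN N 2) :
    Form.pullback (E := EP) p β ∈ closedForms EP P 2 := by
  refine ⟨hβ.1.pullback hp, ?_⟩
  rw [hβ.1.d_pullback hp, hβ.2]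
  rfl

/-- A pullback from the base vanishes on vertical vectors, so subtracting it changes neither the
restriction to the fibers nor the orthogonality conditions that define the distribution. -/
theorem mem_sameFiberAndDistribution {Ω Ω' : closedForms EP P 2} {β : Form EN N 2}
    (h : Form.pullback p β = (Ω : Form EP P 2) - (Ω' : Form EP P 2)) :
    Ω' ∈ sameFiberAndDistribution EN p (Ω : Form EP P 2) := by
  have hv : ∀ x, ∀ a ∈ vertical EN EP p x, ∀ b : EP,
      (Ω' : Form EP P 2) x ![(a : EP), b] = (Ω : Form EP P 2) x ![(a : EP), b] := by
    intro x a ha b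
    have h1 := isHorizontal_pullback (EP := EP) (p := p) β x a ha b
    rw [h] at h1
    exact (sub_eq_zero.1 h1).symm
  refine ⟨fun x a ha b _ => hv x a ha b, fun x => Set.ext fun a => ?_⟩
  refine forall₂_congr fun y hy => ?_
  have h2 := hv x y hy a
  have key : ∀ (η η' : EP [⋀^Fin 2]→L[ℝ] ℝ) (a y : EP), η' ![y, a] = η ![y, a] →
      (η' ![a, y] = 0 ↔ η ![a, y] = 0) := by
    intro η η' a y h
    rw [form_two_swap η', form_two_swap η, h]
  exact key _ _ a y h2

theorem cohomologyClass_eq_iff {E : Type*} [NormedAddCommGroup E] [NormedSpace ℝ E]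
    {M : Type*} [TopologicalSpace M] [ChartedSpace E M] {α β : closedForms E M 2} :
    cohomologyClass α = cohomologyClass β ↔ (α : Form E M 2) - (β : Form E M 2) ∈ exactForms E M 1 :=
  Submodule.Quotient.eq _

/-- Closed forms on the base are cohomologous if and only if their pullbacks are. -/
theorem cohomologyClass_eq_iff_of_pullback [FiniteDimensional ℝ EP] [T2Space F] [CompactSpace F]
    [Nonempty F] (S : SymplecticFibration EN EP p σ) {Ω : closedForms EP P 2}
    (hnd : FiberwiseNondegenerate EN p (Ω : Form EP P 2)) {Ω₁ Ω₂ : closedForms EP P 2}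
    {β₁ β₂ : closedForms EN N 2}
    (h₁ : Form.pullback p (β₁ : Form EN N 2) = (Ω : Form EP P 2) - (Ω₁ : Form EP P 2))
    (h₂ : Form.pullback p (β₂ : Form EN N 2) = (Ω : Form EP P 2) - (Ω₂ : Form EP P 2)) :
    cohomologyClass β₁ = cohomologyClass β₂ ↔ cohomologyClass Ω₁ = cohomologyClass Ω₂ := by
  have h : Form.pullback p ((β₁ : Form EN N 2) - (β₂ : Form EN N 2))
      = (Ω₂ : Form EP P 2) - (Ω₁ : Form EP P 2) := by
    rw [Form.pullback_sub, h₁, h₂, sub_sub_sub_cancel_left]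
  rw [eq_comm (a := cohomologyClass Ω₁), cohomologyClass_eq_iff, cohomologyClass_eq_iff, ← h]
  constructor
  · rintro ⟨γ, hγ, hd⟩
    exact ⟨Form.pullback p γ, hγ.pullback S.contMDiff_proj, by
      rw [hγ.d_pullback S.contMDiff_proj, hd]⟩
  · intro h
    borelize EF
    exact mem_exactForms_of_pullback S Ω.2 hnd h

end Classification

end SympFib

end

/-! ### The bijection of cohomology classes -/

open SympFib
theorem proposition2p5p2
    {EN : Type*} [NormedAddCommGroup EN] [NormedSpace ℝ EN] [FiniteDimensional ℝ EN]
    {EF : Type*} [NormedAddCommGroup EF] [NormedSpace ℝ EF] [FiniteDimensional ℝ EF]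
    {EP : Type*} [NormedAddCommGroup EP] [NormedSpace ℝ EP] [FiniteDimensional ℝ EP]
    {N : Type*} [TopologicalSpace N] [ChartedSpace EN N] [IsManifold 𝓘(ℝ, EN) ∞ N]
    [T2Space N] [SecondCountableTopology N]
    {F : Type*} [TopologicalSpace F] [ChartedSpace EF F] [IsManifold 𝓘(ℝ, EF) ∞ F]
    [T2Space F] [CompactSpace F] [ConnectedSpace F]
    {P : Type*} [TopologicalSpace P] [ChartedSpace EP P] [IsManifold 𝓘(ℝ, EP) ∞ P]
    [T2Space P] [SecondCountableTopology P]
    (p : P → N) (σ : Form EF F 2) (S : SymplecticFibration EN EP p σ)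
    (Ω : closedForms EP P 2) (hext : S.Extends (Ω : Form EP P 2))
    (hnd : FiberwiseNondegenerate EN p (Ω : Form EP P 2)) :
    (∀ Ω' ∈ sameFiberAndDistribution EN p (Ω : Form EP P 2),
      ∃! β : closedForms EN N 2,
        Form.pullback p (β : Form EN N 2) = (Ω : Form EP P 2) - (Ω' : Form EP P 2)) ∧
    ∃ Φ : (cohomologyClass '' sameFiberAndDistribution EN p (Ω : Form EP P 2)) ≃ H2 EN N,
      ∀ (Ω' : closedForms EP P 2)
        (hΩ' : Ω' ∈ sameFiberAndDistribution EN p (Ω : Form EP P 2))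
        (β : closedForms EN N 2),
        Form.pullback p (β : Form EN N 2) = (Ω : Form EP P 2) - (Ω' : Form EP P 2) →
          Φ ⟨cohomologyClass Ω', Set.mem_image_of_mem cohomologyClass hΩ'⟩
            = cohomologyClass β := by
  have hex : ∀ Ω' ∈ sameFiberAndDistribution EN p (Ω : Form EP P 2),
      ∃! β : closedForms EN N 2,
        Form.pullback p (β : Form EN N 2) = (Ω : Form EP P 2) - (Ω' : Form EP P 2) := fun Ω' h =>
    (isHorizontal_sub S hnd h).existsUnique_pullback S hnd (sub_mem Ω.2 Ω'.2)
  refine ⟨hex, ?_⟩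
  let A := cohomologyClass '' sameFiberAndDistribution EN p (Ω : Form EP P 2)
  -- Each class gets a representative with its form on the base;
  -- `cohomologyClass_eq_iff_of_pullback` makes the resulting class independent of this choice, and
  -- its other direction gives injectivity.
  have hc : ∀ c : A, ∃ (Ω' : closedForms EP P 2) (β : closedForms EN N 2),
      cohomologyClass Ω' = c ∧
        Form.pullback p (β : Form EN N 2) = (Ω : Form EP P 2) - (Ω' : Form EP P 2) := by
    rintro ⟨_, Ω', hΩ', rfl⟩
    obtain ⟨β, hβ, -⟩ := hex Ω' hΩ'
    exact ⟨Ω', β, rfl, hβ⟩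
  choose f g hf hg using hc
  have hbij : Function.Bijective fun c : A => cohomologyClass (g c) := by
    constructor
    · intro c c' h
      have := (cohomologyClass_eq_iff_of_pullback S hnd (hg c) (hg c')).1 h
      rw [hf, hf] at this
      exact Subtype.ext this
    · intro b
      obtain ⟨β, rfl⟩ := Submodule.Quotient.mk_surjective _ b
      -- The preimage of the class of `β` is the class of `Ω - p^*β`.
      let Ω' : closedForms EP P 2 :=
        Ω - ⟨Form.pullback p (β : Form EN N 2), pullback_mem_closedForms S.contMDiff_proj β.2⟩
      have hβ : Form.pullback p (β : Form EN N 2) = (Ω : Form EP P 2) - (Ω' : Form EP P 2) :=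
        (sub_sub_cancel _ _).symm
      let c : A := ⟨cohomologyClass Ω', Ω', mem_sameFiberAndDistribution hβ, rfl⟩
      exact ⟨c, (cohomologyClass_eq_iff_of_pullback S hnd (hg c) hβ).2 (hf c)⟩
  refine ⟨Equiv.ofBijective _ hbij, fun Ω' hΩ' β hβ => ?_⟩
  exact (cohomologyClass_eq_iff_of_pullback S hnd (hg _) hβ).2 (hf _)
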